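/- Call $\delta\in \mathrm{SL}_3(\mathbb{R})$ *hyperbolic* if it is conjugate to $\mathrm{diag}(a,b,c)$ with $a>b>c>0$, $abc=1$; *quasi-hyperbolic* if it is conjugate to $\begin{pmatrix}\alpha&1&0\\0&\alpha&0\\0&0&\beta\end{pmatrix}$ with $\alpha,\beta>0$, $\alpha^2\beta=1$, $\alpha,\beta\neq1$; *parabolic* if it is conjugate to $\begin{pmatrix}1&1&0\\0&1&1\\0&0&1\end{pmatrix}$. If all eigenvalues $\lambda_1\le\lambda_2\le\lambda_3$ of $\gamma$ (with multiplicity) are real and positive, put $\lambda(\gamma)=\lambda_1$ and $\tau(\gamma)=\lambda_2+\lambda_3$. A *closed triangle* in $\mathbb{P}^2(\mathbb{R})$ is the image of the nonzero vectors of a cone $\{t_1v_1+t_2v_2+t_3v_3 : t_i\ge0\}$, where $(v_1,v_2,v_3)$ is a basis of $\mathbb{R}^3$; its *vertices* are the three points $[v_i]$, its *open edges* the three open segments with $t_i=0$ and the other two coefficients positive. A *punctured triangle* $T$ is a closed triangle $\overline{T}$ with its vertices removed. The space of punctured triangles has the quotient topology from the space of bases $(v_1,v_2,v_3)$, that is,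 its topology as a homogeneous space. Let $\delta_1,\delta_2,\delta_3\in \mathrm{SL}_3(\mathbb{R})$ each be hyperbolic, quasi-hyperbolic or parabolic. Let $\mathbb{Q}'_{\delta_1,\delta_2,\delta_3}$ be the set of tuples $(T_0,T_1,T_2,T_3,\gamma_1,\gamma_2,\gamma_3)$ such that 1. $T_0,\dots,T_3$ are punctured triangles in $\mathbb{P}^2(\mathbb{R})$, and $T_0\cap T_1$, $T_0\cap T_2$, $T_0\cap T_3$ are the three distinct open edges of $T_0$, $T_0\cap T_i$ being also an open edge of $T_i$; write $p_i$ for the vertex of $T_0$ opposite to $T_0\cap T_i$; 2. $\overline{T_0}\cup\overline{T_1}\cup\overline{T_2}\cup\overline{T_3}$ is, in some affine chart, a convex hexagon with exactly six sides; 3. $\gamma_1,\gamma_2,\gamma_3\in \mathrm{SL}_3(\mathbb{R})$ and $\gamma_3\gamma_2\gamma_1=1$; 4. $\gamma_1(T_2)=T_3$, $\gamma_2(T_3)=T_1$, $\gamma_3(T_1)=T_2$; 5. $\gamma_i$ is conjugate to $\delta_i$ in $\mathrm{SL}_3(\mathbb{R})$ for $i=1,2,3$; 6. $p_i$ is the fixed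 point of $\gamma_i$ belonging to its smallest eigenvalue, i.e. any lift $e_i\in\mathbb{R}^3$ of $p_i$ satisfies $\gamma_i e_i=\lambda(\gamma_i)e_i$, for $i=1,2,3$. Give $\mathbb{Q}'_{\delta_1,\delta_2,\delta_3}$ the topology induced by the product topology, and let $\mathbb{Q}_{\delta_1,\delta_2,\delta_3}$ be its quotient by the action $g\cdot(T_j,\gamma_i)=(gT_j,g\gamma_ig^{-1})$ of $\mathrm{SL}_3(\mathbb{R})$, with the quotient topology. Let $\mathcal{E}\subset\mathbb{R}^{14}$ be the set of all $(\rho_1,\rho_2,\rho_3,\sigma_1,\sigma_2,\kappa_1,\mu_1,\nu_1,\kappa_2,\mu_2,\nu_2,\kappa_3,\mu_3,\nu_3)$ with $\rho_i>1$ and $\sigma_1,\sigma_2,\kappa_i,\mu_i,\nu_i>0$ such that - $\sigma_1\sigma_2=\rho_1\rho_2\rho_3$; - $\kappa_1\mu_1\nu_1=\kappa_2\mu_2\nu_2=\kappa_3\mu_3\nu_3=1$; - $\kappa_1\nu_2\mu_3=\kappa_2\nu_3\mu_1=\kappa_3\nu_1\mu_2=1$; - $\kappa_i=\lambda(\delta_i)$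 for $i=1,2,3$; - $-\mu_i+\nu_i(\rho_i-1)=\tau(\delta_i)$ for $i=1,2,3$. Then there are continuous maps $\rho_i,\sigma_1,\sigma_2,\kappa_i,\mu_i,\nu_i:\mathbb{Q}_{\delta_1,\delta_2,\delta_3}\to\mathbb{R}$ ($i=1,2,3$) which together form a homeomorphism $\mathbb{Q}_{\delta_1,\delta_2,\delta_3}\to\mathcal{E}$. Moreover $\mathcal{E}$ is homeomorphic to $\mathbb{R}^2$, and hence so is $\mathbb{Q}_{\delta_1,\delta_2,\delta_3}$. -/

import Mathlib

open scoped LinearAlgebra.Projectivization Matrix MatrixGroups Pointwise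

noncomputable section

namespace ProjectivePants

/-- The real projective plane. The group `SL(3, ℝ)` acts on it through Mathlib's instance. -/
abbrev P2 : Type := ℙ ℝ (Fin 3 → ℝ)

/-! ### Conjugacy types in `SL(3, ℝ)`, and the invariants `λ`, `τ` -/

/-- `δ` is conjugate to `diag(a, b, c)` with `a > b > c > 0` and `a b c = 1`. -/
def IsHyperbolic (δ : SL(3, ℝ)) : Prop :=
  ∃ a b c : ℝ, a > b ∧ b > c ∧ c > 0 ∧ a * b * c = 1 ∧
    ∃ D : SL(3, ℝ), (D : Matrix (Fin 3) (Fin 3) ℝ) = !![a, 0, 0; 0, b, 0; 0, 0, c] ∧ IsConj δ D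

/-- `δ` is conjugate to a Jordan block of size 2 for `α` plus a block `β`,
where `α, β > 0`, `α² β = 1` and `α, β ≠ 1`. -/
def IsQuasiHyperbolic (δ : SL(3, ℝ)) : Prop :=
  ∃ α β : ℝ, 0 < α ∧ 0 < β ∧ α ^ 2 * β = 1 ∧ α ≠ 1 ∧ β ≠ 1 ∧
    ∃ D : SL(3, ℝ), (D : Matrix (Fin 3) (Fin 3) ℝ) = !![α, 1, 0; 0, α, 0; 0, 0, β] ∧ IsConj δ D

/-- `δ` is conjugate to the unipotent Jordan block of size 3. -/
def IsParabolic (δ : SL(3, ℝ)) : Prop :=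
  ∃ D : SL(3, ℝ), (D : Matrix (Fin 3) (Fin 3) ℝ) = !![1, 1, 0; 0, 1, 1; 0, 0, 1] ∧ IsConj δ D

/-- The real eigenvalues of `γ`, with algebraic multiplicity, in increasing order. -/
def eigenvalueList (γ : SL(3, ℝ)) : List ℝ :=
  (γ : Matrix (Fin 3) (Fin 3) ℝ).charpoly.roots.sort (· ≤ ·)

/-- `λ(γ) = λ₁`, where `λ₁ ≤ λ₂ ≤ λ₃` are the eigenvalues of `γ` (used when the spectrum of `γ`
is real and positive). -/
def lam (γ : SL(3, ℝ)) : ℝ := (eigenvalueList γ).getD 0 0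

/-- `τ(γ) = λ₂ + λ₃`, where `λ₁ ≤ λ₂ ≤ λ₃` are the eigenvalues of `γ` (used when the spectrum of
`γ` is real and positive). -/
def tau (γ : SL(3, ℝ)) : ℝ := (eigenvalueList γ).getD 1 0 + (eigenvalueList γ).getD 2 0

/-! ### Triangles in the projective plane

The columns of `M : GL (Fin 3) ℝ` are lifts of the three vertices of a triangle, and the triangle
is the image in `P2` of the cone of their nonnegative combinations. Every nondegenerate closed
triangle of an affine chart is of this form. -/

/-- The closed triangle spanned by the columns of `M`. -/
def closedTriangle (M : GL (Fin 3) ℝ) : Set P2 :=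
  {x | ∃ t : Fin 3 → ℝ, (∀ i, 0 ≤ t i) ∧
    ∃ h : (M : Matrix (Fin 3) (Fin 3) ℝ) *ᵥ t ≠ 0, x = Projectivization.mk ℝ _ h}

/-- The vertices of the triangle spanned by the columns of `M`. -/
def vertices (M : GL (Fin 3) ℝ) : Set P2 :=
  {x | ∃ i : Fin 3, ∃ h : (M : Matrix (Fin 3) (Fin 3) ℝ).col i ≠ 0, x = Projectivization.mk ℝ _ h}

/-- The punctured triangle: the closed triangle without its vertices. -/
def puncturedTriangle (M : GL (Fin 3) ℝ) : Set P2 := closedTriangle M \ vertices M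

/-- The open edge of the triangle of `M` opposite to the vertex given by column `i`. -/
def openEdge (M : GL (Fin 3) ℝ) (i : Fin 3) : Set P2 :=
  {x | ∃ t : Fin 3 → ℝ, t i = 0 ∧ (∀ j, j ≠ i → 0 < t j) ∧
    ∃ h : (M : Matrix (Fin 3) (Fin 3) ℝ) *ᵥ t ≠ 0, x = Projectivization.mk ℝ _ h}

/-- The set of all punctured triangles of the projective plane. -/
def PuncturedTriangle : Type := {T : Set P2 // ∃ M, puncturedTriangle M = T}

/-- The group `GL(3, ℝ)` acts transitively on punctured triangles; their space carries the topology
of this homogeneous space, i.e. the quotient topology from the space of triples of lifts of the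
vertices. -/
instance puncturedTriangleTopology : TopologicalSpace PuncturedTriangle :=
  TopologicalSpace.coinduced
    (fun M : GL (Fin 3) ℝ => (⟨puncturedTriangle M, M, rfl⟩ : PuncturedTriangle)) inferInstance

/-- `H` is a convex hexagon with exactly six sides: `H` lies in the affine chart `φ ≠ 0`, identified
with the affine plane `φ = 1` of `ℝ³`, and there it is the convex hull of six points none of which
is in the convex hull of the others. -/
def IsConvexHexagon (H : Set P2) : Prop :=
  ∃ (φ : Module.Dual ℝ (Fin 3 → ℝ)) (v : Fin 6 → Fin 3 → ℝ),
    (∀ k, φ (v k) = 1) ∧ ConvexIndependent ℝ v ∧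
    H = {x | ∃ y ∈ convexHull ℝ (Set.range v), ∃ h : y ≠ 0, x = Projectivization.mk ℝ y h}

/-! ### The combinatorial object

The indices `1, 2, 3` of `T₁, T₂, T₃` and `γ₁, γ₂, γ₃` are `0, 1, 2 : Fin 3`, and `i + 1`, `i + 2`
are taken modulo 3. The triangle `T₀` is kept apart. -/

/-- `M₀` and `M` are lifts of the vertices of `T₀` and of `T₁, T₂, T₃` which exhibit
`(T₀, T₁, T₂, T₃)` as a hexagon: `T₀` meets each `Tᵢ` exactly along the edge of index `i` of `T₀`,
which is also an edge of `Tᵢ`, and the union of the closed triangles is a convex hexagon. Column `i`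
of `M₀` is then a lift of the vertex `pᵢ` of `T₀` opposite to `T₀ ∩ Tᵢ`. -/
structure IsHexagonFrame (M₀ : GL (Fin 3) ℝ) (M : Fin 3 → GL (Fin 3) ℝ)
    (T₀ : PuncturedTriangle) (T : Fin 3 → PuncturedTriangle) : Prop where
  center_eq : T₀.1 = puncturedTriangle M₀
  outer_eq : ∀ i, (T i).1 = puncturedTriangle (M i)
  inter_eq : ∀ i, T₀.1 ∩ (T i).1 = openEdge M₀ i
  edge_eq : ∀ i, openEdge M₀ i = openEdge (M i) i
  hexagon : IsConvexHexagon (closedTriangle M₀ ∪ ⋃ i, closedTriangle (M i))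

/-- The space `ℚ'` of tuples `(T₀, T₁, T₂, T₃, γ₁, γ₂, γ₃)`, with the topology induced by the
product. The last clause says that the vertex `pᵢ` of `T₀` is the fixed point of `γᵢ` belonging to
its smallest eigenvalue. -/
def QPrime (δ : Fin 3 → SL(3, ℝ)) : Type :=
  {x : PuncturedTriangle × (Fin 3 → PuncturedTriangle) × (Fin 3 → SL(3, ℝ)) //
    x.2.2 2 * x.2.2 1 * x.2.2 0 = 1 ∧
    (∀ i : Fin 3, x.2.2 i • (x.2.1 (i + 1)).1 = (x.2.1 (i + 2)).1) ∧
    (∀ i, IsConj (x.2.2 i) (δ i)) ∧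
    ∃ (M₀ : GL (Fin 3) ℝ) (M : Fin 3 → GL (Fin 3) ℝ), IsHexagonFrame M₀ M x.1 x.2.1 ∧
      ∀ i, x.2.2 i • (M₀ : Matrix (Fin 3) (Fin 3) ℝ).col i =
        lam (x.2.2 i) • (M₀ : Matrix (Fin 3) (Fin 3) ℝ).col i}

instance (δ : Fin 3 → SL(3, ℝ)) : TopologicalSpace (QPrime δ) :=
  inferInstanceAs (TopologicalSpace (Subtype _))

/-- Being in the same orbit of `SL(3, ℝ)`, where `g` sends `(Tᵢ, γᵢ)` to `(g Tᵢ, g γᵢ g⁻¹)`. -/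
instance orbitSetoid (δ : Fin 3 → SL(3, ℝ)) : Setoid (QPrime δ) where
  r x y := ∃ g : SL(3, ℝ), y.1.1.1 = g • x.1.1.1 ∧
    (∀ i, (y.1.2.1 i).1 = g • (x.1.2.1 i).1) ∧
    ∀ i, y.1.2.2 i = g * x.1.2.2 i * g⁻¹
  iseqv :=
    { refl := fun x => ⟨1, by simp, fun i => by simp, fun i => by simp⟩
      symm := by
        rintro x y ⟨g, h₀, h, hc⟩
        refine ⟨g⁻¹, by rw [h₀, inv_smul_smul], fun i => by rw [h i, inv_smul_smul], fun i => ?_⟩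
        rw [hc i]
        group
      trans := by
        rintro x y z ⟨g, h₀, h, hc⟩ ⟨g', h₀', h', hc'⟩
        refine ⟨g' * g, by rw [h₀', h₀, mul_smul], fun i => by rw [h' i, h i, mul_smul],
          fun i => ?_⟩
        rw [hc' i, hc i]
        group }

/-- The space `ℚ = ℚ' / SL(3, ℝ)`, with the quotient topology. -/
abbrev Q (δ : Fin 3 → SL(3, ℝ)) : Type := Quotient (orbitSetoid δ)

/-- `ℝ¹⁴`, with coordinates `(ρ, σ, κ, μ, ν)`. -/
abbrev Coords : Type :=
  (Fin 3 → ℝ) × (Fin 2 → ℝ) × (Fin 3 → ℝ) × (Fin 3 → ℝ) × (Fin 3 → ℝ)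

/-- The semialgebraic set `𝓔`. -/
def E (δ : Fin 3 → SL(3, ℝ)) : Set Coords :=
  {x | match x with
    | (ρ, σ, κ, μ, ν) =>
      (∀ i, 1 < ρ i) ∧ (∀ j, 0 < σ j) ∧ (∀ i, 0 < κ i) ∧ (∀ i, 0 < μ i) ∧ (∀ i, 0 < ν i) ∧
      σ 0 * σ 1 = ρ 0 * ρ 1 * ρ 2 ∧
      (∀ i, κ i * μ i * ν i = 1) ∧
      (∀ i : Fin 3, κ i * ν (i + 1) * μ (i + 2) = 1) ∧
      (∀ i, κ i = lam (δ i)) ∧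
      (∀ i, -μ i + ν i * (ρ i - 1) = tau (δ i))}

end ProjectivePants

end

open scoped LinearAlgebra.Projectivization Matrix MatrixGroups Pointwise

noncomputable section

namespace ProjectivePants

/-! ### Rigidity of simplicial cones -/

section Rigidity

variable {ι V : Type*} [Fintype ι] [AddCommGroup V] [Module ℝ V]

/-! The set of points of a triangle determines lifts of its vertices up to order, positive factors
and a common sign, because a nonnegative matrix whose inverse is nonnegative up to sign is monomial
(`cone_rigidity`). This turns every condition on triangles into equations between vectors. With
lifts `e i` of the vertices of `T₀`, indices modulo 3, the outer vertex of `Tᵢ` can be scaled to `-e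
i + b i • e (i + 1) + c i • e (i + 2)`, and the hexagon is convex exactly when `b i, c i > 0` and `ρ
i = b (i + 1) * c (i + 2) > 1` (`exists_apex`, and conversely `isConvexHexagon_std`). Since `γ i`
fixes the line of `e i`, it can match the other two vertices of its source and target triangles in
only two ways, and the relation between the three maps excludes one of them. What remains are the
formulas of `IsStd`, with positive factors `κ, μ, ν` (`exists_isStd`).

In the basis `e i, e (i + 1), e (i + 2)` the map `γ i` is block triangular: the eigenvalue `κ i`,
then a block of trace `-μ i + ν i * (ρ i - 1)` and determinant `μ i * ν i`. Determinant one, the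
product relation and the characteristic polynomial become the equations of `E`. The characteristic
polynomial settles the conjugacy class: the three allowed types and all the `γ i` have cyclic
vectors, so equal polynomials give a common companion matrix, and real cube roots bring the
conjugator into `SL(3, ℝ)` (`isConj_of_cyclic`).

The eigenspace of `γ i` for `κ i` is a line, so `e` is unique up to three scalars
(`IsStd.eq_smul_of_fix`). The invariants of this rescaling are `ρ`, `c 0 * c 1 * c 2` and `b 0 * b 1
* b 2`; setting `b 0 = b 1 = 1` and `e` standard gives an inverse to the coordinate map. Continuity
of the coordinates uses the gluing maps alone: locally, columns of an adjugate are eigenvectors, and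
`b, c, ν` are quotients of determinants in them. The inverse is continuous because frames depend
continuously on the parameters.

Finally, `E` is solved explicitly in terms of `μ 0` and `σ 0`. These range over all positive
numbers, since `τ > 0` makes `ρ > 1` automatic, and logarithms give the plane. -/

theorem sum_smul_inj {u : ι → V} (hu : LinearIndependent ℝ u) {a b : ι → ℝ}
    (h : ∑ i, a i • u i = ∑ i, b i • u i) (k : ι) : a k = b k := by
  have h0 : ∑ i, (a i - b i) • u i = 0 := by
    simp only [sub_smul, Finset.sum_sub_distrib, h, sub_self]
  exact sub_eq_zero.1 (Fintype.linearIndependent_iff.1 hu _ h0 k)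

theorem nonneg_of_forall_pos_add {a b : ℝ} (h : ∀ η : ℝ, 0 < η → 0 ≤ a + η * b) : 0 ≤ a := by
  by_contra ha
  have ha : a < 0 := not_le.1 ha
  have hb : 0 < |b| + 1 := by positivity
  -- This `η` is so small that `η * b ≤ -a / 2`, which leaves `a + η * b` negative.
  have hη : 0 < -a / (2 * (|b| + 1)) := by apply div_pos <;> linarith
  have h1 := h _ hη
  have h2 : -a / (2 * (|b| + 1)) * b ≤ -a / (2 * (|b| + 1)) * (|b| + 1) :=
    mul_le_mul_of_nonneg_left (by linarith [le_abs_self b]) hη.le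
  have h3 : -a / (2 * (|b| + 1)) * (|b| + 1) = -a / 2 := by field_simp
  linarith

/-- If the open cone on `u'` lies projectively in the closed cone on `u`, then the generators `u'`
are, up to a common sign, nonnegative combinations of `u`. -/
theorem exists_nonneg_coeff [Nonempty ι] {u u' : ι → V} (hu : LinearIndependent ℝ u)
    (hu' : LinearIndependent ℝ u')
    (h : ∀ t : ι → ℝ, (∀ i, 0 < t i) → ∃ (c : ℝ) (s : ι → ℝ), (∀ i, 0 ≤ s i) ∧
      ∑ i, t i • u' i = c • ∑ i, s i • u i) :
    ∃ ε : ℝ, (ε = 1 ∨ ε = -1) ∧ ∃ N : ι → ι → ℝ, (∀ i k, 0 ≤ N i k) ∧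
      ∀ i, u' i = ε • ∑ k, N i k • u k := by
  classical
  have hspan : ∀ i, ∃ a : ι → ℝ, u' i = ∑ k, a k • u k := by
    intro i
    -- The vector `u' i` is the difference of two positive combinations of the `u'`, hence lies in
    -- the span of `u`.
    obtain ⟨c₁, s₁, -, h₁⟩ := h (fun _ => 1) (fun _ => one_pos)
    obtain ⟨c₂, s₂, -, h₂⟩ := h (fun j => 1 + if j = i then 1 else 0)
      (fun j => by split_ifs <;> norm_num)
    refine ⟨fun k => c₂ * s₂ k - c₁ * s₁ k, ?_⟩
    simp only [add_smul, Finset.sum_add_distrib, ite_smul, one_smul, zero_smul,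
      Finset.sum_ite_eq', Finset.mem_univ, if_true] at h₁ h₂
    simp only [sub_smul, Finset.sum_sub_distrib, mul_smul, ← Finset.smul_sum, ← h₁, ← h₂]
    abel
  choose N hN using hspan
  have hcomb : ∀ t : ι → ℝ, ∑ i, t i • u' i = ∑ k, (∑ i, t i * N i k) • u k := by
    intro t
    simp only [Finset.sum_smul, mul_smul]
    rw [Finset.sum_comm]
    exact Finset.sum_congr rfl fun i _ => by rw [hN i, Finset.smul_sum]
  have hcoef : ∀ t : ι → ℝ, (∀ i, 0 < t i) → ∃ (c : ℝ) (s : ι → ℝ), (∀ i, 0 ≤ s i) ∧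
      (∀ k, ∑ i, t i * N i k = c * s k) ∧ 0 < ∑ k, s k ∧ c ≠ 0 := by
    intro t ht
    obtain ⟨c, s, hs, hts⟩ := h t ht
    have hne : ∑ i, t i • u' i ≠ 0 := fun h0 => by
      obtain ⟨i⟩ := ‹Nonempty ι›
      exact (ht i).ne' (Fintype.linearIndependent_iff.1 hu' _ h0 i)
    refine ⟨c, s, hs, fun k => ?_, ?_, ?_⟩
    · have := hcomb t
      rw [hts, Finset.smul_sum] at this
      simp only [← mul_smul] at this
      exact (sum_smul_inj hu this k).symm
    · refine lt_of_le_of_ne (Finset.sum_nonneg fun k _ => hs k) fun h0 => hne ?_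
      have := (Finset.sum_eq_zero_iff_of_nonneg fun k _ => hs k).1 h0.symm
      rw [hts, Finset.sum_eq_zero fun k hk => by rw [this k hk, zero_smul], smul_zero]
    · rintro rfl
      exact hne (by rw [hts, zero_smul])
  -- `F t` is the sum of the `u`-coordinates of `∑ t i • u' i`. It is linear and has no zero on the
  -- open orthant, so it has a constant sign `ε` there.
  set F : (ι → ℝ) → ℝ := fun t => ∑ k, ∑ i, t i * N i k with hF
  have hFne : ∀ t : ι → ℝ, (∀ i, 0 < t i) → F t ≠ 0 := by
    intro t ht
    obtain ⟨c, s, -, h1, h2, h3⟩ := hcoef t ht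
    simp only [hF, h1, ← Finset.mul_sum]
    exact mul_ne_zero h3 h2.ne'
  have hFlin : ∀ (a b : ℝ) (t t' : ι → ℝ),
      F (fun i => a * t i + b * t' i) = a * F t + b * F t' := by
    intro a b t t'
    simp only [hF, Finset.mul_sum, ← Finset.sum_add_distrib]
    exact Finset.sum_congr rfl fun k _ => Finset.sum_congr rfl fun i _ => by ring
  obtain ⟨ε, hε, hε1⟩ : ∃ ε : ℝ, (ε = 1 ∨ ε = -1) ∧ 0 < ε * F (fun _ => 1) := by
    rcases lt_or_gt_of_ne (hFne (fun _ => 1) fun _ => one_pos) with hlt | hlt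
    · exact ⟨-1, Or.inr rfl, by linarith⟩
    · exact ⟨1, Or.inl rfl, by linarith⟩
  have hε2 : ε * ε = 1 := by rcases hε with rfl | rfl <;> norm_num
  have hε0 : ε ≠ 0 := by rintro rfl; simp at hε2
  have hpos : ∀ t : ι → ℝ, (∀ i, 0 < t i) → 0 < ε * F t := by
    intro t ht
    by_contra hneg
    have hneg : ε * F t < 0 := lt_of_le_of_ne (not_lt.1 hneg) (mul_ne_zero hε0 (hFne t ht))
    -- If the signs at `t` and at the all-ones vector differed, this positive combination of the two
    -- would be a zero of `F` in the open orthant.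
    refine hFne (fun i => (ε * F fun _ => 1) * t i + (-(ε * F t)) * (fun _ => 1) i)
      (fun i => by have := mul_pos hε1 (ht i); simp only [mul_one]; linarith) ?_
    rw [hFlin]; ring
  have hcol : ∀ t : ι → ℝ, (∀ i, 0 < t i) → ∀ k, 0 ≤ ε * ∑ i, t i * N i k := by
    intro t ht k
    obtain ⟨c, s, hs, h1, h2, -⟩ := hcoef t ht
    have h4 := hpos t ht
    simp only [hF, h1, ← Finset.mul_sum] at h4
    rw [← mul_assoc] at h4
    have h5 : 0 < ε * c := pos_of_mul_pos_left h4 h2.le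
    rw [h1, ← mul_assoc]
    exact mul_nonneg h5.le (hs k)
  refine ⟨ε, hε, fun i k => ε * N i k, fun i k => ?_, fun i => ?_⟩
  -- The unit vector at `i` is only on the boundary of the orthant; it is approached by adding `η`
  -- to every coordinate.
  · refine nonneg_of_forall_pos_add (b := ε * ∑ j, N j k) fun η hη => ?_
    have := hcol (fun j => η + if j = i then 1 else 0) (fun j => by split_ifs <;> linarith) k
    simp only [add_mul, Finset.sum_add_distrib, ite_mul, one_mul, zero_mul, Finset.sum_ite_eq',
      Finset.mem_univ, if_true, ← Finset.mul_sum] at this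
    linarith
  · simp only [mul_smul, ← Finset.smul_sum]
    rw [← mul_smul, hε2, one_smul, hN i]

/-- Two simplicial cones with the same open part in projective space have the same generators, up
to order and scaling. -/
theorem cone_rigidity [Nonempty ι] {u u' : ι → V} (hu : LinearIndependent ℝ u)
    (hu' : LinearIndependent ℝ u')
    (h : ∀ t : ι → ℝ, (∀ i, 0 < t i) → ∃ (c : ℝ) (s : ι → ℝ), (∀ i, 0 ≤ s i) ∧
      ∑ i, t i • u' i = c • ∑ i, s i • u i)
    (h' : ∀ t : ι → ℝ, (∀ i, 0 < t i) → ∃ (c : ℝ) (s : ι → ℝ), (∀ i, 0 ≤ s i) ∧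
      ∑ i, t i • u i = c • ∑ i, s i • u' i) :
    ∃ ε : ℝ, ε ≠ 0 ∧ ∃ (σ : Equiv.Perm ι) (c : ι → ℝ), (∀ i, 0 < c i) ∧
      ∀ i, u' i = (ε * c i) • u (σ i) := by
  classical
  obtain ⟨ε, hε, N, hN, hu1⟩ := exists_nonneg_coeff hu hu' h
  obtain ⟨ε', hε', N', hN', hu2⟩ := exists_nonneg_coeff hu' hu h'
  have hε2 : ε' * ε' = 1 := by rcases hε' with rfl | rfl <;> norm_num
  have hε0 : ε ≠ 0 := by rcases hε with rfl | rfl <;> norm_num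
  have hε0' : ε' ≠ 0 := by rcases hε' with rfl | rfl <;> norm_num
  -- Up to sign `N` and `N'` are inverse matrices. An off-diagonal entry of their product is a
  -- vanishing sum of nonnegative terms, so each term vanishes.
  have hprod : ∀ i j, i ≠ j → ∀ k, N i k * N' k j = 0 := by
    intro i j hij k
    have e1 : ∑ j, (if j = i then (1 : ℝ) else 0) • u' j =
        ∑ j, (ε * ε' * ∑ k, N i k * N' k j) • u' j := by
      simp only [ite_smul, one_smul, zero_smul, Finset.sum_ite_eq', Finset.mem_univ, if_true]
      conv_lhs => rw [hu1 i]
      simp only [mul_smul, Finset.sum_smul, ← Finset.smul_sum]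
      rw [Finset.sum_comm]
      congr 1
      rw [Finset.smul_sum]
      refine Finset.sum_congr rfl fun k _ => ?_
      conv_lhs => rw [hu2 k]
      rw [smul_comm (N i k), ← Finset.smul_sum]
    have e2 := sum_smul_inj hu' e1 j
    rw [if_neg hij.symm] at e2
    have e3 : ∑ k, N i k * N' k j = 0 := by
      rcases mul_eq_zero.1 e2.symm with h0 | h0
      · exact absurd h0 (mul_ne_zero hε0 hε0')
      · exact h0
    exact (Finset.sum_eq_zero_iff_of_nonneg
      fun k _ => mul_nonneg (hN i k) (hN' k j)).1 e3 k (Finset.mem_univ k)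
  have hex : ∀ i, ∃ k, N i k ≠ 0 := by
    intro i
    by_contra! h0
    apply hu'.ne_zero i
    rw [hu1 i, Finset.sum_eq_zero fun k _ => by rw [h0 k, zero_smul], smul_zero]
  -- A nonzero entry of row `i` of `N`, in column `σ i`, forces row `σ i` of `N'` to vanish off `i`;
  -- hence `u (σ i)` is a multiple of `u' i`.
  choose σ hσ using hex
  have hz : ∀ i j, j ≠ i → N' (σ i) j = 0 := fun i j hij =>
    (mul_eq_zero.1 (hprod i j hij.symm (σ i))).resolve_left (hσ i)
  have huσ : ∀ i, u (σ i) = (ε' * N' (σ i) i) • u' i := by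
    intro i
    conv_lhs => rw [hu2 (σ i)]
    rw [Finset.sum_eq_single i (fun j _ hj => by rw [hz i j hj, zero_smul])
      (fun hi => absurd (Finset.mem_univ i) hi), mul_smul]
  have hpos : ∀ i, 0 < N' (σ i) i := by
    intro i
    refine lt_of_le_of_ne (hN' _ _) fun h0 => hu.ne_zero (σ i) ?_
    rw [huσ i, ← h0, mul_zero, zero_smul]
  have hinj : Function.Injective σ := by
    intro i j hij
    by_contra hne
    have := hz i j (Ne.symm hne)
    rw [hij] at this
    exact (hpos j).ne' this
  refine ⟨ε', hε0', Equiv.ofBijective σ (Finite.injective_iff_bijective.1 hinj),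
    fun i => (N' (σ i) i)⁻¹, fun i => inv_pos.2 (hpos i), fun i => ?_⟩
  rw [Equiv.ofBijective_apply, huσ i, ← mul_smul]
  have : ε' * (N' (σ i) i)⁻¹ * (ε' * N' (σ i) i) = 1 := by
    have := (hpos i).ne'
    calc _ = (ε' * ε') * ((N' (σ i) i)⁻¹ * N' (σ i) i) := by ring
      _ = 1 := by rw [hε2, inv_mul_cancel₀ this, one_mul]
  rw [this, one_smul]

end Rigidity

section

/-! ### Triangles spanned by families of vectors -/

theorem mulVec_eq_sum_col (M : Matrix (Fin 3) (Fin 3) ℝ) (t : Fin 3 → ℝ) :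
    M *ᵥ t = ∑ i, t i • M.col i := by
  ext k
  simp [Matrix.mulVec, dotProduct, Matrix.col, mul_comm]

theorem linearIndependent_col (M : GL (Fin 3) ℝ) :
    LinearIndependent ℝ (M : Matrix (Fin 3) (Fin 3) ℝ).col :=
  Matrix.linearIndependent_cols_iff_isUnit.2 M.isUnit

theorem exists_col_eq {u : Fin 3 → Fin 3 → ℝ} (hu : LinearIndependent ℝ u) :
    ∃ M : GL (Fin 3) ℝ, (M : Matrix (Fin 3) (Fin 3) ℝ).col = u := by
  have : IsUnit (Matrix.of fun r j => u j r) :=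
    Matrix.linearIndependent_cols_iff_isUnit.1 (by simpa [Matrix.col] using! hu)
  obtain ⟨M, hM⟩ := this
  exact ⟨M, by rw [hM]; rfl⟩

/-- The closed triangle with vertices `[u i]`. -/
def tri (u : Fin 3 → Fin 3 → ℝ) : Set P2 :=
  {x | ∃ t : Fin 3 → ℝ, (∀ i, 0 ≤ t i) ∧
    ∃ h : ∑ i, t i • u i ≠ 0, x = Projectivization.mk ℝ _ h}

/-- The punctured triangle with vertices `[u i]`. -/
def pt (u : Fin 3 → Fin 3 → ℝ) : Set P2 :=
  tri u \ {x | ∃ i, ∃ h : u i ≠ 0, x = Projectivization.mk ℝ _ h}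

/-- The open edge opposite to `[u i]`. -/
def edge (u : Fin 3 → Fin 3 → ℝ) (i : Fin 3) : Set P2 :=
  {x | ∃ t : Fin 3 → ℝ, t i = 0 ∧ (∀ j, j ≠ i → 0 < t j) ∧
    ∃ h : ∑ i, t i • u i ≠ 0, x = Projectivization.mk ℝ _ h}

theorem closedTriangle_eq (M : GL (Fin 3) ℝ) :
    closedTriangle M = tri (M : Matrix (Fin 3) (Fin 3) ℝ).col := by
  simp only [closedTriangle, tri, mulVec_eq_sum_col]

theorem puncturedTriangle_eq (M : GL (Fin 3) ℝ) :
    puncturedTriangle M = pt (M : Matrix (Fin 3) (Fin 3) ℝ).col := by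
  simp only [puncturedTriangle, pt, closedTriangle_eq, vertices]

theorem openEdge_eq (M : GL (Fin 3) ℝ) (i : Fin 3) :
    openEdge M i = edge (M : Matrix (Fin 3) (Fin 3) ℝ).col i := by
  simp only [openEdge, edge, mulVec_eq_sum_col]

variable {u u' : Fin 3 → Fin 3 → ℝ}

theorem mk_mem_tri_iff {z : Fin 3 → ℝ} (hz : z ≠ 0) :
    Projectivization.mk ℝ z hz ∈ tri u ↔
      ∃ (c : ℝ) (t : Fin 3 → ℝ), (∀ i, 0 ≤ t i) ∧ z = c • ∑ i, t i • u i := by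
  constructor
  · rintro ⟨t, ht, h, hx⟩
    obtain ⟨c, hc⟩ := (Projectivization.mk_eq_mk_iff' ℝ _ _ hz h).1 hx
    exact ⟨c, t, ht, hc.symm⟩
  · rintro ⟨c, t, ht, rfl⟩
    have h : ∑ i, t i • u i ≠ 0 := fun h => hz (by rw [h, smul_zero])
    exact ⟨t, ht, h, (Projectivization.mk_eq_mk_iff' ℝ _ _ hz h).2 ⟨c, rfl⟩⟩

theorem mk_mem_edge_iff {z : Fin 3 → ℝ} (hz : z ≠ 0) (i : Fin 3) :
    Projectivization.mk ℝ z hz ∈ edge u i ↔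
      ∃ (c : ℝ) (t : Fin 3 → ℝ), t i = 0 ∧ (∀ j, j ≠ i → 0 < t j) ∧
        z = c • ∑ i, t i • u i := by
  constructor
  · rintro ⟨t, ht, ht', h, hx⟩
    obtain ⟨c, hc⟩ := (Projectivization.mk_eq_mk_iff' ℝ _ _ hz h).1 hx
    exact ⟨c, t, ht, ht', hc.symm⟩
  · rintro ⟨c, t, ht, ht', rfl⟩
    have h : ∑ i, t i • u i ≠ 0 := fun h => hz (by rw [h, smul_zero])
    exact ⟨t, ht, ht', h, (Projectivization.mk_eq_mk_iff' ℝ _ _ hz h).2 ⟨c, rfl⟩⟩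

/-- A combination of the vertices with two nonzero coefficients is not a vertex. -/
theorem not_vertex_of_two (hu : LinearIndependent ℝ u) {t : Fin 3 → ℝ} {j k : Fin 3} (hjk : j ≠ k)
    (hj : t j ≠ 0) (hk : t k ≠ 0) (h : ∑ i, t i • u i ≠ 0) :
    Projectivization.mk ℝ _ h ∉ {x : P2 | ∃ i, ∃ h : u i ≠ 0, x = Projectivization.mk ℝ _ h} := by
  rintro ⟨i, hi, hx⟩
  obtain ⟨c, hc⟩ := (Projectivization.mk_eq_mk_iff' ℝ _ _ h hi).1 hx
  have h1 : ∑ l, (if l = i then c else 0) • u l = ∑ l, t l • u l := by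
    simp only [ite_smul, zero_smul, Finset.sum_ite_eq', Finset.mem_univ, if_true, hc]
  rcases eq_or_ne j i with rfl | hji
  · exact hk (by rw [← sum_smul_inj hu h1 k, if_neg hjk.symm])
  · exact hj (by rw [← sum_smul_inj hu h1 j, if_neg hji])

theorem mk_mem_pt_of_two (hu : LinearIndependent ℝ u) {t : Fin 3 → ℝ} (ht : ∀ i, 0 ≤ t i)
    {j k : Fin 3} (hjk : j ≠ k) (hj : t j ≠ 0) (hk : t k ≠ 0) (h : ∑ i, t i • u i ≠ 0) :
    Projectivization.mk ℝ _ h ∈ pt u :=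
  ⟨⟨t, ht, h, rfl⟩, not_vertex_of_two hu hjk hj hk h⟩

theorem sum_smul_ne_zero (hu : LinearIndependent ℝ u) {t : Fin 3 → ℝ} {k : Fin 3} (hk : t k ≠ 0) :
    ∑ i, t i • u i ≠ 0 := fun h => hk (Fintype.linearIndependent_iff.1 hu _ h k)

/-- `u'` spans the same cone as `u`, up to sign. -/
def SameCone {ι V : Type*} [AddCommGroup V] [Module ℝ V] (u u' : ι → V) : Prop :=
  ∃ ε : ℝ, ε ≠ 0 ∧ ∃ (σ : Equiv.Perm ι) (c : ι → ℝ), (∀ i, 0 < c i) ∧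
    ∀ i, u' i = (ε * c i) • u (σ i)

theorem SameCone.symm {ι V : Type*} [AddCommGroup V] [Module ℝ V] {u u' : ι → V}
    (h : SameCone u u') : SameCone u' u := by
  obtain ⟨ε, hε, σ, c, hc, h⟩ := h
  refine ⟨ε⁻¹, inv_ne_zero hε, σ.symm, fun i => (c (σ.symm i))⁻¹, fun i => inv_pos.2 (hc _),
    fun i => ?_⟩
  have h1 := (hc (σ.symm i)).ne'
  rw [h, ← mul_smul, Equiv.apply_symm_apply, show ε⁻¹ * (c (σ.symm i))⁻¹ * (ε * c (σ.symm i)) = 1 by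
    field_simp, one_smul]

theorem SameCone.tri_subset (h : SameCone u u') : tri u' ⊆ tri u := by
  obtain ⟨ε, hε, σ, c, hc, h⟩ := h
  rintro x ⟨t, ht, h0, rfl⟩
  rw [mk_mem_tri_iff]
  refine ⟨ε, fun i => t (σ.symm i) * c (σ.symm i), fun i => mul_nonneg (ht _) (hc _).le, ?_⟩
  rw [Finset.smul_sum]
  refine Eq.trans (Finset.sum_congr rfl fun i _ => ?_) (Equiv.sum_comp σ _)
  simp only [h, Equiv.symm_apply_apply, ← mul_smul]
  ring_nf

theorem SameCone.vert_subset (h : SameCone u u') :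
    {x : P2 | ∃ i, ∃ h : u' i ≠ 0, x = Projectivization.mk ℝ _ h} ⊆
      {x | ∃ i, ∃ h : u i ≠ 0, x = Projectivization.mk ℝ _ h} := by
  obtain ⟨ε, hε, σ, c, hc, h⟩ := h
  rintro x ⟨i, hi, rfl⟩
  have hi' : u (σ i) ≠ 0 := fun h0 => hi (by rw [h, h0, smul_zero])
  exact ⟨σ i, hi', (Projectivization.mk_eq_mk_iff' ℝ _ _ hi hi').2 ⟨ε * c i, (h i).symm⟩⟩

theorem SameCone.tri_eq (h : SameCone u u') : tri u = tri u' :=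
  h.symm.tri_subset.antisymm h.tri_subset

theorem SameCone.pt_eq (h : SameCone u u') : pt u = pt u' := by
  rw [pt, pt, h.tri_eq, h.symm.vert_subset.antisymm h.vert_subset]

theorem exists_coeff_of_mem_pt (hu' : LinearIndependent ℝ u') (h : pt u' ⊆ pt u)
    (t : Fin 3 → ℝ) (ht : ∀ i, 0 < t i) : ∃ (c : ℝ) (s : Fin 3 → ℝ), (∀ i, 0 ≤ s i) ∧
      ∑ i, t i • u' i = c • ∑ i, s i • u i := by
  have hz : ∑ i, t i • u' i ≠ 0 := sum_smul_ne_zero hu' (ht 0).ne'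
  have := (h (mk_mem_pt_of_two hu' (fun i => (ht i).le) (show (0 : Fin 3) ≠ 1 by decide)
    (ht 0).ne' (ht 1).ne' hz)).1
  rwa [mk_mem_tri_iff] at this

/-- Positive combinations of the three lifts are never vertices, so removing the vertices loses
nothing that `cone_rigidity` needs. -/
theorem sameCone_of_pt_eq (hu : LinearIndependent ℝ u) (hu' : LinearIndependent ℝ u')
    (h : pt u = pt u') : SameCone u u' :=
  cone_rigidity hu hu' (exists_coeff_of_mem_pt hu' h.ge) (exists_coeff_of_mem_pt hu h.le)

theorem sum_cyclic {V : Type*} [AddCommMonoid V] (f : Fin 3 → V) (i : Fin 3) :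
    ∑ j, f j = f i + f (i + 1) + f (i + 2) := by
  fin_cases i
  · exact Fin.sum_univ_three f
  · rw [Fin.sum_univ_three]
    change _ = f 1 + f 2 + f 0
    abel
  · rw [Fin.sum_univ_three]
    change _ = f 2 + f 0 + f 1
    abel

theorem eq_cyclic (i j : Fin 3) : j = i ∨ j = i + 1 ∨ j = i + 2 := by
  revert i j; decide

theorem add_one_ne (i : Fin 3) : i + 1 ≠ i := by revert i; decide
theorem add_two_ne (i : Fin 3) : i + 2 ≠ i := by revert i; decide
theorem add_two_ne_add_one (i : Fin 3) : i + 2 ≠ i + 1 := by revert i; decide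
theorem add_one_add_one (i : Fin 3) : i + 1 + 1 = i + 2 := by revert i; decide
theorem add_one_add_two (i : Fin 3) : i + 1 + 2 = i := by revert i; decide
theorem add_two_add_one (i : Fin 3) : i + 2 + 1 = i := by revert i; decide
theorem add_two_add_two (i : Fin 3) : i + 2 + 2 = i + 1 := by revert i; decide

theorem exists_coeff_of_mem_edge (hu' : LinearIndependent ℝ u') {i : Fin 3}
    (h : edge u' i ⊆ edge u i) (t : Fin 2 → ℝ) (ht : ∀ i, 0 < t i) :
    ∃ (c : ℝ) (s : Fin 2 → ℝ), (∀ i, 0 ≤ s i) ∧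
      ∑ k, t k • (![u' (i + 1), u' (i + 2)] : Fin 2 → _) k =
        c • ∑ k, s k • (![u (i + 1), u (i + 2)] : Fin 2 → _) k := by
  set T : Fin 3 → ℝ := fun j => if j = i then 0 else if j = i + 1 then t 0 else t 1 with hT
  have e0 : T i = 0 := by simp [hT]
  have e1 : T (i + 1) = t 0 := by simp [hT]
  have e2 : T (i + 2) = t 1 := by simp [hT]
  have hz : ∑ j, T j • u' j ≠ 0 := sum_smul_ne_zero hu' (k := i + 1) (by rw [e1]; exact (ht 0).ne')
  have := h ⟨T, e0, fun j hj => by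
    rcases eq_cyclic i j with rfl | rfl | rfl
    · exact absurd rfl hj
    · rw [e1]; exact ht 0
    · rw [e2]; exact ht 1, hz, rfl⟩
  rw [mk_mem_edge_iff] at this
  obtain ⟨c, s, hs0, hs, hts⟩ := this
  refine ⟨c, ![s (i + 1), s (i + 2)], ?_, ?_⟩
  · intro k
    fin_cases k
    · exact (hs _ (add_one_ne i)).le
    · exact (hs _ (add_two_ne i)).le
  · simpa only [sum_cyclic _ i, e0, e1, e2, hs0, zero_smul, zero_add, Fin.sum_univ_two] using! hts

/-- Rigidity for cones with two generators: an open edge determines its endpoints, though not their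
order. -/
theorem sameCone_of_edge_eq (hu : LinearIndependent ℝ u) (hu' : LinearIndependent ℝ u') {i : Fin 3}
    (h : edge u i = edge u' i) :
    SameCone ![u (i + 1), u (i + 2)] ![u' (i + 1), u' (i + 2)] := by
  have aux : ∀ {w : Fin 3 → Fin 3 → ℝ}, LinearIndependent ℝ w →
      LinearIndependent ℝ ![w (i + 1), w (i + 2)] := by
    intro w hw
    have := hw.comp (![i + 1, i + 2] : Fin 2 → Fin 3) (by
      intro a b; fin_cases a <;> fin_cases b <;> simp)
    convert this using 1
    ext k; fin_cases k <;> rfl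
  exact cone_rigidity (aux hu) (aux hu') (exists_coeff_of_mem_edge hu' h.ge)
    (exists_coeff_of_mem_edge hu h.le)

/-! ### The action of `SL(3, ℝ)` -/

theorem smul_sum_smul (g : SL(3, ℝ)) (t : Fin 3 → ℝ) (u : Fin 3 → Fin 3 → ℝ) :
    g • ∑ i, t i • u i = ∑ i, t i • g • u i := by
  rw [Finset.smul_sum]
  exact Finset.sum_congr rfl fun i _ => smul_comm _ _ _

theorem smul_tri (g : SL(3, ℝ)) (u : Fin 3 → Fin 3 → ℝ) :
    g • tri u = tri fun i => g • u i := by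
  have key : ∀ (g : SL(3, ℝ)) u, g • tri u ⊆ tri fun i => g • u i := by
    rintro g u _ ⟨_, ⟨t, ht, h, rfl⟩, rfl⟩
    refine ⟨t, ht, ?_, ?_⟩
    · rw [← smul_sum_smul]; exact (smul_ne_zero_iff_ne g).2 h
    · simp only [Projectivization.smul_mk, smul_sum_smul]
  refine (key g u).antisymm ?_
  rw [Set.subset_smul_set_iff]
  simpa only [inv_smul_smul] using key g⁻¹ fun i => g • u i

theorem smul_pt (g : SL(3, ℝ)) (u : Fin 3 → Fin 3 → ℝ) :
    g • pt u = pt fun i => g • u i := by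
  have key : ∀ (g : SL(3, ℝ)) (u : Fin 3 → Fin 3 → ℝ),
      g • {x : P2 | ∃ i, ∃ h : u i ≠ 0, x = Projectivization.mk ℝ _ h} ⊆
        {x | ∃ i, ∃ h : g • u i ≠ 0, x = Projectivization.mk ℝ _ h} := by
    rintro g u _ ⟨_, ⟨i, h, rfl⟩, rfl⟩
    exact ⟨i, (smul_ne_zero_iff_ne g).2 h, rfl⟩
  have key' : g • {x : P2 | ∃ i, ∃ h : u i ≠ 0, x = Projectivization.mk ℝ _ h} =
      {x | ∃ i, ∃ h : g • u i ≠ 0, x = Projectivization.mk ℝ _ h} := by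
    refine (key g u).antisymm ?_
    rw [Set.subset_smul_set_iff]
    simpa only [inv_smul_smul] using key g⁻¹ fun i => g • u i
  rw [pt, pt, Set.smul_set_sdiff, smul_tri, key']

end

/-! ### Characteristic polynomials, cyclic vectors and conjugacy in `SL(3, ℝ)` -/

open Polynomial in
theorem eigenvalueList_eq {γ : SL(3, ℝ)} {a b c : ℝ} (hab : a ≤ b) (hbc : b ≤ c)
    (h : (γ : Matrix (Fin 3) (Fin 3) ℝ).charpoly = (X - C a) * (X - C b) * (X - C c)) :
    eigenvalueList γ = [a, b, c] := by
  have h1 : ((X - C a) * (X - C b) * (X - C c)).roots = {a, b, c} := by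
    rw [roots_mul, roots_mul, roots_X_sub_C, roots_X_sub_C, roots_X_sub_C]
    · rfl
    · exact mul_ne_zero (X_sub_C_ne_zero a) (X_sub_C_ne_zero b)
    · exact mul_ne_zero (mul_ne_zero (X_sub_C_ne_zero a) (X_sub_C_ne_zero b)) (X_sub_C_ne_zero c)
  rw [eigenvalueList, h, h1]
  have h2 : ({a, b, c} : Multiset ℝ) = (([a, b, c] : List ℝ) : Multiset ℝ) := rfl
  rw [h2, Multiset.coe_sort]
  apply List.mergeSort_of_pairwise
  simp [hab, hbc, hab.trans hbc]

theorem charpoly_of_isConj {γ δ : SL(3, ℝ)} (h : IsConj γ δ) :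
    (γ : Matrix (Fin 3) (Fin 3) ℝ).charpoly = (δ : Matrix (Fin 3) (Fin 3) ℝ).charpoly := by
  obtain ⟨c, hc⟩ := isConj_iff.1 h
  rw [← hc, Matrix.SpecialLinearGroup.coe_mul, Matrix.charpoly_mul_comm, ← Matrix.SpecialLinearGroup.coe_mul]
  simp

theorem lam_of_isConj {γ δ : SL(3, ℝ)} (h : IsConj γ δ) : lam γ = lam δ := by
  rw [lam, lam, eigenvalueList, eigenvalueList, charpoly_of_isConj h]

open Polynomial in
theorem charpoly_fin_three (A : Matrix (Fin 3) (Fin 3) ℝ) :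
    A.charpoly = X ^ 3 - C A.trace * X ^ 2 + C (A 0 0 * A 1 1 - A 0 1 * A 1 0 + A 0 0 * A 2 2
      - A 0 2 * A 2 0 + A 1 1 * A 2 2 - A 1 2 * A 2 1) * X - C A.det := by
  rw [Matrix.charpoly, Matrix.det_fin_three, Matrix.det_fin_three, Matrix.trace_fin_three]
  simp
  ring

/-- The matrix with columns `v`, `A v`, `A² v`. -/
def krylov (A : Matrix (Fin 3) (Fin 3) ℝ) (v : Fin 3 → ℝ) : Matrix (Fin 3) (Fin 3) ℝ :=
  Matrix.of fun r j => ((A ^ (j : ℕ)) *ᵥ v) r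

theorem exists_cube (d : ℝ) : ∃ s : ℝ, s ^ 3 = d := by
  have key : ∀ d : ℝ, 0 ≤ d → ∃ s : ℝ, s ^ 3 = d := fun d hd =>
    ⟨d ^ ((3 : ℕ) : ℝ)⁻¹, Real.rpow_inv_natCast_pow hd (by norm_num)⟩
  rcases le_total 0 d with h | h
  · exact key d h
  · obtain ⟨s, hs⟩ := key (-d) (by linarith)
    exact ⟨-s, by linear_combination -hs⟩

/-- The size 3 is odd, so a real cube root normalizes a determinant of either sign. Conjugation and
the projective action do not see the scalar. -/
theorem exists_sl_eq_smul {M : Matrix (Fin 3) (Fin 3) ℝ} (hM : M.det ≠ 0) :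
    ∃ (g : SL(3, ℝ)) (s : ℝ), s ≠ 0 ∧ (g : Matrix (Fin 3) (Fin 3) ℝ) = s • M := by
  obtain ⟨s, hs⟩ := exists_cube M.det⁻¹
  refine ⟨⟨s • M, ?_⟩, s, ?_, rfl⟩
  · rw [Matrix.det_smul, Fintype.card_fin, hs, inv_mul_cancel₀ hM]
  · rintro rfl
    simp at hs
    exact hM hs.symm

/-- The companion matrix of `X³ + c₂ X² + c₁ X + c₀`. -/
def companion (c₀ c₁ c₂ : ℝ) : Matrix (Fin 3) (Fin 3) ℝ := !![0, 0, -c₀; 1, 0, -c₁; 0, 1, -c₂]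

/-- Cayley–Hamilton, needed only for the last column `A³ v`; the other two columns are shifts. -/
theorem mul_krylov (A : Matrix (Fin 3) (Fin 3) ℝ) (v : Fin 3 → ℝ) :
    A * krylov A v =
      krylov A v * companion (A.charpoly.coeff 0) (A.charpoly.coeff 1) (A.charpoly.coeff 2) := by
  have h := Matrix.aeval_self_charpoly A
  have hdeg : A.charpoly.natDegree = 3 := by simp
  have hlead : A.charpoly.coeff 3 = 1 := by
    have := A.charpoly_monic.coeff_natDegree
    rwa [hdeg] at this
  rw [Polynomial.aeval_eq_sum_range, hdeg, Finset.sum_range_succ, Finset.sum_range_succ,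
    Finset.sum_range_succ, Finset.sum_range_one, hlead] at h
  have h2 : ∀ r, (A *ᵥ (A ^ 2 *ᵥ v)) r = -(A.charpoly.coeff 0) * v r -
      A.charpoly.coeff 1 * (A *ᵥ v) r - A.charpoly.coeff 2 * (A ^ 2 *ᵥ v) r := by
    intro r
    have := congrFun (congrArg (fun B : Matrix (Fin 3) (Fin 3) ℝ => B *ᵥ v) h) r
    simp only [Matrix.add_mulVec, Matrix.smul_mulVec, Pi.add_apply, Pi.smul_apply, smul_eq_mul,
      pow_zero, Matrix.one_mulVec, pow_one, one_smul, Matrix.zero_mulVec, Pi.zero_apply] at this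
    rw [Matrix.mulVec_mulVec, ← pow_succ']
    linarith
  have hcol : ∀ r j, (A * krylov A v) r j = (A *ᵥ (A ^ (j : ℕ) *ᵥ v)) r := fun r j => rfl
  ext r j
  rw [hcol]
  fin_cases j
  · simp [krylov, companion, Matrix.mul_apply, Fin.sum_univ_three]
  · simp [krylov, companion, Matrix.mul_apply, Fin.sum_univ_three, pow_succ]
  · refine (h2 r).trans ?_
    simp [krylov, companion, Matrix.mul_apply, Fin.sum_univ_three]
    ring

/-- In the bases given by their cyclic vectors, both maps have the same companion matrix. -/
theorem isConj_of_cyclic {A B : SL(3, ℝ)} {v w : Fin 3 → ℝ}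
    (h : (A : Matrix (Fin 3) (Fin 3) ℝ).charpoly = (B : Matrix (Fin 3) (Fin 3) ℝ).charpoly)
    (hv : (krylov A v).det ≠ 0) (hw : (krylov B w).det ≠ 0) : IsConj A B := by
  have h1 := mul_krylov A v
  have h2 := mul_krylov B w
  rw [h] at h1
  set K := krylov (A : Matrix (Fin 3) (Fin 3) ℝ) v
  set L := krylov (B : Matrix (Fin 3) (Fin 3) ℝ) w
  set D := companion ((B : Matrix (Fin 3) (Fin 3) ℝ).charpoly.coeff 0)
    ((B : Matrix (Fin 3) (Fin 3) ℝ).charpoly.coeff 1)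
    ((B : Matrix (Fin 3) (Fin 3) ℝ).charpoly.coeff 2)
  have hK : IsUnit K.det := isUnit_iff_ne_zero.2 hv
  have hL : IsUnit L.det := isUnit_iff_ne_zero.2 hw
  have h3 : L * K⁻¹ * (A : Matrix (Fin 3) (Fin 3) ℝ) = B * (L * K⁻¹) := by
    have h4 : K⁻¹ * (A : Matrix (Fin 3) (Fin 3) ℝ) = D * K⁻¹ := by
      calc K⁻¹ * (A : Matrix (Fin 3) (Fin 3) ℝ)
          = K⁻¹ * ((A : Matrix (Fin 3) (Fin 3) ℝ) * K) * K⁻¹ := by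
            rw [Matrix.mul_assoc, Matrix.mul_assoc, Matrix.mul_nonsing_inv _ hK, Matrix.mul_one]
        _ = D * K⁻¹ := by rw [h1, ← Matrix.mul_assoc, Matrix.nonsing_inv_mul _ hK, Matrix.one_mul]
    rw [Matrix.mul_assoc, h4, ← Matrix.mul_assoc, ← h2, Matrix.mul_assoc]
  have hdet : (L * K⁻¹).det ≠ 0 := by
    rw [Matrix.det_mul, Matrix.det_nonsing_inv, Ring.inverse_eq_inv']
    exact mul_ne_zero hw (inv_ne_zero hv)
  obtain ⟨g, s, hs, hg⟩ := exists_sl_eq_smul hdet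
  rw [isConj_iff]
  refine ⟨g, ?_⟩
  rw [mul_inv_eq_iff_eq_mul]
  apply Subtype.ext
  rw [Matrix.SpecialLinearGroup.coe_mul, Matrix.SpecialLinearGroup.coe_mul, hg, Matrix.smul_mul,
    Matrix.mul_smul, h3]

theorem krylov_mul {A B C : Matrix (Fin 3) (Fin 3) ℝ} (h : A * B = B * C) (v : Fin 3 → ℝ) :
    krylov A (B *ᵥ v) = B * krylov C v := by
  have h1 : ∀ n : ℕ, A ^ n * B = B * C ^ n := by
    intro n
    induction n with
    | zero => simp
    | succ n ih => rw [pow_succ, Matrix.mul_assoc, h, ← Matrix.mul_assoc, ih, Matrix.mul_assoc,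
        ← pow_succ]
  ext r j
  change ((A ^ (j : ℕ)) *ᵥ (B *ᵥ v)) r = (B *ᵥ (C ^ (j : ℕ) *ᵥ v)) r
  rw [Matrix.mulVec_mulVec, h1, Matrix.mulVec_mulVec]

/-- The common features of hyperbolic, quasi-hyperbolic and parabolic elements. -/
structure IsBoundaryType (δ : SL(3, ℝ)) : Prop where
  lam_pos : 0 < lam δ
  tau_pos : 0 < tau δ
  charpoly_eq : (δ : Matrix (Fin 3) (Fin 3) ℝ).charpoly =
    (Polynomial.X - Polynomial.C (lam δ)) * (Polynomial.X ^ 2 -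
      Polynomial.C (tau δ) * Polynomial.X + Polynomial.C (lam δ)⁻¹)
  cyclic : ∃ v, (krylov δ v).det ≠ 0

open Polynomial in
theorem isBoundaryType_of_isConj {δ D : SL(3, ℝ)} (h : IsConj δ D) {a b c : ℝ} (ha : 0 < a)
    (hab : a ≤ b) (hbc : b ≤ c) (habc : a * b * c = 1)
    (hD : (D : Matrix (Fin 3) (Fin 3) ℝ).charpoly = (X - C a) * (X - C b) * (X - C c))
    {v : Fin 3 → ℝ} (hv : (krylov D v).det ≠ 0) : IsBoundaryType δ := by
  have h1 := eigenvalueList_eq hab hbc ((charpoly_of_isConj h).trans hD)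
  have hl : lam δ = a := by simp [lam, h1]
  have ht : tau δ = b + c := by simp [tau, h1]
  obtain ⟨g, hg⟩ := isConj_iff.1 h.symm
  refine ⟨by rw [hl]; exact ha, by rw [ht]; linarith, ?_, g.1 *ᵥ v, ?_⟩
  · have hinv : a⁻¹ = b * c := by
      rw [inv_eq_iff_eq_inv]; exact eq_inv_of_mul_eq_one_left (by rw [← habc]; ring)
    rw [charpoly_of_isConj h, hD, hl, ht, hinv, C_add, C_mul]
    ring
  · have h2 : (δ : Matrix (Fin 3) (Fin 3) ℝ) * g.1 = g.1 * D.1 := by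
      have : δ * g = g * D := by rw [← hg, inv_mul_cancel_right]
      exact congrArg Subtype.val this
    rw [krylov_mul h2, Matrix.det_mul, g.2, one_mul]
    exact hv

open Polynomial in
-- Each of the three types has positive spectrum and a single Jordan block for each eigenvalue; this
-- is all that is used of them later.
theorem isBoundaryType {δ : SL(3, ℝ)}
    (h : IsHyperbolic δ ∨ IsQuasiHyperbolic δ ∨ IsParabolic δ) : IsBoundaryType δ := by
  rcases h with ⟨a, b, c, hab, hbc, hc, habc, D, hD, hconj⟩ |
    ⟨α, β, hα, hβ, hαβ, hα1, -, D, hD, hconj⟩ | ⟨D, hD, hconj⟩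
  · refine isBoundaryType_of_isConj hconj hc hbc.le hab.le (by linarith) ?_ (v := ![1, 1, 1]) ?_
    · rw [charpoly_fin_three, hD]
      simp [Matrix.det_fin_three, Matrix.trace_fin_three]
      ring
    -- A Vandermonde determinant.
    · have : (krylov D ![1, 1, 1]).det = (b - a) * (c - a) * (c - b) := by
        rw [hD]
        simp [krylov, Matrix.det_fin_three, Matrix.mulVec, dotProduct, Fin.sum_univ_three, pow_two,
          Matrix.mul_apply]
        ring
      rw [this]
      exact mul_ne_zero (mul_ne_zero (by linarith) (by linarith)) (by linarith)
  · have hne : α ≠ β := by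
      rintro rfl
      apply hα1
      have h3 : α ^ 3 = 1 := by linarith [hαβ, pow_succ α 2]
      exact (pow_eq_one_iff_of_nonneg hα.le (by norm_num)).1 h3
    have hchar : (D : Matrix (Fin 3) (Fin 3) ℝ).charpoly = (X - C α) * (X - C α) * (X - C β) := by
      rw [charpoly_fin_three, hD]
      simp [Matrix.det_fin_three, Matrix.trace_fin_three]
      ring
    have hv : (krylov D ![0, 1, 1]).det ≠ 0 := by
      have : (krylov D ![0, 1, 1]).det = -(α - β) ^ 2 := by
        rw [hD]
        simp [krylov, Matrix.det_fin_three, Matrix.mulVec, dotProduct, Fin.sum_univ_three, pow_two,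
          Matrix.mul_apply]
        ring
      rw [this]
      exact neg_ne_zero.2 (pow_ne_zero 2 (sub_ne_zero.2 hne))
    -- The double eigenvalue may be the smallest or the largest one, and `lam` differs accordingly.
    rcases le_total α β with hle | hle
    · exact isBoundaryType_of_isConj hconj hα le_rfl hle (by linarith) hchar hv
    · exact isBoundaryType_of_isConj hconj hβ hle le_rfl (by linarith)
        (hchar.trans (by ring)) hv
  · refine isBoundaryType_of_isConj hconj one_pos le_rfl le_rfl (by norm_num) ?_ (v := ![0, 0, 1]) ?_
    · rw [charpoly_fin_three, hD]
      simp [Matrix.det_fin_three, Matrix.trace_fin_three]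
      ring
    · rw [hD]
      simp [krylov, Matrix.det_fin_three, Matrix.mulVec, dotProduct, Fin.sum_univ_three, pow_two,
          Matrix.mul_apply]

section

/-! ### Hexagons in an affine chart -/

/-- The points of a finite convexly independent family are extreme in their hull, and an extreme
point of a convex hull belongs to any generating set. -/
theorem range_subset_of_convexHull_eq {ι κ V : Type*} [Finite ι] [NormedAddCommGroup V]
    [NormedSpace ℝ V] {v : ι → V} (hv : ConvexIndependent ℝ v) {p : κ → V}
    (h : convexHull ℝ (Set.range v) = convexHull ℝ (Set.range p)) :
    Set.range v ⊆ Set.range p := by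
  have hfin : (Set.range v).Finite := Set.finite_range v
  have hext : Set.range v ⊆ (convexHull ℝ (Set.range v)).extremePoints ℝ := by
    rintro _ ⟨k, rfl⟩
    have hcl := closure_convexHull_extremePoints (hfin.isCompact_convexHull ℝ) (convex_convexHull ℝ _)
    have hsub := extremePoints_convexHull_subset (𝕜 := ℝ) (A := Set.range v)
    by_contra hk
    -- By Krein–Milman the extreme points among the `v k` already generate the hull; convex
    -- independence then puts every index in `s`.
    set s : Set ι := v ⁻¹' (convexHull ℝ (Set.range v)).extremePoints ℝ with hs
    have himg : v '' s = (convexHull ℝ (Set.range v)).extremePoints ℝ := by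
      rw [hs, Set.image_preimage_eq_inter_range, Set.inter_eq_left]
      exact hsub
    have hclosed : IsClosed (convexHull ℝ (v '' s)) :=
      ((Set.toFinite s).image v).isClosed_convexHull ℝ
    have hmem : v k ∈ convexHull ℝ (v '' s) := by
      rw [← hclosed.closure_eq, himg, hcl]
      exact subset_convexHull ℝ _ ⟨k, rfl⟩
    exact hk (hv s k hmem)
  rw [h] at hext
  exact hext.trans extremePoints_convexHull_subset

/-- The equal cardinalities make the inclusion of `range_subset_of_convexHull_eq` a bijection of
indices. -/
theorem convexIndependent_of_convexHull_eq {ι κ V : Type*} [Fintype ι] [Fintype κ]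
    [NormedAddCommGroup V] [NormedSpace ℝ V] {v : ι → V} (hv : ConvexIndependent ℝ v) {p : κ → V}
    (hcard : Fintype.card ι = Fintype.card κ)
    (h : convexHull ℝ (Set.range v) = convexHull ℝ (Set.range p)) : ConvexIndependent ℝ p := by
  have hsub := range_subset_of_convexHull_eq hv h
  choose f hf using fun k => hsub ⟨k, rfl⟩
  have hinj : Function.Injective f := fun a b hab => hv.injective (by rw [← hf a, ← hf b, hab])
  have hbij : Function.Bijective f := (Fintype.bijective_iff_injective_and_card f).2 ⟨hinj, hcard⟩
  let F := Equiv.ofBijective f hbij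
  have : p = v ∘ F.symm := by
    funext k
    change p k = v (F.symm k)
    rw [← hf, show f (F.symm k) = k from F.apply_symm_apply k]
  rw [this]
  exact hv.comp_embedding F.symm.toEmbedding

theorem exists_coords {u : Fin 3 → Fin 3 → ℝ} (hu : LinearIndependent ℝ u) (z : Fin 3 → ℝ) :
    ∃ y : Fin 3 → ℝ, z = ∑ j, y j • u j := by
  obtain ⟨M, rfl⟩ := exists_col_eq hu
  refine ⟨(M⁻¹ : GL (Fin 3) ℝ).1 *ᵥ z, ?_⟩
  rw [← mulVec_eq_sum_col, Matrix.mulVec_mulVec, ← Units.val_mul, mul_inv_cancel, Units.val_one,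
    Matrix.one_mulVec]

variable {φ : Module.Dual ℝ (Fin 3 → ℝ)}

/-- On the plane `φ = 1` the projective scalar is forced to be positive, so a conical combination
becomes a convex one. -/
theorem mem_convexHull_of_mk_mem_tri {a : Fin 3 → Fin 3 → ℝ} (ha : ∀ j, φ (a j) = 1)
    {z : Fin 3 → ℝ} (hz : z ≠ 0) (hφ : φ z = 1) (h : Projectivization.mk ℝ z hz ∈ tri a) :
    z ∈ convexHull ℝ (Set.range a) := by
  obtain ⟨c, t, ht, hzt⟩ := (mk_mem_tri_iff hz).1 h
  have hsum : c * ∑ i, t i = 1 := by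
    rw [hzt, map_smul, map_sum] at hφ
    simpa only [map_smul, ha, smul_eq_mul, mul_one] using hφ
  have hc : 0 < c := by
    have h1 : 0 ≤ ∑ i, t i := Finset.sum_nonneg fun i _ => ht i
    exact pos_of_mul_pos_left (by rw [hsum]; exact one_pos) h1
  refine mem_convexHull_of_exists_fintype (fun i => c * t i) a (fun i => mul_nonneg hc.le (ht i))
    (by rw [← Finset.mul_sum, hsum]) (fun i => ⟨i, rfl⟩) ?_
  rw [hzt, Finset.smul_sum]
  exact Finset.sum_congr rfl fun i _ => mul_smul _ _ _

theorem vertex_mem_tri (a : Fin 3 → Fin 3 → ℝ) (j : Fin 3) (h : a j ≠ 0) :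
    Projectivization.mk ℝ (a j) h ∈ tri a := by
  rw [mk_mem_tri_iff]
  refine ⟨1, fun k => if k = j then 1 else 0, fun k => by dsimp only; split_ifs <;> norm_num, ?_⟩
  simp

/-- In a convex independent family, no point is a positive combination of three others. -/
theorem ConvexIndependent.ne_combination {κ : Type*} {p : κ → Fin 3 → ℝ}
    (hp : ConvexIndependent ℝ p) (hφ : ∀ k, φ (p k) = 1) {x i j k : κ} (hi : x ≠ i) (hj : x ≠ j)
    (hk : x ≠ k) {d a b c : ℝ} (hd : 0 < d) (ha : 0 ≤ a) (hb : 0 ≤ b) (hc : 0 ≤ c) :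
    d • p x ≠ a • p i + b • p j + c • p k := by
  intro h
  have hsum : d = a + b + c := by
    have := congrArg φ h
    simpa only [map_add, map_smul, hφ, smul_eq_mul, mul_one] using this
  have hmem : p x ∈ convexHull ℝ (p '' {i, j, k}) := by
    refine mem_convexHull_of_exists_fintype (![a / d, b / d, c / d]) ![p i, p j, p k] ?_ ?_ ?_ ?_
    · intro l; fin_cases l
      · exact div_nonneg ha hd.le
      · exact div_nonneg hb hd.le
      · exact div_nonneg hc hd.le
    · rw [Fin.sum_univ_three]
      change a / d + b / d + c / d = 1
      rw [← add_div, ← add_div, ← hsum, div_self hd.ne']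
    · intro l; fin_cases l
      · exact ⟨i, by simp, rfl⟩
      · exact ⟨j, by simp, rfl⟩
      · exact ⟨k, by simp, rfl⟩
    · rw [Fin.sum_univ_three]
      change (a / d) • p i + (b / d) • p j + (c / d) • p k = p x
      rw [div_eq_inv_mul, div_eq_inv_mul, div_eq_inv_mul, mul_smul, mul_smul, mul_smul, ← smul_add,
        ← smul_add, ← h, ← mul_smul, inv_mul_cancel₀ hd.ne', one_smul]
  have := hp _ _ hmem
  simp only [Set.mem_insert_iff, Set.mem_singleton_iff] at this
  tauto

/-- The lift of the vertex of `Tᵢ` outside `T₀`, in terms of lifts `e` of the vertices of `T₀`. -/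
def apex (e : Fin 3 → Fin 3 → ℝ) (b c : Fin 3 → ℝ) (i : Fin 3) : Fin 3 → ℝ :=
  -e i + b i • e (i + 1) + c i • e (i + 2)

/-- The lifts of the vertices of `Tᵢ`. -/
def outer (e : Fin 3 → Fin 3 → ℝ) (b c : Fin 3 → ℝ) (i : Fin 3) : Fin 3 → Fin 3 → ℝ :=
  Function.update e i (apex e b c i)

theorem sum_update (e : Fin 3 → Fin 3 → ℝ) (i : Fin 3) (x : Fin 3 → ℝ) (t : Fin 3 → ℝ) :
    ∑ j, t j • Function.update e i x j = t i • x + t (i + 1) • e (i + 1) + t (i + 2) • e (i + 2) := by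
  rw [sum_cyclic _ i, Function.update_self, Function.update_of_ne (add_one_ne i),
    Function.update_of_ne (add_two_ne i)]

/-- The coordinate of the outer vertex `w` in the direction of the opposite vertex is negative. -/
theorem coord_neg {e : Fin 3 → Fin 3 → ℝ} (he : LinearIndependent ℝ e) {i : Fin 3}
    {w y : Fin 3 → ℝ} (hw : LinearIndependent ℝ (Function.update e i w)) (hy : w = ∑ j, y j • e j)
    (hint : ∀ z (hz : z ≠ 0), Projectivization.mk ℝ z hz ∈ pt e →
      Projectivization.mk ℝ z hz ∈ pt (Function.update e i w) →
        ∃ t : Fin 3 → ℝ, t i = 0 ∧ z = ∑ j, t j • e j) : y i < 0 := by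
  have hne : y i ≠ 0 := by
    intro h0
    have h1 := Fintype.linearIndependent_iff.1 hw
      (fun j => if j = i then 1 else - y j) (by
        rw [sum_update, if_pos rfl, if_neg (add_one_ne i), if_neg (add_two_ne i), hy,
          sum_cyclic _ i, h0]
        module) i
    simp at h1
  refine lt_of_le_of_ne (not_lt.1 fun hpos => ?_) hne
  -- If `y i > 0`, the point `δ • w + e (i + 1) + e (i + 2)` has all `e`-coordinates positive for
  -- this small `δ`. It would lie in both triangles but off the common edge.
  set δ : ℝ := 1 / (1 + |y (i + 1)| + |y (i + 2)|) with hδ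
  have hD : 0 < 1 + |y (i + 1)| + |y (i + 2)| := by positivity
  have hδ0 : 0 < δ := one_div_pos.2 hD
  have hδ1 : δ * (1 + |y (i + 1)| + |y (i + 2)|) = 1 := one_div_mul_cancel hD.ne'
  have h1 : 0 < 1 + δ * y (i + 1) := by
    have := mul_le_mul_of_nonneg_left (neg_abs_le (y (i + 1))) hδ0.le
    have := mul_nonneg hδ0.le (abs_nonneg (y (i + 2)))
    linarith
  have h2 : 0 < 1 + δ * y (i + 2) := by
    have := mul_le_mul_of_nonneg_left (neg_abs_le (y (i + 2))) hδ0.le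
    have := mul_nonneg hδ0.le (abs_nonneg (y (i + 1)))
    linarith
  set s : Fin 3 → ℝ := fun j => if j = i then δ * y i else 1 + δ * y j with hs
  set s' : Fin 3 → ℝ := fun j => if j = i then δ else 1 with hs'
  have e0 : s i = δ * y i := if_pos rfl
  have e1 : s (i + 1) = 1 + δ * y (i + 1) := if_neg (add_one_ne i)
  have e2 : s (i + 2) = 1 + δ * y (i + 2) := if_neg (add_two_ne i)
  have e0' : s' i = δ := if_pos rfl
  have e1' : s' (i + 1) = 1 := if_neg (add_one_ne i)
  have e2' : s' (i + 2) = 1 := if_neg (add_two_ne i)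
  have hss : ∑ j, s' j • Function.update e i w j = ∑ j, s j • e j := by
    rw [sum_update, sum_cyclic _ i, e0, e1, e2, e0', e1', e2', hy, sum_cyclic _ i]
    module
  have hspos : ∀ j, 0 < s j := by
    intro j
    rcases eq_cyclic i j with rfl | rfl | rfl
    · rw [e0]; exact mul_pos hδ0 hpos
    · rwa [e1]
    · rwa [e2]
  have hspos' : ∀ j, 0 ≤ s' j := by
    intro j
    simp only [hs']
    split_ifs <;> linarith
  have hz : ∑ j, s j • e j ≠ 0 := sum_smul_ne_zero he (hspos 0).ne'
  have hz' : ∑ j, s' j • Function.update e i w j ≠ 0 := by rwa [hss]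
  have m1 := mk_mem_pt_of_two he (fun j => (hspos j).le) (add_two_ne_add_one i) (hspos _).ne'
    (hspos _).ne' hz
  have m2 := mk_mem_pt_of_two hw hspos' (add_two_ne_add_one i) (by rw [e2']; exact one_ne_zero)
    (by rw [e1']; exact one_ne_zero) hz'
  simp only [hss] at m2
  obtain ⟨t, ht, hzt⟩ := hint _ hz m1 m2
  have := sum_smul_inj he hzt i
  rw [ht] at this
  exact (hspos i).ne' this

/-- The outer vertices of a convex hexagon, in coordinates with respect to the inner ones. -/
theorem exists_apex {e w : Fin 3 → Fin 3 → ℝ} (he : LinearIndependent ℝ e)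
    (hφe : ∀ j, φ (e j) = 1) (hφw : ∀ j, φ (w j) = 1)
    (hw : ∀ i, LinearIndependent ℝ (Function.update e i (w i)))
    (hint : ∀ i z (hz : z ≠ 0), Projectivization.mk ℝ z hz ∈ pt e →
      Projectivization.mk ℝ z hz ∈ pt (Function.update e i (w i)) →
        ∃ t : Fin 3 → ℝ, t i = 0 ∧ z = ∑ j, t j • e j)
    {v : Fin 6 → Fin 3 → ℝ} (hφv : ∀ k, φ (v k) = 1) (hv : ConvexIndependent ℝ v)
    (hH : tri e ∪ ⋃ i, tri (Function.update e i (w i)) =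
      {x | ∃ y ∈ convexHull ℝ (Set.range v), ∃ h : y ≠ 0, x = Projectivization.mk ℝ y h}) :
    ∃ b c s : Fin 3 → ℝ, (∀ i, 0 < b i) ∧ (∀ i, 0 < c i) ∧ (∀ i, 0 < s i) ∧
      (∀ i, 1 < b (i + 1) * c (i + 2)) ∧ ∀ i, w i = s i • apex e b c i := by
  have hne : ∀ z, φ z = 1 → z ≠ 0 := by
    rintro z hz rfl
    simp at hz
  have hhull : ∀ y ∈ convexHull ℝ (Set.range v), φ y = 1 := by
    have hconv : Convex ℝ {y | φ y = 1} := convex_hyperplane φ.isLinear 1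
    intro y hy
    exact convexHull_min (by rintro _ ⟨k, rfl⟩; exact hφv k) hconv hy
  set p : Fin 3 ⊕ Fin 3 → Fin 3 → ℝ := Sum.elim e w with hp
  have hφp : ∀ k, φ (p k) = 1 := by
    rintro (k | k)
    · exact hφe k
    · exact hφw k
  have hφu : ∀ i j, φ (Function.update e i (w i) j) = 1 := by
    intro i j
    rcases eq_or_ne j i with rfl | hj
    · rw [Function.update_self]; exact hφw j
    · rw [Function.update_of_ne hj]; exact hφe j
  have hmem : ∀ {z} (hz : z ≠ 0), φ z = 1 → Projectivization.mk ℝ z hz ∈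
      {x | ∃ y ∈ convexHull ℝ (Set.range v), ∃ h : y ≠ 0, x = Projectivization.mk ℝ y h} →
      z ∈ convexHull ℝ (Set.range v) := by
    rintro z hz hφz ⟨y, hy, hy0, hzy⟩
    obtain ⟨c, rfl⟩ := (Projectivization.mk_eq_mk_iff' ℝ _ _ hz hy0).1 hzy
    rw [map_smul, hhull y hy, smul_eq_mul, mul_one] at hφz
    rwa [hφz, one_smul]
  have hconv : convexHull ℝ (Set.range v) = convexHull ℝ (Set.range p) := by
    apply Set.Subset.antisymm
    · intro z hz
      have hz1 := hhull z hz
      have : Projectivization.mk ℝ z (hne z hz1) ∈ tri e ∪ ⋃ i, tri (Function.update e i (w i)) := by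
        rw [hH]; exact ⟨z, hz, _, rfl⟩
      rcases this with h | h
      · refine convexHull_mono ?_ (mem_convexHull_of_mk_mem_tri hφe _ hz1 h)
        rintro _ ⟨k, rfl⟩
        exact ⟨Sum.inl k, rfl⟩
      · obtain ⟨i, h⟩ := Set.mem_iUnion.1 h
        refine convexHull_mono ?_ (mem_convexHull_of_mk_mem_tri (hφu i) _ hz1 h)
        rintro _ ⟨k, rfl⟩
        rcases eq_or_ne k i with rfl | hk
        · exact ⟨Sum.inr k, by rw [Function.update_self]; rfl⟩
        · exact ⟨Sum.inl k, by rw [Function.update_of_ne hk]; rfl⟩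
    · refine convexHull_min ?_ (convex_convexHull ℝ _)
      rintro _ ⟨k, rfl⟩
      refine hmem (hne _ (hφp k)) (hφp k) ?_
      rw [← hH]
      rcases k with k | k
      · exact Or.inl (vertex_mem_tri e k _)
      · refine Or.inr (Set.mem_iUnion.2 ⟨k, ?_⟩)
        have := vertex_mem_tri (Function.update e k (w k)) k (hne _ (hφu k k))
        simpa only [Function.update_self] using! this
  -- The three inner and three outer vertices have the same hull as the six given ones, so they are
  -- the vertices of the hexagon.
  have hci : ConvexIndependent ℝ p := convexIndependent_of_convexHull_eq hv (by simp) hconv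
  choose y hy using fun i => exists_coords he (w i)
  have hneg : ∀ i, y i i < 0 := fun i => coord_neg he (hw i) (hy i) (hint i)
  have hy3 : ∀ i, w i = y i i • e i + y i (i + 1) • e (i + 1) + y i (i + 2) • e (i + 2) :=
    fun i => (hy i).trans (sum_cyclic _ i)
  have hysum : ∀ i, y i i + y i (i + 1) + y i (i + 2) = 1 := by
    intro i
    have := hφw i
    rw [hy3 i] at this
    simpa only [map_add, map_smul, hφe, smul_eq_mul, mul_one] using this
  -- Otherwise, solving for `e (i + 2)` puts it in the triangle of `w i`, `e i` and `e (i + 1)`;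
  -- `hpos2` is the mirror image.
  have hpos1 : ∀ i, 0 < y i (i + 1) := by
    intro i
    by_contra h0
    have h0 := not_lt.1 h0
    refine ConvexIndependent.ne_combination hci hφp (x := Sum.inl (i + 2)) (i := Sum.inr i)
      (j := Sum.inl i) (k := Sum.inl (i + 1)) (by simp) (by simp)
      (by simp) (d := y i (i + 2)) (a := 1) (b := - y i i)
      (c := - y i (i + 1)) (by linarith [hysum i, hneg i]) (by norm_num) (by linarith [hneg i])
      (by linarith) ?_
    simp only [hp, Sum.elim_inl, Sum.elim_inr]
    rw [hy3 i]
    module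
  have hpos2 : ∀ i, 0 < y i (i + 2) := by
    intro i
    by_contra h0
    have h0 := not_lt.1 h0
    refine ConvexIndependent.ne_combination hci hφp (x := Sum.inl (i + 1)) (i := Sum.inr i)
      (j := Sum.inl i) (k := Sum.inl (i + 2)) (by simp) (by simp)
      (by simp) (d := y i (i + 1)) (a := 1) (b := - y i i)
      (c := - y i (i + 2)) (by linarith [hysum i, hneg i]) (by norm_num) (by linarith [hneg i])
      (by linarith) ?_
    simp only [hp, Sum.elim_inl, Sum.elim_inr]
    rw [hy3 i]
    module
  have hs : ∀ i, 0 < - y i i := fun i => by linarith [hneg i]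
  set b : Fin 3 → ℝ := fun i => y i (i + 1) / (- y i i) with hb
  set c : Fin 3 → ℝ := fun i => y i (i + 2) / (- y i i) with hc
  have hb0 : ∀ i, 0 < b i := fun i => div_pos (hpos1 i) (hs i)
  have hc0 : ∀ i, 0 < c i := fun i => div_pos (hpos2 i) (hs i)
  have hwa : ∀ i, w i = (- y i i) • apex e b c i := by
    intro i
    have h1 : - y i i * b i = y i (i + 1) := mul_div_cancel₀ _ (hs i).ne'
    have h2 : - y i i * c i = y i (i + 2) := mul_div_cancel₀ _ (hs i).ne'
    rw [apex, smul_add, smul_add, ← mul_smul, ← mul_smul, h1, h2, hy3 i]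
    module
  refine ⟨b, c, fun i => - y i i, hb0, hc0, hs, fun i => ?_, hwa⟩
  by_contra h0
  have h0 := not_lt.1 h0
  -- Eliminating `e (i + 1)` between the apexes of index `i + 1` and `i + 2` expresses a positive
  -- multiple of `e i` by these apexes and `(1 - ρ i) • e (i + 2)`. So `ρ i > 1` is strict convexity
  -- at the vertex `e i`.
  refine ConvexIndependent.ne_combination hci hφp (x := Sum.inl i) (i := Sum.inr (i + 1))
    (j := Sum.inr (i + 2)) (k := Sum.inl (i + 2)) (by simp) (by simp)
    (by simp) (d := c (i + 2) * c (i + 1) + b (i + 2)) (a := c (i + 2) / (- y (i + 1) (i + 1)))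
    (b := 1 / (- y (i + 2) (i + 2))) (c := 1 - b (i + 1) * c (i + 2))
    (by have := mul_pos (hc0 (i + 2)) (hc0 (i + 1)); linarith [hb0 (i + 2)])
    (div_nonneg (hc0 _).le (hs _).le) (div_nonneg one_pos.le (hs _).le) (by linarith) ?_
  simp only [hp, Sum.elim_inl, Sum.elim_inr]
  rw [hwa (i + 1), hwa (i + 2), ← mul_smul, ← mul_smul, div_mul_cancel₀ _ (hs _).ne',
    div_mul_cancel₀ _ (hs _).ne', apex, apex, add_one_add_one, add_one_add_two, add_two_add_one,
    add_two_add_two]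
  module

end

/-! ### Rescaling lifts into the plane of the affine chart -/

section Normalize

variable {φ : Module.Dual ℝ (Fin 3 → ℝ)} {u : Fin 3 → Fin 3 → ℝ}

/-- If `φ` had opposite signs at two vertices, it would vanish at an explicit point of the edge
joining them. -/
theorem chart_sign (hu : LinearIndependent ℝ u)
    (h : ∀ z (hz : z ≠ 0), Projectivization.mk ℝ z hz ∈ tri u → φ z ≠ 0) :
    ∃ ε : ℝ, ε * ε = 1 ∧ ∀ j, 0 < ε * φ (u j) := by
  have hv : ∀ j, φ (u j) ≠ 0 := fun j => h _ (hu.ne_zero j) (vertex_mem_tri u j _)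
  have key : ∀ j k, 0 < φ (u j) → 0 < φ (u k) := by
    intro j k hj
    by_contra hk
    have hk : φ (u k) < 0 := lt_of_le_of_ne (not_lt.1 hk) (hv k)
    have hjk : j ≠ k := by rintro rfl; exact lt_asymm hj hk
    have hsum : ∑ l, (if l = j then - φ (u k) else if l = k then φ (u j) else 0) • u l =
        (- φ (u k)) • u j + φ (u j) • u k := by
      rw [Finset.sum_eq_add_of_mem j k (Finset.mem_univ _) (Finset.mem_univ _) hjk]
      · simp [hjk.symm]
      · rintro l - ⟨h1, h2⟩
        simp [h1, h2]
    have hz : ∑ l, (if l = j then - φ (u k) else if l = k then φ (u j) else 0) • u l ≠ 0 :=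
      sum_smul_ne_zero hu (k := k) (by simp [hjk.symm, hj.ne'])
    refine h _ hz ((mk_mem_tri_iff hz).2 ⟨1, _, fun l => ?_, (one_smul _ _).symm⟩) ?_
    · split_ifs <;> linarith
    · rw [hsum, map_add, map_smul, map_smul, smul_eq_mul, smul_eq_mul]
      ring
  rcases lt_or_gt_of_ne (hv 0) with h0 | h0
  · refine ⟨-1, by norm_num, fun j => ?_⟩
    rcases lt_or_gt_of_ne (hv j) with hj | hj
    · linarith
    · exact absurd (key j 0 hj) (not_lt.2 h0.le)
  · exact ⟨1, by norm_num, fun j => by rw [one_mul]; exact key 0 j h0⟩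

variable (φ u) in
/-- The family `u`, rescaled to lie in the affine plane `φ = 1`. -/
def normalize (j : Fin 3) : Fin 3 → ℝ := (φ (u j))⁻¹ • u j

theorem apply_normalize {j : Fin 3} (h : φ (u j) ≠ 0) : φ (normalize φ u j) = 1 := by
  rw [normalize, map_smul, smul_eq_mul, inv_mul_cancel₀ h]

theorem sameCone_normalize {ε : ℝ} (hε : ε * ε = 1) (h : ∀ j, 0 < ε * φ (u j)) :
    SameCone u (normalize φ u) := by
  refine ⟨ε, by rintro rfl; simp at hε, Equiv.refl _, fun j => (ε * φ (u j))⁻¹,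
    fun j => inv_pos.2 (h j), fun j => ?_⟩
  have h1 : ε ≠ 0 := by rintro rfl; simp at hε
  have h2 : φ (u j) ≠ 0 := fun h0 => by have := h j; rw [h0, mul_zero] at this; exact lt_irrefl _ this
  rw [normalize, Equiv.refl_apply]
  congr 1
  field_simp

theorem linearIndependent_normalize (hu : LinearIndependent ℝ u) (h : ∀ j, φ (u j) ≠ 0) :
    LinearIndependent ℝ (normalize φ u) :=
  hu.units_smul fun j => (Units.mk0 _ (h j))⁻¹

theorem normalize_eq_of_smul {u' : Fin 3 → Fin 3 → ℝ} {j k : Fin 3} {d : ℝ} (hd : d ≠ 0)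
    (h : u' j = d • u k) : normalize φ u' j = normalize φ u k := by
  rw [normalize, normalize, h, map_smul, smul_eq_mul, ← mul_smul, mul_inv, mul_right_comm,
    inv_mul_cancel₀ hd, one_mul]

end Normalize

theorem SameCone.of_perm {ι V : Type*} [AddCommGroup V] [Module ℝ V] {u u' : ι → V}
    (σ : Equiv.Perm ι) (h : ∀ i, u' i = u (σ i)) : SameCone u u' :=
  ⟨1, one_ne_zero, σ, fun _ => 1, fun _ => one_pos, fun i => by rw [h, one_mul, one_smul]⟩

/-- The frame of an outer triangle may list the endpoints of the shared edge in either order. -/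
theorem exists_perm_update {e m : Fin 3 → Fin 3 → ℝ} {i : Fin 3}
    (h : (m (i + 1) = e (i + 1) ∧ m (i + 2) = e (i + 2)) ∨
      (m (i + 1) = e (i + 2) ∧ m (i + 2) = e (i + 1))) :
    ∃ σ : Equiv.Perm (Fin 3), ∀ j, Function.update e i (m i) j = m (σ j) := by
  rcases h with ⟨h1, h2⟩ | ⟨h1, h2⟩
  · refine ⟨Equiv.refl _, fun j => ?_⟩
    rcases eq_cyclic i j with rfl | rfl | rfl
    · rw [Function.update_self]; rfl
    · rw [Function.update_of_ne (add_one_ne _), ← h1]; rfl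
    · rw [Function.update_of_ne (add_two_ne _), ← h2]; rfl
  · refine ⟨Equiv.swap (i + 1) (i + 2), fun j => ?_⟩
    rcases eq_cyclic i j with rfl | rfl | rfl
    · rw [Function.update_self,
        Equiv.swap_apply_of_ne_of_ne (add_one_ne j).symm (add_two_ne j).symm]
    · rw [Function.update_of_ne (add_one_ne _), Equiv.swap_apply_left, h2]
    · rw [Function.update_of_ne (add_two_ne _), Equiv.swap_apply_right, h1]

theorem perm_fin_two (σ : Equiv.Perm (Fin 2)) : (σ 0 = 0 ∧ σ 1 = 1) ∨ (σ 0 = 1 ∧ σ 1 = 0) := by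
  revert σ; decide

/-- A frame of a hexagon can be normalized: the inner triangle is spanned by `e`, and the outer
ones by `outer e b c i`. -/
theorem IsHexagonFrame.exists_normal {M₀ : GL (Fin 3) ℝ} {M : Fin 3 → GL (Fin 3) ℝ}
    {T₀ : PuncturedTriangle} {T : Fin 3 → PuncturedTriangle} (h : IsHexagonFrame M₀ M T₀ T) :
    ∃ e : Fin 3 → Fin 3 → ℝ, LinearIndependent ℝ e ∧
      (∀ j, ∃ d : ℝ, e j = d • (M₀ : Matrix (Fin 3) (Fin 3) ℝ).col j) ∧ T₀.1 = pt e ∧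
      ∃ b c : Fin 3 → ℝ, (∀ i, 0 < b i) ∧ (∀ i, 0 < c i) ∧ (∀ i, 1 < b (i + 1) * c (i + 2)) ∧
        ∀ i, (T i).1 = pt (outer e b c i) := by
  obtain ⟨φ, v, hφv, hv, hH⟩ := h.hexagon
  set u := (M₀ : Matrix (Fin 3) (Fin 3) ℝ).col with hu_def
  set m : Fin 3 → Fin 3 → Fin 3 → ℝ := fun i => (M i : Matrix (Fin 3) (Fin 3) ℝ).col with hm_def
  have hu : LinearIndependent ℝ u := linearIndependent_col M₀
  have hm : ∀ i, LinearIndependent ℝ (m i) := fun i => linearIndependent_col (M i)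
  have hhull : ∀ y ∈ convexHull ℝ (Set.range v), φ y = 1 := by
    have hconv : Convex ℝ {y | φ y = 1} := convex_hyperplane φ.isLinear 1
    intro y hy
    exact convexHull_min (by rintro _ ⟨k, rfl⟩; exact hφv k) hconv hy
  simp only [closedTriangle_eq] at hH
  have hchart : ∀ z (hz : z ≠ 0), Projectivization.mk ℝ z hz ∈ tri u ∪ ⋃ i, tri (m i) →
      φ z ≠ 0 := by
    intro z hz hmem
    rw [hH] at hmem
    obtain ⟨y, hy, hy0, hzy⟩ := hmem
    obtain ⟨c, rfl⟩ := (Projectivization.mk_eq_mk_iff' ℝ _ _ hz hy0).1 hzy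
    rw [map_smul, hhull y hy, smul_eq_mul, mul_one]
    rintro rfl
    exact hz (zero_smul _ _)
  obtain ⟨ε₀, hε₀, hs₀⟩ := chart_sign (φ := φ) hu fun z hz hmem => hchart z hz (Or.inl hmem)
  have hsm := fun i => chart_sign (φ := φ) (hm i) fun z hz hmem =>
    hchart z hz (Or.inr (Set.mem_iUnion.2 ⟨i, hmem⟩))
  choose ε hε hs using hsm
  have hφu : ∀ j, φ (u j) ≠ 0 := fun j h0 => by
    have := hs₀ j; rw [h0, mul_zero] at this; exact lt_irrefl _ this
  have hφm : ∀ i j, φ (m i j) ≠ 0 := fun i j h0 => by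
    have := hs i j; rw [h0, mul_zero] at this; exact lt_irrefl _ this
  set e := normalize φ u with he_def
  set w : Fin 3 → Fin 3 → ℝ := fun i => normalize φ (m i) i with hw_def
  have he : LinearIndependent ℝ e := linearIndependent_normalize hu hφu
  -- A shared edge gives proportional lifts of its endpoints; in the plane `φ = 1` they coincide.
  have hedge : ∀ i, (normalize φ (m i) (i + 1) = e (i + 1) ∧
        normalize φ (m i) (i + 2) = e (i + 2)) ∨
      (normalize φ (m i) (i + 1) = e (i + 2) ∧ normalize φ (m i) (i + 2) = e (i + 1)) := by
    intro i
    have h1 := h.edge_eq i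
    rw [openEdge_eq, openEdge_eq] at h1
    obtain ⟨η, hη, σ, d, hd, h2⟩ := sameCone_of_edge_eq hu (hm i) h1
    have h3 : m i (i + 1) = (η * d 0) • (![u (i + 1), u (i + 2)] : Fin 2 → _) (σ 0) := h2 0
    have h4 : m i (i + 2) = (η * d 1) • (![u (i + 1), u (i + 2)] : Fin 2 → _) (σ 1) := h2 1
    have hd0 : η * d 0 ≠ 0 := mul_ne_zero hη (hd 0).ne'
    have hd1 : η * d 1 ≠ 0 := mul_ne_zero hη (hd 1).ne'
    have hσ : (σ 0 = 0 ∧ σ 1 = 1) ∨ (σ 0 = 1 ∧ σ 1 = 0) := perm_fin_two σ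
    rcases hσ with ⟨s0, s1⟩ | ⟨s0, s1⟩
    · rw [s0] at h3
      rw [s1] at h4
      exact Or.inl ⟨normalize_eq_of_smul hd0 h3, normalize_eq_of_smul hd1 h4⟩
    · rw [s0] at h3
      rw [s1] at h4
      exact Or.inr ⟨normalize_eq_of_smul hd0 h3, normalize_eq_of_smul hd1 h4⟩
  have hperm := fun i => exists_perm_update (hedge i)
  choose σ hσ using hperm
  have hcone₀ : SameCone u e := sameCone_normalize hε₀ hs₀
  have hcone : ∀ i, SameCone (m i) (normalize φ (m i)) := fun i => sameCone_normalize (hε i) (hs i)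
  have hcone' : ∀ i, SameCone (normalize φ (m i)) (Function.update e i (w i)) :=
    fun i => SameCone.of_perm (σ i) (hσ i)
  have hpt : ∀ i, (T i).1 = pt (Function.update e i (w i)) := fun i => by
    rw [h.outer_eq, puncturedTriangle_eq, (hcone i).pt_eq, (hcone' i).pt_eq]
  have hpt₀ : T₀.1 = pt e := by rw [h.center_eq, puncturedTriangle_eq, hcone₀.pt_eq]
  have hw : ∀ i, LinearIndependent ℝ (Function.update e i (w i)) := by
    intro i
    have := (linearIndependent_normalize (hm i) (hφm i)).comp (σ i) (σ i).injective
    convert this using 1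
    funext j
    exact hσ i j
  obtain ⟨b, c, s, hb, hc, hs', hbc, hwa⟩ := exists_apex (φ := φ) (w := w) he
    (fun j => apply_normalize (hφu j)) (fun i => apply_normalize (hφm i i)) hw (by
      intro i z hz h1 h2
      rw [← hpt₀] at h1
      rw [← hpt i] at h2
      have h3 : Projectivization.mk ℝ z hz ∈ openEdge M₀ i := by
        rw [← h.inter_eq i]; exact ⟨h1, h2⟩
      rw [openEdge_eq, mk_mem_edge_iff] at h3
      obtain ⟨d, t, ht, -, rfl⟩ := h3
      refine ⟨fun j => d * t j * φ (u j), by dsimp only; rw [ht]; ring, ?_⟩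
      rw [Finset.smul_sum]
      refine Finset.sum_congr rfl fun j _ => ?_
      rw [he_def, normalize, ← mul_smul, ← mul_smul, mul_assoc (d * t j),
        mul_inv_cancel₀ (hφu j), mul_one]) hφv hv (by
      rw [← hH, ← hcone₀.tri_eq]
      congr 1
      exact Set.iUnion_congr fun i => by rw [← (hcone' i).tri_eq, ← (hcone i).tri_eq])
  refine ⟨e, he, fun j => ⟨_, rfl⟩, hpt₀, b, c, hb, hc, hbc, fun i => ?_⟩
  rw [hpt i]
  -- The factor `s i > 0` between `w i` and the apex is absorbed by rescaling a single vertex.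
  refine SameCone.pt_eq ⟨1, one_ne_zero, Equiv.refl _, fun j => if j = i then (s i)⁻¹ else 1,
    fun j => ?_, fun j => ?_⟩
  · dsimp only
    split_ifs
    · exact inv_pos.2 (hs' i)
    · exact one_pos
  · rw [outer, Equiv.refl_apply, one_mul]
    dsimp only
    rcases eq_or_ne j i with rfl | hj
    · rw [if_pos rfl, Function.update_self, Function.update_self, hwa, ← mul_smul,
        inv_mul_cancel₀ (hs' j).ne', one_smul]
    · rw [if_neg hj, Function.update_of_ne hj, Function.update_of_ne hj, one_smul]

/-! ### Normal forms -/

theorem outer_self (e : Fin 3 → Fin 3 → ℝ) (b c : Fin 3 → ℝ) (i : Fin 3) :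
    outer e b c i i = apex e b c i := Function.update_self ..

theorem outer_of_ne (e : Fin 3 → Fin 3 → ℝ) (b c : Fin 3 → ℝ) {i j : Fin 3} (h : j ≠ i) :
    outer e b c i j = e j := Function.update_of_ne h ..

theorem sum_outer (e : Fin 3 → Fin 3 → ℝ) (b c t : Fin 3 → ℝ) (i : Fin 3) :
    ∑ j, t j • outer e b c i j =
      (-t i) • e i + (t (i + 1) + t i * b i) • e (i + 1) + (t (i + 2) + t i * c i) • e (i + 2) := by
  rw [outer, sum_update, apex]
  module

theorem cyclic_coords {e : Fin 3 → Fin 3 → ℝ} (he : LinearIndependent ℝ e) (i : Fin 3)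
    {x y z x' y' z' : ℝ} (h : x • e i + y • e (i + 1) + z • e (i + 2) =
      x' • e i + y' • e (i + 1) + z' • e (i + 2)) : x = x' ∧ y = y' ∧ z = z' := by
  have aux : ∀ x y z : ℝ, x • e i + y • e (i + 1) + z • e (i + 2) =
      ∑ j, (if j = i then x else if j = i + 1 then y else z) • e j := by
    intro x y z
    rw [sum_cyclic _ i]
    simp
  rw [aux, aux] at h
  have h0 := sum_smul_inj he h i
  have h1 := sum_smul_inj he h (i + 1)
  have h2 := sum_smul_inj he h (i + 2)
  simp at h0 h1 h2
  exact ⟨h0, h1, h2⟩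

theorem linearIndependent_outer {e : Fin 3 → Fin 3 → ℝ} (he : LinearIndependent ℝ e)
    (b c : Fin 3 → ℝ) (i : Fin 3) : LinearIndependent ℝ (outer e b c i) := by
  rw [Fintype.linearIndependent_iff]
  intro t ht
  rw [sum_outer] at ht
  obtain ⟨h0, h1, h2⟩ := cyclic_coords he i (x' := 0) (y' := 0) (z' := 0) (by rw [ht]; simp)
  have h0 : t i = 0 := by linarith
  rw [h0] at h1 h2
  intro j
  rcases eq_cyclic i j with rfl | rfl | rfl
  · exact h0
  · linarith
  · linarith

theorem linearIndependent_smul (g : SL(3, ℝ)) {u : Fin 3 → Fin 3 → ℝ}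
    (hu : LinearIndependent ℝ u) : LinearIndependent ℝ fun j => g • u j := by
  rw [Fintype.linearIndependent_iff]
  intro t ht
  rw [← smul_sum_smul, smul_eq_zero_iff_eq] at ht
  exact Fintype.linearIndependent_iff.1 hu t ht

/-- The positivity conditions on the parameters of a hexagon with its gluing maps. -/
structure IsPos (b c κ μ ν : Fin 3 → ℝ) : Prop where
  b_pos : ∀ i, 0 < b i
  c_pos : ∀ i, 0 < c i
  rho : ∀ i, 1 < b (i + 1) * c (i + 2)
  κ_pos : ∀ i, 0 < κ i
  μ_pos : ∀ i, 0 < μ i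
  ν_pos : ∀ i, 0 < ν i

/-- `γ` acts on the basis `e` and the apexes by the standard formulas. -/
structure IsStd (γ : Fin 3 → SL(3, ℝ)) (e : Fin 3 → Fin 3 → ℝ) (b c κ μ ν : Fin 3 → ℝ) : Prop where
  indep : LinearIndependent ℝ e
  fix : ∀ i, γ i • e i = κ i • e i
  unflip : ∀ i, γ i • apex e b c (i + 1) = μ i • e (i + 1)
  flip : ∀ i, γ i • e (i + 2) = ν i • apex e b c (i + 2)

/-- By rigidity `γ i` carries the vertices `e i`, `apex (i + 1)`, `e (i + 2)` of its source triangle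
to `e i`, `e (i + 1)`, `apex (i + 2)` in some order. Fixing `e i` with `κ i > 0` leaves two
matchings and makes all factors positive; the product relation decides between the two. -/
theorem exists_isStd {γ : Fin 3 → SL(3, ℝ)} {e : Fin 3 → Fin 3 → ℝ} {b c κ : Fin 3 → ℝ}
    (he : LinearIndependent ℝ e) (hb : ∀ i, 0 < b i) (hc : ∀ i, 0 < c i)
    (hbc : ∀ i, 1 < b (i + 1) * c (i + 2)) (hκ : ∀ i, 0 < κ i)
    (hfix : ∀ i, γ i • e i = κ i • e i) (hprod : γ 2 * γ 1 * γ 0 = 1)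
    (hT : ∀ i, γ i • pt (outer e b c (i + 1)) = pt (outer e b c (i + 2))) :
    ∃ μ ν : Fin 3 → ℝ, IsPos b c κ μ ν ∧ IsStd γ e b c κ μ ν := by
  have hprod' : ∀ i, γ (i + 2) * γ (i + 1) * γ i = 1 := by
    intro i
    fin_cases i
    · exact hprod
    · change γ 0 * γ 2 * γ 1 = 1
      rw [mul_assoc, mul_eq_one_comm]
      exact hprod
    · change γ 1 * γ 0 * γ 2 = 1
      rw [mul_eq_one_comm, ← mul_assoc]
      exact hprod
  have halt : ∀ i, ∃ p q : ℝ, 0 < p ∧ 0 < q ∧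
      ((γ i • apex e b c (i + 1) = p • e (i + 1) ∧ γ i • e (i + 2) = q • apex e b c (i + 2)) ∨
        γ i • e (i + 2) = q • e (i + 1)) := by
    intro i
    have h1 := hT i
    rw [smul_pt] at h1
    have hind : LinearIndependent ℝ fun j => γ i • outer e b c (i + 1) j :=
      linearIndependent_smul (γ i) (linearIndependent_outer he b c (i + 1))
    have hout := linearIndependent_outer he b c (i + 2)
    obtain ⟨ε, hε, σ, d, hd, hσ⟩ := sameCone_of_pt_eq hout hind h1.symm
    have e0 : outer e b c (i + 2) i = e i := outer_of_ne e b c (add_two_ne i).symm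
    have e1 : outer e b c (i + 2) (i + 1) = e (i + 1) :=
      outer_of_ne e b c (add_two_ne_add_one i).symm
    have e2 : outer e b c (i + 2) (i + 2) = apex e b c (i + 2) := outer_self ..
    have g0 := hσ i
    have g1 := hσ (i + 1)
    have g2 := hσ (i + 2)
    simp only at g0 g1 g2
    rw [outer_of_ne e b c (add_one_ne i).symm, hfix] at g0
    rw [outer_self] at g1
    rw [outer_of_ne e b c (add_two_ne_add_one i)] at g2
    -- `e i` is a vertex of both triangles and is mapped to a multiple of itself.
    have hσi : σ i = i := by
      by_contra hne
      rw [← e0] at g0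
      have h2 := sum_smul_inj hout (a := fun j => if j = i then κ i else 0)
        (b := fun j => if j = σ i then ε * d i else 0) (by simpa using g0) i
      simp [Ne.symm hne] at h2
      exact (hκ i).ne' h2
    have hεd : κ i = ε * d i := by
      rw [hσi, e0] at g0
      exact smul_left_injective ℝ (he.ne_zero i) g0
    -- The positive eigenvalue at `e i` fixes the common sign for all three vertices.
    have hε' : 0 < ε := pos_of_mul_pos_left (by rw [← hεd]; exact hκ i) (hd i).le
    refine ⟨ε * d (i + 1), ε * d (i + 2), mul_pos hε' (hd _), mul_pos hε' (hd _), ?_⟩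
    have h12 : (σ (i + 1) = i + 1 ∧ σ (i + 2) = i + 2) ∨ σ (i + 2) = i + 1 := by
      have n1 : σ (i + 1) ≠ i := fun h => add_one_ne i (σ.injective (h.trans hσi.symm))
      have n2 : σ (i + 2) ≠ i := fun h => add_two_ne i (σ.injective (h.trans hσi.symm))
      have n3 : σ (i + 2) ≠ σ (i + 1) := fun h => add_two_ne_add_one i (σ.injective h)
      rcases eq_cyclic i (σ (i + 2)) with h | h | h
      · exact absurd h n2
      · exact Or.inr h
      · rcases eq_cyclic i (σ (i + 1)) with h' | h' | h'
        · exact absurd h' n1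
        · exact Or.inl ⟨h', h⟩
        · exact absurd (h.trans h'.symm) n3
    rcases h12 with ⟨h, h'⟩ | h
    · rw [h, e1] at g1
      rw [h', e2] at g2
      exact Or.inl ⟨g1, g2⟩
    · rw [h, e1] at g2
      exact Or.inr g2
  choose μ ν hμ hν halt using halt
  have hgood : ∀ i, γ i • apex e b c (i + 1) = μ i • e (i + 1) ∧
      γ i • e (i + 2) = ν i • apex e b c (i + 2) := by
    intro i
    -- In the bad matching `e (i + 2)` goes to the line of `e (i + 1)`, which `γ (i + 1)` fixes, and
    -- `γ (i + 2)` sends this line to that of `apex (i + 1)` or `e i`. Neither is the line of `e (i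
    -- + 2)`, contrary to the product being 1.
    refine (halt i).resolve_right fun hbad => ?_
    have h1 : (γ (i + 2) * γ (i + 1) * γ i) • e (i + 2) = e (i + 2) := by rw [hprod', one_smul]
    rw [mul_smul, mul_smul, hbad, smul_comm (γ (i + 1)) (ν i), hfix, smul_comm (γ (i + 2)) (ν i),
      smul_comm (γ (i + 2)) (κ (i + 1))] at h1
    have h2 := halt (i + 2)
    rw [add_two_add_two, add_two_add_one] at h2
    have hne : ν i * κ (i + 1) * ν (i + 2) ≠ 0 := (mul_pos (mul_pos (hν _) (hκ _)) (hν _)).ne'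
    rcases h2 with ⟨-, h2⟩ | h2
    · rw [h2, apex, add_one_add_one, add_one_add_two] at h1
      have := (cyclic_coords he i (x := ν i * κ (i + 1) * ν (i + 2) * c (i + 1))
        (y := - (ν i * κ (i + 1) * ν (i + 2))) (z := ν i * κ (i + 1) * ν (i + 2) * b (i + 1))
        (x' := 0) (y' := 0) (z' := 1) (by
          refine Eq.trans ?_ (h1.trans ?_) <;> module)).2.1
      exact hne (by linarith)
    · rw [h2] at h1
      have := (cyclic_coords he i (x := ν i * κ (i + 1) * ν (i + 2))
        (y := 0) (z := 0) (x' := 0) (y' := 0) (z' := 1) (by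
          refine Eq.trans ?_ (h1.trans ?_) <;> module)).1
      exact hne this
  exact ⟨μ, ν, ⟨hb, hc, hbc, hκ, hμ, hν⟩, he, hfix, fun i => (hgood i).1, fun i => (hgood i).2⟩

/-! ### The matrix of a gluing map -/

/-- The matrix with columns `e i`, `e (i + 1)`, `e (i + 2)`. -/
def basisMat (e : Fin 3 → Fin 3 → ℝ) (i : Fin 3) : Matrix (Fin 3) (Fin 3) ℝ :=
  Matrix.of fun r k => e (i + k) r

/-- The matrix of `γ i` in the basis `e i`, `e (i + 1)`, `e (i + 2)`. -/
def core (κ μ ν b c b' c' : ℝ) : Matrix (Fin 3) (Fin 3) ℝ :=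
  !![κ, c * κ + b * ν * b', ν * b'; 0, b * ν * c' - μ, ν * c'; 0, -(b * ν), -ν]

theorem det_basisMat_ne_zero {e : Fin 3 → Fin 3 → ℝ} (he : LinearIndependent ℝ e) (i : Fin 3) :
    (basisMat e i).det ≠ 0 := by
  have h : LinearIndependent ℝ (basisMat e i).col := by
    have := he.comp (Equiv.addLeft i) (Equiv.addLeft i).injective
    exact this
  exact ((Matrix.isUnit_iff_isUnit_det _).1 (Matrix.linearIndependent_cols_iff_isUnit.1 h)).ne_zero

section Algebra

variable {γ : Fin 3 → SL(3, ℝ)} {e : Fin 3 → Fin 3 → ℝ} {b c κ μ ν : Fin 3 → ℝ}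

theorem IsStd.apply_mid (h : IsStd γ e b c κ μ ν) (i : Fin 3) :
    γ i • e (i + 1) = (c (i + 1) * κ i + b (i + 1) * ν i * b (i + 2)) • e i +
      (b (i + 1) * ν i * c (i + 2) - μ i) • e (i + 1) + (-(b (i + 1) * ν i)) • e (i + 2) := by
  have h1 := h.unflip i
  have h2 := h.flip i
  have h3 : e (i + 1) = b (i + 1) • e (i + 2) + c (i + 1) • e i - apex e b c (i + 1) := by
    rw [apex, add_one_add_one, add_one_add_two]
    module
  conv_lhs => rw [h3]
  rw [smul_sub, smul_add, smul_comm (γ i) (b _), smul_comm (γ i) (c _), h1, h2, h.fix, apex,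
    add_two_add_one, add_two_add_two]
  module

theorem IsStd.apply_last (h : IsStd γ e b c κ μ ν) (i : Fin 3) :
    γ i • e (i + 2) = (ν i * b (i + 2)) • e i + (ν i * c (i + 2)) • e (i + 1) +
      (-ν i) • e (i + 2) := by
  rw [h.flip, apex, add_two_add_one, add_two_add_two]
  module

theorem IsStd.mul_basisMat (h : IsStd γ e b c κ μ ν) (i : Fin 3) :
    (γ i : Matrix (Fin 3) (Fin 3) ℝ) * basisMat e i = basisMat e i *
      core (κ i) (μ i) (ν i) (b (i + 1)) (c (i + 1)) (b (i + 2)) (c (i + 2)) := by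
  have hcol : ∀ r k, ((γ i : Matrix (Fin 3) (Fin 3) ℝ) * basisMat e i) r k =
      (γ i • e (i + k)) r := fun r k => rfl
  ext r k
  rw [hcol]
  fin_cases k
  · change (γ i • e (i + 0)) r = _
    rw [add_zero, h.fix]
    simp [basisMat, core, Matrix.mul_apply, Fin.sum_univ_three, mul_comm]
  · change (γ i • e (i + 1)) r = _
    rw [h.apply_mid]
    simp [basisMat, core, Matrix.mul_apply, Fin.sum_univ_three]
    ring
  · change (γ i • e (i + 2)) r = _
    rw [h.apply_last]
    simp [basisMat, core, Matrix.mul_apply, Fin.sum_univ_three]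
    ring

theorem det_core (κ μ ν b c b' c' : ℝ) : (core κ μ ν b c b' c').det = κ * μ * ν := by
  simp [core, Matrix.det_fin_three]
  ring

theorem IsStd.mul_eq_one (h : IsStd γ e b c κ μ ν) (i : Fin 3) : κ i * μ i * ν i = 1 := by
  have h1 := congrArg Matrix.det (h.mul_basisMat i)
  rw [Matrix.det_mul, Matrix.det_mul, (γ i).2, det_core, one_mul, mul_comm] at h1
  exact (mul_eq_right₀ (det_basisMat_ne_zero h.indep i)).1 h1.symm

theorem charpoly_eq_of_mul_eq {A B C : Matrix (Fin 3) (Fin 3) ℝ} (hB : B.det ≠ 0)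
    (h : A * B = B * C) : A.charpoly = C.charpoly := by
  have hB' : IsUnit B.det := isUnit_iff_ne_zero.2 hB
  have hA : A = B * (C * B⁻¹) := by
    rw [← Matrix.mul_assoc, ← h, Matrix.mul_assoc, Matrix.mul_nonsing_inv _ hB', Matrix.mul_one]
  rw [hA, Matrix.charpoly_mul_comm, Matrix.mul_assoc, Matrix.nonsing_inv_mul _ hB', Matrix.mul_one]

theorem IsStd.charpoly (h : IsStd γ e b c κ μ ν) (i : Fin 3) :
    (γ i : Matrix (Fin 3) (Fin 3) ℝ).charpoly =
      (core (κ i) (μ i) (ν i) (b (i + 1)) (c (i + 1)) (b (i + 2)) (c (i + 2))).charpoly :=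
  charpoly_eq_of_mul_eq (det_basisMat_ne_zero h.indep i) (h.mul_basisMat i)

open Polynomial in
-- The matrix is block triangular; its lower block has trace `-μ + ν * (b * c' - 1)` and determinant
-- `μ * ν = κ⁻¹`.
theorem charpoly_core {κ μ ν b c b' c' τ : ℝ} (hdet : κ * μ * ν = 1)
    (hτ : -μ + ν * (b * c' - 1) = τ) :
    (core κ μ ν b c b' c').charpoly = (X - C κ) * (X ^ 2 - C τ * X + C κ⁻¹) := by
  have hκ : κ ≠ 0 := by rintro rfl; simp at hdet
  have hinv : κ⁻¹ = μ * ν := by field_simp; linarith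
  rw [charpoly_fin_three, det_core, hinv, ← hτ]
  simp [core, Matrix.trace_fin_three]
  ring

open Polynomial in
theorem tau_eq_of_charpoly_core {κ μ ν b c b' c' τ : ℝ}
    (h : (core κ μ ν b c b' c').charpoly = (X - C κ) * (X ^ 2 - C τ * X + C κ⁻¹)) :
    -μ + ν * (b * c' - 1) = τ := by
  have h0 : (X - C κ) * (X ^ 2 - C τ * X + C κ⁻¹) =
      X ^ 3 - C (κ + τ) * X ^ 2 + C (κ⁻¹ + κ * τ) * X - C (κ * κ⁻¹) := by
    simp only [C_add, C_mul]; ring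
  have h1 := congrArg (fun p => coeff p 2) (h.trans h0)
  rw [charpoly_fin_three] at h1
  simp [core, Matrix.trace_fin_three, -map_add, -map_sub, -map_mul, -map_neg] at h1
  linarith

/-- Follow `e i` through the product: it is fixed, then flipped to its apex, then brought back,
picking up `κ i`, `ν (i + 1)` and `μ (i + 2)`. -/
theorem IsStd.comp_eq_one (h : IsStd γ e b c κ μ ν) (hprod : γ 2 * γ 1 * γ 0 = 1) (i : Fin 3) :
    κ i * ν (i + 1) * μ (i + 2) = 1 := by
  have hprod' : γ (i + 2) * γ (i + 1) * γ i = 1 := by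
    fin_cases i
    · exact hprod
    · change γ 0 * γ 2 * γ 1 = 1
      rw [mul_assoc, mul_eq_one_comm]
      exact hprod
    · change γ 1 * γ 0 * γ 2 = 1
      rw [mul_eq_one_comm, ← mul_assoc]
      exact hprod
  have h1 : (γ (i + 2) * γ (i + 1) * γ i) • e i = e i := by rw [hprod', one_smul]
  have h2 := h.flip (i + 1)
  have h3 := h.unflip (i + 2)
  rw [add_one_add_two] at h2
  rw [add_two_add_one] at h3
  rw [mul_smul, mul_smul, h.fix, smul_comm (γ (i + 1)) (κ i), h2, smul_comm (γ (i + 2)) (κ i),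
    smul_comm (γ (i + 2)) (ν (i + 1)), h3, ← mul_smul, ← mul_smul] at h1
  exact smul_left_injective ℝ (h.indep.ne_zero i) (h1.trans (one_smul ℝ _).symm)

/-- The eigenspace of `γ i` for `κ i` is spanned by `e i`. -/
theorem IsStd.eq_smul_of_fix (h : IsStd γ e b c κ μ ν) (hp : IsPos b c κ μ ν) {i : Fin 3}
    {v : Fin 3 → ℝ} (hv : γ i • v = κ i • v) : ∃ t : ℝ, v = t • e i := by
  obtain ⟨y, hy⟩ := exists_coords h.indep v
  rw [sum_cyclic _ i] at hy
  have h1 : γ i • v = (y i * κ i + y (i + 1) * (c (i + 1) * κ i + b (i + 1) * ν i * b (i + 2)) +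
      y (i + 2) * (ν i * b (i + 2))) • e i + (y (i + 1) * (b (i + 1) * ν i * c (i + 2) - μ i) +
      y (i + 2) * (ν i * c (i + 2))) • e (i + 1) +
      (y (i + 1) * (-(b (i + 1) * ν i)) + y (i + 2) * (-ν i)) • e (i + 2) := by
    rw [hy, smul_add, smul_add, smul_comm (γ i) (y i), smul_comm (γ i) (y (i + 1)),
      smul_comm (γ i) (y (i + 2)), h.fix, h.apply_mid, h.apply_last]
    module
  have h2 : κ i • v = (κ i * y i) • e i + (κ i * y (i + 1)) • e (i + 1) +
      (κ i * y (i + 2)) • e (i + 2) := by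
    rw [hy]
    module
  rw [h1, h2] at hv
  obtain ⟨e0, -, e2⟩ := cyclic_coords h.indep i hv
  have hν := hp.ν_pos i
  have hκ := hp.κ_pos i
  have hb1 := hp.b_pos (i + 1)
  have hb2 := hp.b_pos (i + 2)
  have hc1 := hp.c_pos (i + 1)
  -- Eliminating `y (i + 2)` leaves a 2×2 minor of `core - κ`, whose terms are all positive. Hence
  -- the eigenspace is a line even when `κ i` is a multiple eigenvalue.
  have key : y (i + 1) * ((c (i + 1) * κ i) * (ν i + κ i) + b (i + 1) * ν i * b (i + 2) * κ i) = 0 := by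
    linear_combination (ν i + κ i) * e0 + ν i * b (i + 2) * e2
  have hy1 : y (i + 1) = 0 := by
    refine (mul_eq_zero.1 key).resolve_right (ne_of_gt ?_)
    positivity
  have hy2 : y (i + 2) = 0 := by
    rw [hy1] at e2
    have : y (i + 2) * (κ i + ν i) = 0 := by linear_combination -e2
    exact (mul_eq_zero.1 this).resolve_right (by positivity)
  exact ⟨y i, by rw [hy, hy1, hy2, zero_smul, zero_smul, add_zero, add_zero]⟩

/-- Rescaling the basis. -/
theorem IsStd.scale (h : IsStd γ e b c κ μ ν) {t : Fin 3 → ℝ} (ht : ∀ i, t i ≠ 0) :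
    IsStd γ (fun i => t i • e i) (fun i => t i * b i / t (i + 1)) (fun i => t i * c i / t (i + 2))
      κ μ ν := by
  have hap : ∀ i, apex (fun i => t i • e i) (fun i => t i * b i / t (i + 1))
      (fun i => t i * c i / t (i + 2)) i = t i • apex e b c i := by
    intro i
    rw [apex, apex, ← mul_smul, ← mul_smul, div_mul_cancel₀ _ (ht _), div_mul_cancel₀ _ (ht _)]
    module
  refine ⟨h.indep.units_smul fun i => Units.mk0 _ (ht i), fun i => ?_, fun i => ?_, fun i => ?_⟩
  · rw [smul_comm, h.fix, smul_comm]
  · rw [hap, smul_comm, h.unflip, smul_comm]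
  · rw [hap, smul_comm, h.flip, smul_comm]

/-- The determinant with rows `u`, `v`, `w`. -/
def det3 (u v w : Fin 3 → ℝ) : ℝ := Matrix.det (Matrix.of ![u, v, w])

variable (γ e) in
/-- The parameter `ν i` in terms of the gluing maps and their eigenvectors. -/
def nuOf (i : Fin 3) : ℝ :=
  -det3 (e i) (e (i + 1)) (γ i • e (i + 2)) / det3 (e i) (e (i + 1)) (e (i + 2))

variable (γ e) in
/-- The parameter `b i` in terms of the gluing maps and their eigenvectors. -/
def bOf (i : Fin 3) : ℝ :=
  -det3 (γ (i + 1) • e i) (e (i + 2)) (e i) / det3 (e (i + 1)) (e (i + 2)) (γ (i + 1) • e i)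

variable (γ e) in
/-- The parameter `c i` in terms of the gluing maps and their eigenvectors. -/
def cOf (i : Fin 3) : ℝ :=
  -det3 (e (i + 1)) (γ (i + 1) • e i) (e i) / det3 (e (i + 1)) (e (i + 2)) (γ (i + 1) • e i)

theorem det3_ne_zero (he : LinearIndependent ℝ e) (i : Fin 3) :
    det3 (e i) (e (i + 1)) (e (i + 2)) ≠ 0 := by
  have : det3 (e i) (e (i + 1)) (e (i + 2)) = (basisMat e i).det := by
    simp [det3, basisMat, Matrix.det_fin_three]
    ring
  rw [this]
  exact det_basisMat_ne_zero he i

theorem IsStd.det3_flip (h : IsStd γ e b c κ μ ν) (i : Fin 3) :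
    det3 (e i) (e (i + 1)) (γ i • e (i + 2)) = -ν i * det3 (e i) (e (i + 1)) (e (i + 2)) := by
  rw [h.apply_last]
  simp [det3, Matrix.det_fin_three]
  ring

theorem IsStd.nuOf_eq (h : IsStd γ e b c κ μ ν) (i : Fin 3) : nuOf γ e i = ν i := by
  rw [nuOf, h.det3_flip, neg_mul, neg_neg, mul_div_cancel_right₀ _ (det3_ne_zero h.indep i)]

theorem IsStd.ν_ne_zero (h : IsStd γ e b c κ μ ν) (i : Fin 3) : ν i ≠ 0 := fun h0 => by
  have := h.mul_eq_one i
  rw [h0, mul_zero] at this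
  exact zero_ne_one this

theorem IsStd.bOf_eq (h : IsStd γ e b c κ μ ν) (i : Fin 3) : bOf γ e i = b i := by
  have h1 := h.apply_last (i + 1)
  have h2 := h.det3_flip (i + 1)
  have h3 := det3_ne_zero h.indep (i + 1)
  have h4 := h.ν_ne_zero (i + 1)
  rw [add_one_add_two, add_one_add_one] at h1 h2 h3
  have h5 : det3 (γ (i + 1) • e i) (e (i + 2)) (e i) =
      ν (i + 1) * b i * det3 (e (i + 1)) (e (i + 2)) (e i) := by
    rw [h1]
    simp [det3, Matrix.det_fin_three]
    ring
  rw [bOf, h2, h5]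
  field_simp

theorem IsStd.cOf_eq (h : IsStd γ e b c κ μ ν) (i : Fin 3) : cOf γ e i = c i := by
  have h1 := h.apply_last (i + 1)
  have h2 := h.det3_flip (i + 1)
  have h3 := det3_ne_zero h.indep (i + 1)
  have h4 := h.ν_ne_zero (i + 1)
  rw [add_one_add_two, add_one_add_one] at h1 h2 h3
  have h5 : det3 (e (i + 1)) (γ (i + 1) • e i) (e i) =
      ν (i + 1) * c i * det3 (e (i + 1)) (e (i + 2)) (e i) := by
    rw [h1]
    simp [det3, Matrix.det_fin_three]
    ring
  rw [cOf, h2, h5]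
  field_simp

/-- Columns of the adjugate of `γ i - κ i` are eigenvectors. -/
def eigencol (A : Matrix (Fin 3) (Fin 3) ℝ) (k : ℝ) (s : Fin 3) : Fin 3 → ℝ :=
  (A - k • (1 : Matrix (Fin 3) (Fin 3) ℝ)).adjugate.col s

theorem core_sub_smul (κ μ ν b c b' c' : ℝ) :
    (core κ μ ν b c b' c' - κ • (1 : Matrix (Fin 3) (Fin 3) ℝ)) =
      !![0, c * κ + b * ν * b', ν * b'; 0, b * ν * c' - μ - κ, ν * c'; 0, -(b * ν), -ν - κ] := by
  ext i j
  fin_cases i <;> fin_cases j <;> simp [core]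

theorem IsStd.sub_mul_basisMat (h : IsStd γ e b c κ μ ν) (i : Fin 3) :
    ((γ i : Matrix (Fin 3) (Fin 3) ℝ) - κ i • (1 : Matrix (Fin 3) (Fin 3) ℝ)) * basisMat e i =
      basisMat e i * (core (κ i) (μ i) (ν i) (b (i + 1)) (c (i + 1)) (b (i + 2)) (c (i + 2)) -
        κ i • (1 : Matrix (Fin 3) (Fin 3) ℝ)) := by
  rw [Matrix.sub_mul, Matrix.mul_sub, h.mul_basisMat, Matrix.smul_mul, Matrix.mul_smul,
    Matrix.one_mul, Matrix.mul_one]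

/-- `(γ - κ) * adjugate (γ - κ) = det (γ - κ) = 0`. -/
theorem IsStd.smul_eigencol (h : IsStd γ e b c κ μ ν) (i s : Fin 3) :
    γ i • eigencol (γ i) (κ i) s = κ i • eigencol (γ i) (κ i) s := by
  have hdet : ((γ i : Matrix (Fin 3) (Fin 3) ℝ) - κ i • (1 : Matrix (Fin 3) (Fin 3) ℝ)).det = 0 := by
    have h1 := congrArg Matrix.det (h.sub_mul_basisMat i)
    rw [Matrix.det_mul, Matrix.det_mul, core_sub_smul] at h1
    have h2 : ((γ i : Matrix (Fin 3) (Fin 3) ℝ) - κ i • (1 : Matrix (Fin 3) (Fin 3) ℝ)).det *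
        (basisMat e i).det = 0 := by
      rw [h1]
      simp [Matrix.det_fin_three]
    exact (mul_eq_zero.1 h2).resolve_right (det_basisMat_ne_zero h.indep i)
  have h1 := Matrix.mul_adjugate
    ((γ i : Matrix (Fin 3) (Fin 3) ℝ) - κ i • (1 : Matrix (Fin 3) (Fin 3) ℝ))
  rw [hdet, zero_smul] at h1
  have h2 : ((γ i : Matrix (Fin 3) (Fin 3) ℝ) - κ i • (1 : Matrix (Fin 3) (Fin 3) ℝ)) *ᵥ
      eigencol (γ i) (κ i) s = 0 := by
    funext r
    exact congrFun (congrFun h1 r) s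
  rw [Matrix.sub_mulVec, sub_eq_zero, Matrix.smul_mulVec, Matrix.one_mulVec] at h2
  exact h2

/-- `γ i - κ i` has rank 2, seen from the positive minor of `eq_smul_of_fix`. A nonzero adjugate
column is an eigenvector depending continuously on `γ i`. -/
theorem IsStd.exists_eigencol_ne_zero (h : IsStd γ e b c κ μ ν) (hp : IsPos b c κ μ ν)
    (i : Fin 3) : ∃ s r, eigencol (γ i) (κ i) s r ≠ 0 := by
  by_contra! h0
  have hzero : ((γ i : Matrix (Fin 3) (Fin 3) ℝ) -
      κ i • (1 : Matrix (Fin 3) (Fin 3) ℝ)).adjugate = 0 := by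
    ext r s
    exact h0 s r
  have h1 := congrArg Matrix.adjugate (h.sub_mul_basisMat i)
  rw [Matrix.adjugate_mul_distrib, Matrix.adjugate_mul_distrib, hzero, Matrix.mul_zero] at h1
  set K := core (κ i) (μ i) (ν i) (b (i + 1)) (c (i + 1)) (b (i + 2)) (c (i + 2)) -
    κ i • (1 : Matrix (Fin 3) (Fin 3) ℝ) with hK
  have h2 : K.adjugate = 0 := by
    have h3 : K.adjugate * ((basisMat e i).adjugate * basisMat e i) = 0 := by
      rw [← Matrix.mul_assoc, ← h1, Matrix.zero_mul]
    rw [Matrix.adjugate_mul, Matrix.mul_smul, Matrix.mul_one] at h3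
    exact (smul_eq_zero.1 h3).resolve_left (det_basisMat_ne_zero h.indep i)
  have h4 : K.adjugate 0 1 = (c (i + 1) * κ i) * (ν i + κ i) + b (i + 1) * ν i * b (i + 2) * κ i := by
    rw [hK, core_sub_smul, Matrix.adjugate_fin_three]
    simp
    ring
  have hν := hp.ν_pos i
  have hκ := hp.κ_pos i
  have hb1 := hp.b_pos (i + 1)
  have hb2 := hp.b_pos (i + 2)
  have hc1 := hp.c_pos (i + 1)
  have h5 : 0 < K.adjugate 0 1 := by
    rw [h4]
    positivity
  rw [h2] at h5
  exact lt_irrefl _ h5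

end Algebra

/-! ### Consequences of the standard formulas -/

section Model

variable {γ : Fin 3 → SL(3, ℝ)} {e : Fin 3 → Fin 3 → ℝ} {b c κ μ ν : Fin 3 → ℝ}

theorem eq_of_smul_eq (he : LinearIndependent ℝ e) {g g' : SL(3, ℝ)}
    (h : ∀ j, g • e j = g' • e j) : g = g' := by
  have hB : IsUnit (basisMat e 0) := by
    rw [Matrix.isUnit_iff_isUnit_det, isUnit_iff_ne_zero]
    exact det_basisMat_ne_zero he 0
  have h1 : (g : Matrix (Fin 3) (Fin 3) ℝ) * basisMat e 0 = g' * basisMat e 0 := by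
    ext r k
    exact congrFun (h (0 + k)) r
  exact Subtype.ext (hB.mul_right_cancel h1)

/-- The product is tested on `e 0`, `e 2` and `apex 1`, the vertices of one outer triangle; each
returns to itself with a factor given by one of the three relations. -/
theorem IsStd.prod_eq_one (h : IsStd γ e b c κ μ ν)
    (hcomp : ∀ i, κ i * ν (i + 1) * μ (i + 2) = 1) : γ 2 * γ 1 * γ 0 = 1 := by
  have hm : ∀ {x y z : ℝ}, x * y * z = 1 → ∀ w : Fin 3 → ℝ, x • y • z • w = w := by
    intro x y z hxyz w
    rw [← mul_smul, ← mul_smul, hxyz, one_smul]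
  have h0 : (γ 2 * γ 1 * γ 0) • e 0 = e 0 := by
    rw [mul_smul, mul_smul, h.fix, smul_comm (γ 1), show γ 1 • e 0 = _ from h.flip 1,
      smul_comm (γ 2), smul_comm (γ 2), show γ 2 • apex e b c (1 + 2) = _ from h.unflip 2]
    exact hm (hcomp 0) _
  have h2 : (γ 2 * γ 1 * γ 0) • e 2 = e 2 := by
    rw [mul_smul, mul_smul, show γ 0 • e 2 = _ from h.flip 0, smul_comm (γ 1),
      show γ 1 • apex e b c (0 + 2) = _ from h.unflip 1, smul_comm (γ 2), smul_comm (γ 2),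
      show γ 2 • e (1 + 1) = _ from h.fix 2]
    refine hm ?_ _
    rw [← hcomp 2]
    change ν 0 * μ 1 * κ 2 = κ 2 * ν 0 * μ 1
    ring
  have h1 : (γ 2 * γ 1 * γ 0) • apex e b c 1 = apex e b c 1 := by
    rw [mul_smul, mul_smul, show γ 0 • apex e b c 1 = _ from h.unflip 0, smul_comm (γ 1),
      show γ 1 • e (0 + 1) = _ from h.fix 1, smul_comm (γ 2), smul_comm (γ 2),
      show γ 2 • e 1 = _ from h.flip 2]
    refine hm ?_ _
    rw [← hcomp 1]
    change μ 0 * κ 1 * ν 2 = κ 1 * ν 2 * μ 0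
    ring
  have h3 : e 1 = b 1 • e 2 + c 1 • e 0 - apex e b c 1 := by
    rw [apex]
    change e 1 = b 1 • e 2 + c 1 • e 0 - (-e 1 + b 1 • e 2 + c 1 • e 0)
    module
  refine eq_of_smul_eq h.indep fun j => ?_
  rw [one_smul]
  fin_cases j
  · exact h0
  · change (γ 2 * γ 1 * γ 0) • e 1 = e 1
    rw [h3, smul_sub, smul_add, smul_comm _ (b 1), smul_comm _ (c 1), h0, h1, h2]
  · exact h2

theorem IsStd.smul_pt_outer (h : IsStd γ e b c κ μ ν) (hp : IsPos b c κ μ ν) (i : Fin 3) :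
    γ i • pt (outer e b c (i + 1)) = pt (outer e b c (i + 2)) := by
  rw [smul_pt]
  refine (SameCone.pt_eq ⟨1, one_ne_zero, Equiv.refl _,
    fun j => if j = i then κ i else if j = i + 1 then μ i else ν i, fun j => ?_, fun j => ?_⟩).symm
  · dsimp only
    split_ifs
    · exact hp.κ_pos i
    · exact hp.μ_pos i
    · exact hp.ν_pos i
  · rw [one_mul, Equiv.refl_apply]
    dsimp only
    rcases eq_cyclic i j with rfl | rfl | rfl
    · rw [if_pos rfl, outer_of_ne _ _ _ (add_one_ne j).symm, outer_of_ne _ _ _ (add_two_ne j).symm,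
        h.fix]
    · rw [if_neg (add_one_ne i), if_pos rfl, outer_self,
        outer_of_ne _ _ _ (add_two_ne_add_one i).symm, h.unflip]
    · rw [if_neg (add_two_ne i), if_neg (add_two_ne_add_one i), outer_self,
        outer_of_ne _ _ _ (add_two_ne_add_one i), h.flip]

/-- The vector `e (i + 2)` is cyclic: its Krylov determinant in the adapted basis is minus a product
of positive terms. -/
theorem IsStd.exists_cyclic (h : IsStd γ e b c κ μ ν) (hp : IsPos b c κ μ ν) (i : Fin 3) :
    ∃ v, (krylov (γ i) v).det ≠ 0 := by
  refine ⟨basisMat e i *ᵥ ![0, 0, 1], ?_⟩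
  rw [krylov_mul (h.mul_basisMat i), Matrix.det_mul]
  refine mul_ne_zero (det_basisMat_ne_zero h.indep i) ?_
  have hν := hp.ν_pos i
  have hμ := hp.μ_pos i
  have hκ := hp.κ_pos i
  have hb2 := hp.b_pos (i + 2)
  have hc1 := hp.c_pos (i + 1)
  have hc2 := hp.c_pos (i + 2)
  have : (krylov (core (κ i) (μ i) (ν i) (b (i + 1)) (c (i + 1)) (b (i + 2)) (c (i + 2)))
      ![0, 0, 1]).det = -(ν i ^ 2 * c (i + 2) *
        (b (i + 2) * μ i + κ i * b (i + 2) + c (i + 2) * c (i + 1) * κ i)) := by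
    simp [krylov, core, Matrix.det_fin_three, Matrix.mulVec, dotProduct, Fin.sum_univ_three,
      pow_two, Matrix.mul_apply]
    ring
  rw [this]
  apply neg_ne_zero.2
  positivity

/-- `κ` and `τ` fix the characteristic polynomial, and both sides have cyclic vectors. -/
theorem IsStd.isConj (h : IsStd γ e b c κ μ ν) (hp : IsPos b c κ μ ν) {δ : Fin 3 → SL(3, ℝ)}
    (hδ : ∀ i, IsBoundaryType (δ i)) (hκ : ∀ i, κ i = lam (δ i))
    (hτ : ∀ i, -μ i + ν i * (b (i + 1) * c (i + 2) - 1) = tau (δ i)) (i : Fin 3) :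
    IsConj (γ i) (δ i) := by
  obtain ⟨v, hv⟩ := h.exists_cyclic hp i
  obtain ⟨w, hw⟩ := (hδ i).cyclic
  refine isConj_of_cyclic ?_ hv hw
  rw [h.charpoly, charpoly_core (h.mul_eq_one i) (hτ i), (hδ i).charpoly_eq, hκ]

end Model

/-! ### The standard hexagon -/

/-- The standard basis. -/
def stdE (j : Fin 3) : Fin 3 → ℝ := Pi.single j 1

theorem sum_smul_stdE (t : Fin 3 → ℝ) : ∑ j, t j • stdE j = t := by
  ext k
  simp [stdE, Pi.single_apply]

theorem linearIndependent_stdE : LinearIndependent ℝ stdE := by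
  rw [Fintype.linearIndependent_iff]
  intro t ht
  rw [sum_smul_stdE] at ht
  exact congrFun ht

theorem sum_outer_apply (b c t : Fin 3 → ℝ) (i : Fin 3) :
    (∑ j, t j • outer stdE b c i j) i = -t i ∧
    (∑ j, t j • outer stdE b c i j) (i + 1) = t (i + 1) + t i * b i ∧
    (∑ j, t j • outer stdE b c i j) (i + 2) = t (i + 2) + t i * c i := by
  rw [sum_outer]
  refine ⟨?_, ?_, ?_⟩ <;> simp [stdE]

theorem apex_apply (b c : Fin 3 → ℝ) (i : Fin 3) :
    apex stdE b c i i = -1 ∧ apex stdE b c i (i + 1) = b i ∧ apex stdE b c i (i + 2) = c i := by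
  refine ⟨?_, ?_, ?_⟩ <;> simp [apex, stdE]

theorem edge_outer (e : Fin 3 → Fin 3 → ℝ) (b c : Fin 3 → ℝ) (i : Fin 3) :
    edge e i = edge (outer e b c i) i := by
  have key : ∀ t : Fin 3 → ℝ, t i = 0 → ∑ j, t j • outer e b c i j = ∑ j, t j • e j := by
    intro t ht
    rw [sum_outer, sum_cyclic _ i, ht]
    simp
  ext x
  constructor
  · rintro ⟨t, ht, ht', h, rfl⟩
    rw [mk_mem_edge_iff]
    exact ⟨1, t, ht, ht', by rw [one_smul, key t ht]⟩
  · rintro ⟨t, ht, ht', h, rfl⟩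
    rw [mk_mem_edge_iff]
    exact ⟨1, t, ht, ht', by rw [one_smul, key t ht]⟩

theorem edge_subset_pt {u : Fin 3 → Fin 3 → ℝ} (hu : LinearIndependent ℝ u) (i : Fin 3) :
    edge u i ⊆ pt u := by
  rintro _ ⟨t, ht, ht', h, rfl⟩
  refine mk_mem_pt_of_two hu (fun j => ?_) (add_two_ne_add_one i) (ht' _ (add_two_ne i)).ne'
    (ht' _ (add_one_ne i)).ne' h
  rcases eq_or_ne j i with rfl | hj
  · exact ht.ge
  · exact (ht' j hj).le

theorem mk_vertex {u : Fin 3 → Fin 3 → ℝ} {t : Fin 3 → ℝ} (h : ∑ j, t j • u j ≠ 0) (k : Fin 3)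
    (hk : ∀ j, j ≠ k → t j = 0) :
    Projectivization.mk ℝ _ h ∈ {x : P2 | ∃ i, ∃ h : u i ≠ 0, x = Projectivization.mk ℝ _ h} := by
  have h1 : ∑ j, t j • u j = t k • u k :=
    Finset.sum_eq_single k (fun j _ hj => by rw [hk j hj, zero_smul])
      (fun hk => absurd (Finset.mem_univ k) hk)
  have h2 : u k ≠ 0 := fun h0 => h (by rw [h1, h0, smul_zero])
  exact ⟨k, h2, (Projectivization.mk_eq_mk_iff' ℝ _ _ h h2).2 ⟨t k, h1.symm⟩⟩

theorem pt_inter_pt_outer {b c : Fin 3 → ℝ} (hb : ∀ i, 0 < b i) (hc : ∀ i, 0 < c i) (i : Fin 3) :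
    pt stdE ∩ pt (outer stdE b c i) = edge stdE i := by
  apply Set.Subset.antisymm
  · rintro _ ⟨⟨⟨t, ht, h, rfl⟩, hnv⟩, ⟨hmem, -⟩⟩
    obtain ⟨d, s, hs, hts⟩ := (mk_mem_tri_iff h).1 hmem
    obtain ⟨o0, o1, o2⟩ := sum_outer_apply b c s i
    have c0 : t i = -(d * s i) := by
      have := congrFun hts i
      rw [sum_smul_stdE, Pi.smul_apply, o0] at this
      rw [this, smul_eq_mul]; ring
    have c1 : t (i + 1) = d * (s (i + 1) + s i * b i) := by
      have := congrFun hts (i + 1)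
      rwa [sum_smul_stdE, Pi.smul_apply, o1] at this
    have c2 : t (i + 2) = d * (s (i + 2) + s i * c i) := by
      have := congrFun hts (i + 2)
      rwa [sum_smul_stdE, Pi.smul_apply, o2] at this
    have p1 : 0 ≤ s (i + 1) + s i * b i := add_nonneg (hs _) (mul_nonneg (hs _) (hb i).le)
    have p2 : 0 ≤ s (i + 2) + s i * c i := add_nonneg (hs _) (mul_nonneg (hs _) (hc i).le)
    -- For `d ≤ 0` the other two coordinates vanish, so the point is the vertex `e i`, which has
    -- been removed. For `d > 0` the `i`-th coordinate is both nonnegative and nonpositive.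
    have hd : 0 < d := by
      by_contra hd
      have hd := not_lt.1 hd
      refine hnv (mk_vertex h i fun j hj => ?_)
      rcases eq_cyclic i j with rfl | rfl | rfl
      · exact absurd rfl hj
      · exact le_antisymm (by rw [c1]; exact mul_nonpos_of_nonpos_of_nonneg hd p1) (ht _)
      · exact le_antisymm (by rw [c2]; exact mul_nonpos_of_nonpos_of_nonneg hd p2) (ht _)
    have ht0 : t i = 0 := le_antisymm (by
      rw [c0]; exact neg_nonpos.2 (mul_nonneg hd.le (hs i))) (ht i)
    have ht1 : t (i + 1) ≠ 0 := fun h0 => hnv (mk_vertex h (i + 2) fun j hj => by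
      rcases eq_cyclic i j with rfl | rfl | rfl
      · exact ht0
      · exact h0
      · exact absurd rfl hj)
    have ht2 : t (i + 2) ≠ 0 := fun h0 => hnv (mk_vertex h (i + 1) fun j hj => by
      rcases eq_cyclic i j with rfl | rfl | rfl
      · exact ht0
      · exact absurd rfl hj
      · exact h0)
    refine ⟨t, ht0, fun j hj => ?_, h, rfl⟩
    rcases eq_cyclic i j with rfl | rfl | rfl
    · exact absurd rfl hj
    · exact lt_of_le_of_ne (ht _) ht1.symm
    · exact lt_of_le_of_ne (ht _) ht2.symm
  · refine Set.subset_inter (edge_subset_pt linearIndependent_stdE i) ?_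
    rw [edge_outer stdE b c i]
    exact edge_subset_pt (linearIndependent_outer linearIndependent_stdE b c i) i

/-- A half-space containing every other point of the family contains their hull and misses the
chosen one. -/
theorem convexIndependent_of_separating {κ : Type*} {p : κ → Fin 3 → ℝ}
    (h : ∀ x, ∃ ψ : Module.Dual ℝ (Fin 3 → ℝ), ψ (p x) < 0 ∧ ∀ y, y ≠ x → 0 ≤ ψ (p y)) :
    ConvexIndependent ℝ p := by
  intro s x hx
  by_contra hxs
  obtain ⟨ψ, hψ, hψ'⟩ := h x
  have hconv : Convex ℝ {y | 0 ≤ ψ y} := convex_halfSpace_ge ψ.isLinear 0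
  have : p x ∈ {y | 0 ≤ ψ y} := convexHull_min (by
    rintro _ ⟨y, hy, rfl⟩
    exact hψ' y fun hyx => hxs (hyx ▸ hy)) hconv hx
  exact absurd hψ (not_lt.2 this)

theorem tri_subset_of_normalized {φ : Module.Dual ℝ (Fin 3 → ℝ)} {a : Fin 3 → Fin 3 → ℝ}
    {S : Set (Fin 3 → ℝ)} (ha : ∀ j, 0 < φ (a j)) (hS : ∀ j, (φ (a j))⁻¹ • a j ∈ S) :
    tri a ⊆ {x | ∃ y ∈ convexHull ℝ S, ∃ h : y ≠ 0, x = Projectivization.mk ℝ y h} := by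
  rintro _ ⟨t, ht, h, rfl⟩
  have hφ : φ (∑ j, t j • a j) = ∑ j, t j * φ (a j) := by simp
  have hpos : 0 < φ (∑ j, t j • a j) := by
    rw [hφ]
    refine lt_of_le_of_ne (Finset.sum_nonneg fun j _ => mul_nonneg (ht j) (ha j).le) fun h0 => h ?_
    have h1 := (Finset.sum_eq_zero_iff_of_nonneg
      fun j _ => mul_nonneg (ht j) (ha j).le).1 h0.symm
    refine Finset.sum_eq_zero fun j hj => ?_
    rw [(mul_eq_zero.1 (h1 j hj)).resolve_right (ha j).ne', zero_smul]
  have hne : (φ (∑ j, t j • a j))⁻¹ • ∑ j, t j • a j ≠ 0 := smul_ne_zero (inv_ne_zero hpos.ne') h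
  refine ⟨_, ?_, hne, (Projectivization.mk_eq_mk_iff' ℝ _ _ h hne).2
    ⟨φ (∑ j, t j • a j), smul_inv_smul₀ hpos.ne' _⟩⟩
  refine mem_convexHull_of_exists_fintype
    (fun j => (φ (∑ j, t j • a j))⁻¹ * (t j * φ (a j))) (fun j => (φ (a j))⁻¹ • a j)
    (fun j => mul_nonneg (inv_nonneg.2 hpos.le) (mul_nonneg (ht j) (ha j).le)) ?_ hS ?_
  · rw [← Finset.mul_sum, ← hφ, inv_mul_cancel₀ hpos.ne']
  · rw [Finset.smul_sum]
    refine Finset.sum_congr rfl fun j _ => ?_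
    rw [← mul_smul, ← mul_smul, mul_assoc, mul_assoc, mul_inv_cancel₀ (ha j).ne', mul_one]

/-- The six vertices of the standard hexagon. -/
def hexVertex (b c : Fin 3 → ℝ) : Fin 3 ⊕ Fin 3 → Fin 3 → ℝ := Sum.elim stdE (apex stdE b c)

/-- The linear functional with coefficients `f`. -/
def functional (f : Fin 3 → ℝ) : Module.Dual ℝ (Fin 3 → ℝ) :=
  ∑ j, f j • LinearMap.proj j

theorem functional_apply (f y : Fin 3 → ℝ) : functional f y = ∑ j, f j * y j := by
  simp [functional]

theorem functional_stdE (f : Fin 3 → ℝ) (j : Fin 3) : functional f (stdE j) = f j := by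
  simp [functional_apply, stdE, Pi.single_apply]

theorem functional_apex (f b c : Fin 3 → ℝ) (i : Fin 3) :
    functional f (apex stdE b c i) = -f i + f (i + 1) * b i + f (i + 2) * c i := by
  obtain ⟨h0, h1, h2⟩ := apex_apply b c i
  rw [functional_apply, sum_cyclic _ i, h0, h1, h2]
  ring

/-- At an outer vertex the `i`-th coordinate separates. At `e i` the form vanishing on the two
neighbouring vertices, the apexes of index `i + 1` and `i + 2`, does; its value at `e i` is `1 - ρ i
< 0`. -/
theorem exists_separating {b c : Fin 3 → ℝ} (hb : ∀ i, 0 < b i) (hc : ∀ i, 0 < c i)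
    (hbc : ∀ i, 1 < b (i + 1) * c (i + 2)) (x : Fin 3 ⊕ Fin 3) :
    ∃ ψ : Module.Dual ℝ (Fin 3 → ℝ), ψ (hexVertex b c x) < 0 ∧
      ∀ y, y ≠ x → 0 ≤ ψ (hexVertex b c y) := by
  rcases x with i | i
  · have hb1 := hb (i + 1)
    have hb2 := hb (i + 2)
    have hc1 := hc (i + 1)
    have hc2 := hc (i + 2)
    have hρ := hbc i
    have hy0 : 0 < b (i + 1) * b (i + 2) + c (i + 1) := by positivity
    have hz0 : 0 < c (i + 1) * c (i + 2) + b (i + 2) := by positivity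
    set f : Fin 3 → ℝ := fun j => if j = i then 1 - b (i + 1) * c (i + 2) else
      if j = i + 1 then b (i + 1) * b (i + 2) + c (i + 1)
      else c (i + 1) * c (i + 2) + b (i + 2) with hf
    have f0 : f i = 1 - b (i + 1) * c (i + 2) := by simp [hf]
    have f1 : f (i + 1) = b (i + 1) * b (i + 2) + c (i + 1) := by simp [hf]
    have f2 : f (i + 2) = c (i + 1) * c (i + 2) + b (i + 2) := by simp [hf]
    refine ⟨functional f, ?_, ?_⟩
    · change functional f (stdE i) < 0
      rw [functional_stdE, f0]
      linarith
    · rintro (j | j) hj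
      · change 0 ≤ functional f (stdE j)
        rw [functional_stdE]
        rcases eq_cyclic i j with rfl | rfl | rfl
        · exact absurd rfl hj
        · rw [f1]; exact hy0.le
        · rw [f2]; exact hz0.le
      · change 0 ≤ functional f (apex stdE b c j)
        rw [functional_apex]
        rcases eq_cyclic i j with rfl | rfl | rfl
        · rw [f0, f1, f2]
          have := mul_pos hy0 (hb j)
          have := mul_pos hz0 (hc j)
          linarith
        · rw [add_one_add_one, add_one_add_two, f0, f1, f2]
          apply le_of_eq
          ring
        · rw [add_two_add_one, add_two_add_two, f0, f1, f2]
          apply le_of_eq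
          ring
  · refine ⟨functional (Pi.single i 1), ?_, ?_⟩
    · change functional _ (apex stdE b c i) < 0
      rw [functional_apex]
      simp
    · rintro (j | j) hj
      · change 0 ≤ functional _ (stdE j)
        rw [functional_stdE, Pi.single_apply]
        split_ifs <;> norm_num
      · change 0 ≤ functional _ (apex stdE b c j)
        rw [functional_apex]
        have hji : j ≠ i := fun h => hj (by rw [h])
        rw [Pi.single_eq_of_ne hji, neg_zero, zero_add]
        have hnn : ∀ k, (0 : ℝ) ≤ (Pi.single i (1 : ℝ) : Fin 3 → ℝ) k := fun k => by
          rw [Pi.single_apply]; split_ifs <;> norm_num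
        exact add_nonneg (mul_nonneg (hnn _) (hb j).le) (mul_nonneg (hnn _) (hc j).le)

theorem exists_chart {b c : Fin 3 → ℝ} (hb : ∀ i, 0 < b i) (hc : ∀ i, 0 < c i)
    (hbc : ∀ i, 1 < b (i + 1) * c (i + 2)) :
    ∃ φ : Module.Dual ℝ (Fin 3 → ℝ), ∀ x, 0 < φ (hexVertex b c x) := by
  -- These coefficients cancel the negative terms at the apexes 1 and 2, leaving `b 2 * b 1` and `c
  -- 1 * c 2`; apex 0 is positive because `b 0 * c 1 > 1`.
  refine ⟨functional ![1, c 1, b 2], ?_⟩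
  rintro (j | j)
  · change 0 < functional _ (stdE j)
    rw [functional_stdE]
    fin_cases j
    · exact one_pos
    · exact hc 1
    · exact hb 2
  · change 0 < functional _ (apex stdE b c j)
    rw [functional_apex]
    fin_cases j
    · change 0 < -1 + c 1 * b 0 + b 2 * c 0
      have h1 : 1 < b 0 * c 1 := hbc 2
      have := mul_pos (hb 2) (hc 0)
      linarith
    · change 0 < -c 1 + b 2 * b 1 + 1 * c 1
      have := mul_pos (hb 2) (hb 1)
      linarith
    · change 0 < -b 2 + 1 * b 2 + c 1 * c 2
      have := mul_pos (hc 1) (hc 2)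
      linarith

/-- The six forms are the lines of the six sides: the first vanishes at `e (i + 2)` and `apex i`,
the second at `e (i + 1)` and `apex i`. -/
theorem hexagon_nonneg {b c : Fin 3 → ℝ} (hb : ∀ i, 0 < b i) (hc : ∀ i, 0 < c i)
    (hbc : ∀ i, 1 < b (i + 1) * c (i + 2)) (x : Fin 3 ⊕ Fin 3) (i : Fin 3) :
    0 ≤ b i * hexVertex b c x i + hexVertex b c x (i + 1) ∧
      0 ≤ c i * hexVertex b c x i + hexVertex b c x (i + 2) := by
  rcases x with j | j
  · have hnn : ∀ k, 0 ≤ stdE j k := fun k => by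
      rw [stdE, Pi.single_apply]; split_ifs <;> norm_num
    exact ⟨add_nonneg (mul_nonneg (hb i).le (hnn _)) (hnn _),
      add_nonneg (mul_nonneg (hc i).le (hnn _)) (hnn _)⟩
  · change 0 ≤ b i * apex stdE b c j i + apex stdE b c j (i + 1) ∧
      0 ≤ c i * apex stdE b c j i + apex stdE b c j (i + 2)
    obtain ⟨h0, h1, h2⟩ := apex_apply b c j
    rcases eq_cyclic j i with rfl | rfl | rfl
    · rw [h0, h1, h2]
      constructor <;> linarith
    · rw [add_one_add_one, add_one_add_two, h0, h1, h2]
      have h3 := hbc (j + 2)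
      rw [add_two_add_one, add_two_add_two] at h3
      have := mul_pos (hb (j + 1)) (hb j)
      constructor
      · linarith [hc j]
      · linarith
    · rw [add_two_add_one, add_two_add_two, h0, h1, h2]
      have h3 := hbc (j + 1)
      rw [add_one_add_one, add_one_add_two] at h3
      have := mul_pos (hc (j + 2)) (hc j)
      constructor
      · linarith
      · linarith [hb j]

theorem isConvexHexagon_std {b c : Fin 3 → ℝ} (hb : ∀ i, 0 < b i) (hc : ∀ i, 0 < c i)
    (hbc : ∀ i, 1 < b (i + 1) * c (i + 2)) :
    IsConvexHexagon (tri stdE ∪ ⋃ i, tri (outer stdE b c i)) := by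
  obtain ⟨φ, hφ⟩ := exists_chart hb hc hbc
  set p := hexVertex b c with hp
  set v : Fin 6 → Fin 3 → ℝ := fun k =>
    (φ (p (finSumFinEquiv.symm k)))⁻¹ • p (finSumFinEquiv.symm k) with hv
  have hrange : ∀ x, (φ (p x))⁻¹ • p x ∈ Set.range v := by
    intro x
    refine ⟨finSumFinEquiv (m := 3) (n := 3) x, ?_⟩
    simp only [hv]
    rw [Equiv.symm_apply_apply]
  refine ⟨φ, v, fun k => ?_, ?_, ?_⟩
  · simp only [hv, map_smul, smul_eq_mul]
    exact inv_mul_cancel₀ (hφ _).ne'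
  · refine convexIndependent_of_separating fun k => ?_
    obtain ⟨ψ, h1, h2⟩ := exists_separating hb hc hbc (finSumFinEquiv.symm k)
    refine ⟨ψ, ?_, fun y hy => ?_⟩
    · simp only [hv, map_smul, smul_eq_mul]
      exact mul_neg_of_pos_of_neg (inv_pos.2 (hφ _)) h1
    · simp only [hv, map_smul, smul_eq_mul]
      exact mul_nonneg (inv_pos.2 (hφ _)).le
        (h2 _ fun h => hy (finSumFinEquiv.symm.injective h))
  · apply Set.Subset.antisymm
    · refine Set.union_subset ?_ (Set.iUnion_subset fun i => ?_)
      · exact tri_subset_of_normalized (φ := φ) (fun j => hφ (Sum.inl j))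
          (fun j => hrange (Sum.inl j))
      · have hout : ∀ j, ∃ x, outer stdE b c i j = p x := by
          intro j
          rcases eq_or_ne j i with rfl | hj
          · exact ⟨Sum.inr j, outer_self ..⟩
          · exact ⟨Sum.inl j, outer_of_ne _ _ _ hj⟩
        refine tri_subset_of_normalized (φ := φ) (fun j => ?_) (fun j => ?_)
        · obtain ⟨x, hx⟩ := hout j
          rw [hx]
          exact hφ x
        · obtain ⟨x, hx⟩ := hout j
          rw [hx]
          exact hrange x
    · rintro _ ⟨y, hy, hy0, rfl⟩
      have hK : ∀ i, 0 ≤ b i * y i + y (i + 1) ∧ 0 ≤ c i * y i + y (i + 2) := by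
        intro i
        have key : ∀ (f : Module.Dual ℝ (Fin 3 → ℝ)), (∀ x, 0 ≤ f (p x)) → 0 ≤ f y := by
          intro f hf
          have hconv : Convex ℝ {y | 0 ≤ f y} := convex_halfSpace_ge f.isLinear 0
          refine convexHull_min ?_ hconv hy
          rintro _ ⟨k, rfl⟩
          change 0 ≤ f (v k)
          simp only [hv, map_smul, smul_eq_mul]
          exact mul_nonneg (inv_pos.2 (hφ _)).le (hf _)
        constructor
        · exact key (b i • LinearMap.proj i + LinearMap.proj (i + 1))
            fun x => (hexagon_nonneg hb hc hbc x i).1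
        · exact key (c i • LinearMap.proj i + LinearMap.proj (i + 2))
            fun x => (hexagon_nonneg hb hc hbc x i).2
      -- A point with all coordinates nonnegative is in the inner triangle. If `y i < 0`, its
      -- coefficients in the frame of `Tᵢ` are `-y i` and the two side forms, all nonnegative.
      by_cases hall : ∀ i, 0 ≤ y i
      · exact Or.inl ((mk_mem_tri_iff hy0).2 ⟨1, y, hall, by rw [one_smul, sum_smul_stdE]⟩)
      · obtain ⟨i, hi⟩ := not_forall.1 hall
        have hi := not_le.1 hi
        refine Or.inr (Set.mem_iUnion.2 ⟨i, (mk_mem_tri_iff hy0).2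
          ⟨1, fun j => if j = i then -y i else if j = i + 1 then b i * y i + y (i + 1) else
            c i * y i + y (i + 2), fun j => ?_, ?_⟩⟩)
        · dsimp only
          split_ifs
          · linarith
          · exact (hK i).1
          · exact (hK i).2
        · rw [one_smul, sum_outer]
          have e1 : (i + 2 : Fin 3) ≠ i + 1 := add_two_ne_add_one i
          rw [if_pos rfl, if_neg (add_one_ne i), if_pos rfl, if_neg (add_two_ne i), if_neg e1]
          conv_lhs => rw [← sum_smul_stdE y, sum_cyclic _ i]
          module

theorem isHexagonFrame_std {b c : Fin 3 → ℝ} (hb : ∀ i, 0 < b i) (hc : ∀ i, 0 < c i)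
    (hbc : ∀ i, 1 < b (i + 1) * c (i + 2)) {M₀ : GL (Fin 3) ℝ} {M : Fin 3 → GL (Fin 3) ℝ}
    (hM₀ : (M₀ : Matrix (Fin 3) (Fin 3) ℝ).col = stdE)
    (hM : ∀ i, (M i : Matrix (Fin 3) (Fin 3) ℝ).col = outer stdE b c i) :
    IsHexagonFrame M₀ M ⟨puncturedTriangle M₀, M₀, rfl⟩
      fun i => ⟨puncturedTriangle (M i), M i, rfl⟩ where
  center_eq := rfl
  outer_eq _ := rfl
  inter_eq i := by
    simp only [puncturedTriangle_eq, openEdge_eq, hM₀, hM]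
    exact pt_inter_pt_outer hb hc i
  edge_eq i := by
    rw [openEdge_eq, openEdge_eq, hM₀, hM]
    exact edge_outer _ _ _ i
  hexagon := by
    simp only [closedTriangle_eq, hM₀, hM]
    exact isConvexHexagon_std hb hc hbc

section

/-! ### The standard representative -/

/-- The matrix of the standard gluing map `γ i`. -/
def stdMat (κ μ ν b c : Fin 3 → ℝ) (i : Fin 3) : Matrix (Fin 3) (Fin 3) ℝ :=
  (core (κ i) (μ i) (ν i) (b (i + 1)) (c (i + 1)) (b (i + 2)) (c (i + 2))).submatrix
    (Equiv.subRight i) (Equiv.subRight i)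

/-- The standard gluing maps. -/
def stdSL {κ μ ν : Fin 3 → ℝ} (h : ∀ i, κ i * μ i * ν i = 1) (b c : Fin 3 → ℝ) (i : Fin 3) :
    SL(3, ℝ) :=
  ⟨stdMat κ μ ν b c i, by rw [stdMat, Matrix.det_submatrix_equiv_self, det_core, h]⟩

theorem stdSL_smul {κ μ ν : Fin 3 → ℝ} (h : ∀ i, κ i * μ i * ν i = 1) (b c : Fin 3 → ℝ)
    (i k : Fin 3) : stdSL h b c i • stdE (i + k) =
      core (κ i) (μ i) (ν i) (b (i + 1)) (c (i + 1)) (b (i + 2)) (c (i + 2)) 0 k • stdE i +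
      core (κ i) (μ i) (ν i) (b (i + 1)) (c (i + 1)) (b (i + 2)) (c (i + 2)) 1 k • stdE (i + 1) +
      core (κ i) (μ i) (ν i) (b (i + 1)) (c (i + 1)) (b (i + 2)) (c (i + 2)) 2 k •
        stdE (i + 2) := by
  have h1 : stdSL h b c i • stdE (i + k) = stdMat κ μ ν b c i *ᵥ Pi.single (i + k) 1 := rfl
  rw [h1, Matrix.mulVec_single_one]
  ext r
  change core _ _ _ _ _ _ _ (r - i) (i + k - i) = _
  rw [add_sub_cancel_left]
  rcases eq_cyclic i r with rfl | rfl | rfl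
  · simp [stdE]
  · rw [add_sub_cancel_left]
    simp [stdE]
  · rw [add_sub_cancel_left]
    simp [stdE]

theorem isStd_stdSL {κ μ ν : Fin 3 → ℝ} (h : ∀ i, κ i * μ i * ν i = 1) (b c : Fin 3 → ℝ) :
    IsStd (stdSL h b c) stdE b c κ μ ν := by
  have hfix : ∀ i, stdSL h b c i • stdE i = κ i • stdE i := by
    intro i
    have := stdSL_smul h b c i 0
    rw [add_zero] at this
    rw [this]
    simp [core]
  have hlast : ∀ i, stdSL h b c i • stdE (i + 2) = ν i • apex stdE b c (i + 2) := by
    intro i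
    rw [stdSL_smul, apex, add_two_add_one, add_two_add_two]
    simp only [core]
    simp
    module
  refine ⟨linearIndependent_stdE, hfix, fun i => ?_, hlast⟩
  have h1 : apex stdE b c (i + 1) =
      -stdE (i + 1) + b (i + 1) • stdE (i + 2) + c (i + 1) • stdE i := by
    rw [apex, add_one_add_one, add_one_add_two]
  rw [h1, smul_add, smul_add, smul_neg, smul_comm _ (b (i + 1)), smul_comm _ (c (i + 1)), hfix,
    hlast, stdSL_smul, apex, add_two_add_one, add_two_add_two]
  simp only [core]
  simp
  module

/-- The involution whose columns are the vertices of the outer triangle `Tᵢ`. -/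
def outerMat (b c : Fin 3 → ℝ) (i : Fin 3) : Matrix (Fin 3) (Fin 3) ℝ :=
  Matrix.of fun r j => outer stdE b c i j r

theorem outerMat_mul_self (b c : Fin 3 → ℝ) (i : Fin 3) : outerMat b c i * outerMat b c i = 1 := by
  ext r j
  fin_cases i <;> fin_cases r <;> fin_cases j <;>
    simp [outerMat, outer, apex, stdE, Matrix.mul_apply, Fin.sum_univ_three]

/-- `outerMat` as an element of the general linear group. -/
def outerGL (b c : Fin 3 → ℝ) (i : Fin 3) : GL (Fin 3) ℝ :=
  ⟨outerMat b c i, outerMat b c i, outerMat_mul_self b c i, outerMat_mul_self b c i⟩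

theorem col_outerGL (b c : Fin 3 → ℝ) (i : Fin 3) :
    (outerGL b c i : Matrix (Fin 3) (Fin 3) ℝ).col = outer stdE b c i := rfl

theorem col_one : ((1 : GL (Fin 3) ℝ) : Matrix (Fin 3) (Fin 3) ℝ).col = stdE := by
  ext j k
  simp [Matrix.col, stdE, Matrix.one_apply, Pi.single_apply]

/-- The punctured triangle of a frame. -/
def PuncturedTriangle.of (M : GL (Fin 3) ℝ) : PuncturedTriangle := ⟨puncturedTriangle M, M, rfl⟩

/-- The only property of the topology on triangles that the proof needs. -/
theorem PuncturedTriangle.continuous_of : Continuous PuncturedTriangle.of :=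
  continuous_coinduced_rng

variable {δ : Fin 3 → SL(3, ℝ)}

/-- A normal form of a point of `ℚ'`. -/
structure IsNormal (x : QPrime δ) (e : Fin 3 → Fin 3 → ℝ) (b c μ ν : Fin 3 → ℝ) : Prop where
  center : x.1.1.1 = pt e
  outer : ∀ i, (x.1.2.1 i).1 = pt (outer e b c i)
  pos : IsPos b c (fun i => lam (δ i)) μ ν
  std : IsStd x.1.2.2 e b c (fun i => lam (δ i)) μ ν

theorem exists_isNormal (hδ : ∀ i, IsBoundaryType (δ i)) (x : QPrime δ) :
    ∃ e b c μ ν, IsNormal x e b c μ ν := by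
  obtain ⟨hprod, hT, hconj, M₀, M, hF, hfix⟩ := x.2
  obtain ⟨e, he, hcol, hcenter, b, c, hb, hc, hbc, hout⟩ := hF.exists_normal
  obtain ⟨μ, ν, hpos, hstd⟩ := exists_isStd (γ := x.1.2.2) (κ := fun i => lam (δ i)) he hb hc hbc
    (fun i => (hδ i).lam_pos) (fun i => by
      obtain ⟨d, hd⟩ := hcol i
      rw [hd, smul_comm, hfix, smul_comm, lam_of_isConj (hconj i)]) hprod
    (fun i => by rw [← hout, ← hout]; exact hT i)
  exact ⟨e, b, c, μ, ν, hcenter, hout, hpos, hstd⟩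

/-- The coordinates of a normal form. -/
def coordsOf (b c κ μ ν : Fin 3 → ℝ) : Coords :=
  (fun i => b (i + 1) * c (i + 2), ![c 0 * c 1 * c 2, b 0 * b 1 * b 2], κ, μ, ν)

/-- The factors `t` cancel in the products over opposite directions `b (i + 1) * c (i + 2)` and in
the two cyclic products. -/
theorem coordsOf_scale (b c κ μ ν : Fin 3 → ℝ) {t : Fin 3 → ℝ} (ht : ∀ i, t i ≠ 0) :
    coordsOf (fun i => t i * b i / t (i + 1)) (fun i => t i * c i / t (i + 2)) κ μ ν =
      coordsOf b c κ μ ν := by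
  have h0 := ht 0
  have h1 := ht 1
  have h2 := ht 2
  have e1 : (0 + 1 : Fin 3) = 1 := rfl
  have e2 : (1 + 1 : Fin 3) = 2 := rfl
  have e3 : (2 + 1 : Fin 3) = 0 := rfl
  have e4 : (0 + 2 : Fin 3) = 2 := rfl
  have e5 : (1 + 2 : Fin 3) = 0 := rfl
  have e6 : (2 + 2 : Fin 3) = 1 := rfl
  unfold coordsOf
  refine Prod.ext (funext fun i => ?_) (Prod.ext (funext fun j => ?_) rfl)
  · dsimp only
    rw [add_one_add_one, add_two_add_two]
    have h3 := ht (i + 1)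
    have h4 := ht (i + 2)
    field_simp
  · fin_cases j
    · change t 0 * c 0 / t (0 + 2) * (t 1 * c 1 / t (1 + 2)) * (t 2 * c 2 / t (2 + 2)) =
        c 0 * c 1 * c 2
      rw [e4, e5, e6]
      field_simp
    · change t 0 * b 0 / t (0 + 1) * (t 1 * b 1 / t (1 + 1)) * (t 2 * b 2 / t (2 + 1)) =
        b 0 * b 1 * b 2
      rw [e1, e2, e3]
      field_simp

theorem IsStd.μ_eq {γ : Fin 3 → SL(3, ℝ)} {e : Fin 3 → Fin 3 → ℝ} {b c κ μ ν : Fin 3 → ℝ}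
    (h : IsStd γ e b c κ μ ν) : μ = fun i => (κ i * nuOf γ e i)⁻¹ := by
  funext i
  rw [h.nuOf_eq]
  exact eq_inv_of_mul_eq_one_left (by rw [← h.mul_eq_one i]; ring)

/-- The coordinates can be computed from any family of eigenvectors. -/
theorem IsNormal.coordsOf_eq {x : QPrime δ} {e : Fin 3 → Fin 3 → ℝ} {b c μ ν : Fin 3 → ℝ}
    (h : IsNormal x e b c μ ν) {f : Fin 3 → Fin 3 → ℝ} (hf : ∀ i, f i ≠ 0)
    (hfix : ∀ i, x.1.2.2 i • f i = lam (δ i) • f i) :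
    IsStd x.1.2.2 f (bOf x.1.2.2 f) (cOf x.1.2.2 f) (fun i => lam (δ i))
      (fun i => (lam (δ i) * nuOf x.1.2.2 f i)⁻¹) (nuOf x.1.2.2 f) ∧
    coordsOf b c (fun i => lam (δ i)) μ ν =
      coordsOf (bOf x.1.2.2 f) (cOf x.1.2.2 f) (fun i => lam (δ i))
        (fun i => (lam (δ i) * nuOf x.1.2.2 f i)⁻¹) (nuOf x.1.2.2 f) := by
  -- Eigenspaces are lines, so `f` is a rescaling of `e`; negative factors are allowed here.
  choose t ht using fun i => h.std.eq_smul_of_fix h.pos (hfix i)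
  have ht0 : ∀ i, t i ≠ 0 := fun i h0 => hf i (by rw [ht, h0, zero_smul])
  obtain rfl : f = fun i => t i • e i := funext ht
  have hs := h.std.scale ht0
  rw [← coordsOf_scale b c _ μ ν ht0]
  have hb := funext hs.bOf_eq
  have hc := funext hs.cOf_eq
  have hν := funext hs.nuOf_eq
  have hμ := hs.μ_eq
  rw [hν] at hμ
  rw [hb, hc, hν, ← hμ]
  exact ⟨hs, rfl⟩

/-- The basis `e'` serves as the family of eigenvectors for both normal forms. -/
theorem IsNormal.coords_unique {x : QPrime δ} {e e' : Fin 3 → Fin 3 → ℝ}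
    {b c μ ν b' c' μ' ν' : Fin 3 → ℝ} (h : IsNormal x e b c μ ν) (h' : IsNormal x e' b' c' μ' ν') :
    coordsOf b c (fun i => lam (δ i)) μ ν = coordsOf b' c' (fun i => lam (δ i)) μ' ν' := by
  rw [(h.coordsOf_eq h'.std.indep.ne_zero h'.std.fix).2,
    (h'.coordsOf_eq h'.std.indep.ne_zero h'.std.fix).2]

theorem smul_apex (g : SL(3, ℝ)) (e : Fin 3 → Fin 3 → ℝ) (b c : Fin 3 → ℝ) (i : Fin 3) :
    g • apex e b c i = apex (fun j => g • e j) b c i := by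
  rw [apex, apex, smul_add, smul_add, smul_neg, smul_comm g (b i), smul_comm g (c i)]

theorem smul_outer (g : SL(3, ℝ)) (e : Fin 3 → Fin 3 → ℝ) (b c : Fin 3 → ℝ) (i : Fin 3) :
    (fun j => g • outer e b c i j) = outer (fun j => g • e j) b c i := by
  funext j
  rcases eq_or_ne j i with rfl | hj
  · rw [outer_self, outer_self, smul_apex]
  · rw [outer_of_ne _ _ _ hj, outer_of_ne _ _ _ hj]

theorem IsStd.conj {γ γ' : Fin 3 → SL(3, ℝ)} {e : Fin 3 → Fin 3 → ℝ} {b c κ μ ν : Fin 3 → ℝ}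
    (h : IsStd γ e b c κ μ ν) (g : SL(3, ℝ)) (hg : ∀ i, γ' i = g * γ i * g⁻¹) :
    IsStd γ' (fun j => g • e j) b c κ μ ν := by
  have hact : ∀ i (v : Fin 3 → ℝ), γ' i • g • v = g • γ i • v := by
    intro i v
    rw [hg, mul_smul, mul_smul, inv_smul_smul]
  refine ⟨linearIndependent_smul g h.indep, fun i => ?_, fun i => ?_, fun i => ?_⟩
  · rw [hact, h.fix, smul_comm]
  · rw [← smul_apex, hact, h.unflip, smul_comm]
  · rw [← smul_apex, hact, h.flip, smul_comm]

theorem IsNormal.smul {x y : QPrime δ} {e : Fin 3 → Fin 3 → ℝ} {b c μ ν : Fin 3 → ℝ}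
    (h : IsNormal x e b c μ ν) {g : SL(3, ℝ)} (h₀ : y.1.1.1 = g • x.1.1.1)
    (h₁ : ∀ i, (y.1.2.1 i).1 = g • (x.1.2.1 i).1) (h₂ : ∀ i, y.1.2.2 i = g * x.1.2.2 i * g⁻¹) :
    IsNormal y (fun j => g • e j) b c μ ν where
  center := by rw [h₀, h.center, smul_pt]
  outer i := by rw [h₁, h.outer, smul_pt, smul_outer]
  pos := h.pos
  std := h.std.conj g h₂

theorem IsStd.unique {γ γ' : Fin 3 → SL(3, ℝ)} {e : Fin 3 → Fin 3 → ℝ} {b c κ μ ν : Fin 3 → ℝ}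
    (h : IsStd γ e b c κ μ ν) (h' : IsStd γ' e b c κ μ ν) (i : Fin 3) : γ i = γ' i := by
  have hB : IsUnit (basisMat e i) := by
    rw [Matrix.isUnit_iff_isUnit_det, isUnit_iff_ne_zero]
    exact det_basisMat_ne_zero h.indep i
  exact Subtype.ext (hB.mul_right_cancel ((h.mul_basisMat i).trans (h'.mul_basisMat i).symm))

/-- Points of `ℚ'` with the same normal form are in the same orbit. -/
theorem IsNormal.orbit {x y : QPrime δ} {e : Fin 3 → Fin 3 → ℝ} {b c μ ν : Fin 3 → ℝ}
    (hx : IsNormal x stdE b c μ ν) (hy : IsNormal y e b c μ ν) : orbitSetoid δ x y := by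
  -- The map from the standard basis to `e` need not have determinant one. A uniform factor `s`
  -- repairs this without changing the triangles or `b, c`.
  obtain ⟨g, s, hs, hg⟩ := exists_sl_eq_smul (det_basisMat_ne_zero hy.std.indep 0)
  have hge : ∀ j, g • stdE j = s • e j := by
    intro j
    change g.1 *ᵥ Pi.single j 1 = s • e j
    rw [hg, Matrix.mulVec_single_one]
    ext r
    simp [basisMat]
  have hscale : IsStd y.1.2.2 (fun j => s • e j) b c (fun i => lam (δ i)) μ ν := by
    have := hy.std.scale (t := fun _ => s) fun _ => hs
    simpa only [mul_div_cancel_left₀ _ hs] using this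
  have happ : ∀ i, apex (fun j => s • e j) b c i = s • apex e b c i := by
    intro i
    rw [apex, apex]
    module
  refine ⟨g, ?_, fun i => ?_, fun i => ?_⟩
  · rw [hx.center, hy.center, smul_pt, funext hge]
    exact SameCone.pt_eq ⟨s, hs, Equiv.refl _, fun _ => 1, fun _ => one_pos, fun j => by
      rw [mul_one, Equiv.refl_apply]⟩
  · rw [hx.outer, hy.outer, smul_pt, smul_outer, funext hge]
    refine SameCone.pt_eq ⟨s, hs, Equiv.refl _, fun _ => 1, fun _ => one_pos, fun j => ?_⟩
    rw [mul_one, Equiv.refl_apply]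
    rcases eq_or_ne j i with rfl | hj
    · rw [outer_self, outer_self, happ]
    · rw [outer_of_ne _ _ _ hj, outer_of_ne _ _ _ hj]
  · refine IsStd.unique (γ' := fun i => g * x.1.2.2 i * g⁻¹) hscale ?_ i
    rw [← funext hge]
    exact hx.std.conj g fun i => rfl

/-- Rescaling a normal form by positive factors. -/
theorem IsNormal.scale {x : QPrime δ} {e : Fin 3 → Fin 3 → ℝ} {b c μ ν : Fin 3 → ℝ}
    (h : IsNormal x e b c μ ν) {t : Fin 3 → ℝ} (ht : ∀ i, 0 < t i) :
    IsNormal x (fun i => t i • e i) (fun i => t i * b i / t (i + 1))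
      (fun i => t i * c i / t (i + 2)) μ ν := by
  have ht0 : ∀ i, t i ≠ 0 := fun i => (ht i).ne'
  have hap : ∀ i, apex (fun i => t i • e i) (fun i => t i * b i / t (i + 1))
      (fun i => t i * c i / t (i + 2)) i = t i • apex e b c i := by
    intro i
    rw [apex, apex, ← mul_smul, ← mul_smul, div_mul_cancel₀ _ (ht0 _), div_mul_cancel₀ _ (ht0 _)]
    module
  refine ⟨?_, fun i => ?_, ⟨fun i => ?_, fun i => ?_, fun i => ?_, h.pos.κ_pos, h.pos.μ_pos,
    h.pos.ν_pos⟩, h.std.scale ht0⟩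
  · rw [h.center]
    exact SameCone.pt_eq ⟨1, one_ne_zero, Equiv.refl _, t, ht, fun j => by
      rw [one_mul, Equiv.refl_apply]⟩
  · rw [h.outer]
    refine SameCone.pt_eq ⟨1, one_ne_zero, Equiv.refl _, t, ht, fun j => ?_⟩
    rw [one_mul, Equiv.refl_apply]
    rcases eq_or_ne j i with rfl | hj
    · rw [outer_self, outer_self, hap]
    · rw [outer_of_ne _ _ _ hj, outer_of_ne _ _ _ hj]
  · exact div_pos (mul_pos (ht _) (h.pos.b_pos _)) (ht _)
  · exact div_pos (mul_pos (ht _) (h.pos.c_pos _)) (ht _)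
  · have := congrFun (congrArg Prod.fst
      (coordsOf_scale b c (fun i => lam (δ i)) μ ν ht0)) i
    exact lt_of_lt_of_eq (h.pos.rho i) this.symm

theorem IsNormal.coords_mem (hδ : ∀ i, IsBoundaryType (δ i)) {x : QPrime δ}
    {e : Fin 3 → Fin 3 → ℝ} {b c μ ν : Fin 3 → ℝ} (h : IsNormal x e b c μ ν) :
    coordsOf b c (fun i => lam (δ i)) μ ν ∈ E δ := by
  refine ⟨h.pos.rho, fun j => ?_, h.pos.κ_pos, h.pos.μ_pos, h.pos.ν_pos, ?_, h.std.mul_eq_one,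
    h.std.comp_eq_one x.2.1, fun i => rfl, fun i => ?_⟩
  · fin_cases j
    · exact mul_pos (mul_pos (h.pos.c_pos 0) (h.pos.c_pos 1)) (h.pos.c_pos 2)
    · exact mul_pos (mul_pos (h.pos.b_pos 0) (h.pos.b_pos 1)) (h.pos.b_pos 2)
  · change c 0 * c 1 * c 2 * (b 0 * b 1 * b 2) = b 1 * c 2 * (b 2 * c 0) * (b 0 * c 1)
    ring
  · refine tau_eq_of_charpoly_core ?_ (κ := lam (δ i)) (c := c (i + 1)) (b' := b (i + 2))
    rw [← h.std.charpoly i, charpoly_of_isConj (x.2.2.2.1 i), (hδ i).charpoly_eq]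

/-! ### The standard section -/

/-- The parameters `b` of the standard representative. -/
def bStd (p : Coords) : Fin 3 → ℝ := ![1, 1, p.2.1 1]

/-- The parameters `c` of the standard representative. -/
def cStd (p : Coords) : Fin 3 → ℝ := ![p.1 1 / p.2.1 1, p.1 2, p.1 0]

/-- With `b 0 = b 1 = 1` the coordinates read off `b 2` and `c`; the relation `σ 0 * σ 1 = ρ 0 * ρ 1
* ρ 2` makes `σ 0` come out right. -/
theorem coordsOf_std {p : Coords} (hp : p ∈ E δ) :
    coordsOf (bStd p) (cStd p) p.2.2.1 p.2.2.2.1 p.2.2.2.2 = p := by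
  obtain ⟨ρ, σ, κ, μ, ν⟩ := p
  obtain ⟨-, hσ, -, -, -, hρσ, -⟩ := hp
  have h1 : σ 1 ≠ 0 := (hσ 1).ne'
  refine Prod.ext (funext fun i => ?_) (Prod.ext (funext fun j => ?_) rfl)
  · fin_cases i
    · exact one_mul _
    · exact mul_div_cancel₀ _ h1
    · exact one_mul _
  · fin_cases j
    · change ρ 1 / σ 1 * ρ 2 * ρ 0 = σ 0
      field_simp
      linarith
    · change 1 * 1 * σ 1 = σ 1
      ring

theorem isPos_std {p : Coords} (hp : p ∈ E δ) :
    IsPos (bStd p) (cStd p) p.2.2.1 p.2.2.2.1 p.2.2.2.2 := by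
  have hc := congrArg Prod.fst (coordsOf_std hp)
  obtain ⟨ρ, σ, κ, μ, ν⟩ := p
  obtain ⟨hρ, hσ, hκ, hμ, hν, -⟩ := hp
  refine ⟨fun i => ?_, fun i => ?_, fun i => ?_, hκ, hμ, hν⟩
  · fin_cases i
    · exact one_pos
    · exact one_pos
    · exact hσ 1
  · fin_cases i
    · exact div_pos (one_pos.trans (hρ 1)) (hσ 1)
    · exact one_pos.trans (hρ 2)
    · exact one_pos.trans (hρ 0)
  · exact (hρ i).trans_eq (congrFun hc i).symm

theorem kmn_eq_one {p : Coords} (hp : p ∈ E δ) (i : Fin 3) :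
    p.2.2.1 i * p.2.2.2.1 i * p.2.2.2.2 i = 1 := hp.2.2.2.2.2.2.1 i

theorem κ_eq {p : Coords} (hp : p ∈ E δ) : p.2.2.1 = fun i => lam (δ i) :=
  funext hp.2.2.2.2.2.2.2.2.1

/-- The standard representative of a point of `𝓔`. -/
def stdPoint (hδ : ∀ i, IsBoundaryType (δ i)) (p : E δ) : QPrime δ :=
  ⟨(PuncturedTriangle.of 1, fun i => PuncturedTriangle.of (outerGL (bStd p.1) (cStd p.1) i),
      stdSL (kmn_eq_one p.2) (bStd p.1) (cStd p.1)), by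
    have hstd := isStd_stdSL (kmn_eq_one p.2) (bStd p.1) (cStd p.1)
    have hpos := isPos_std p.2
    have hrho : ∀ i, bStd p.1 (i + 1) * cStd p.1 (i + 2) = p.1.1 i := fun i =>
      congrFun (congrArg Prod.fst (coordsOf_std p.2)) i
    have hconj : ∀ i, IsConj (stdSL (kmn_eq_one p.2) (bStd p.1) (cStd p.1) i) (δ i) :=
      hstd.isConj hpos hδ (fun i => congrFun (κ_eq p.2) i) fun i => by
        rw [hrho]
        exact p.2.2.2.2.2.2.2.2.2.2 i
    refine ⟨hstd.prod_eq_one p.2.2.2.2.2.2.2.2.1, fun i => ?_, hconj, 1,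
      outerGL (bStd p.1) (cStd p.1),
      isHexagonFrame_std hpos.b_pos hpos.c_pos hpos.rho col_one (col_outerGL _ _), fun i => ?_⟩
    · change _ • puncturedTriangle _ = puncturedTriangle _
      rw [puncturedTriangle_eq, puncturedTriangle_eq, col_outerGL, col_outerGL]
      exact hstd.smul_pt_outer hpos i
    · rw [col_one, lam_of_isConj (hconj i)]
      refine (hstd.fix i).trans ?_
      rw [κ_eq p.2]⟩

theorem isNormal_stdPoint (hδ : ∀ i, IsBoundaryType (δ i)) (p : E δ) :
    IsNormal (stdPoint hδ p) stdE (bStd p.1) (cStd p.1) p.1.2.2.2.1 p.1.2.2.2.2 where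
  center := (puncturedTriangle_eq _).trans (by rw [col_one])
  outer i := puncturedTriangle_eq _
  pos := κ_eq p.2 ▸ isPos_std p.2
  std := by
    have := isStd_stdSL (kmn_eq_one p.2) (bStd p.1) (cStd p.1)
    have h2 := κ_eq p.2
    rw [← h2]
    exact this

/-- Every normal form is equivalent to the standard one with the same coordinates. -/
theorem IsNormal.orbit_stdPoint (hδ : ∀ i, IsBoundaryType (δ i)) {x : QPrime δ}
    {e : Fin 3 → Fin 3 → ℝ} {b c μ ν : Fin 3 → ℝ} (h : IsNormal x e b c μ ν) :
    orbitSetoid δ (stdPoint hδ ⟨_, h.coords_mem hδ⟩) x := by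
  have hb0 := h.pos.b_pos 0
  have hb1 := h.pos.b_pos 1
  have hb2 := h.pos.b_pos 2
  -- These factors solve `t i * b i / t (i + 1) = 1` for `i = 0, 1`.
  have ht : ∀ i, 0 < (![1, b 0, b 0 * b 1] : Fin 3 → ℝ) i := by
    intro i
    fin_cases i
    · exact one_pos
    · exact hb0
    · exact mul_pos hb0 hb1
  have hs := h.scale ht
  have hn := isNormal_stdPoint hδ ⟨_, h.coords_mem hδ⟩
  refine hn.orbit (e := fun i => (![1, b 0, b 0 * b 1] : Fin 3 → ℝ) i • e i) ?_
  convert hs using 1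
  · funext i
    fin_cases i
    · change 1 = 1 * b 0 / b 0
      field_simp
    · change 1 = b 0 * b 1 / (b 0 * b 1)
      field_simp
    · change b 0 * b 1 * b 2 = b 0 * b 1 * b 2 / 1
      ring
  · funext i
    fin_cases i
    · change b 2 * c 0 / (b 0 * b 1 * b 2) = 1 * c 0 / (b 0 * b 1)
      field_simp
    · change b 0 * c 1 = b 0 * c 1 / 1
      ring
    · change b 1 * c 2 = b 0 * b 1 * c 2 / b 0
      field_simp
  · rfl
  · rfl

end

/-! ### Continuity -/

section Continuity

variable {δ : Fin 3 → SL(3, ℝ)}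

theorem coords_exists (hδ : ∀ i, IsBoundaryType (δ i)) (x : QPrime δ) :
    ∃ p : E δ, ∀ e b c μ ν, IsNormal x e b c μ ν →
      p.1 = coordsOf b c (fun i => lam (δ i)) μ ν := by
  obtain ⟨e, b, c, μ, ν, h⟩ := exists_isNormal hδ x
  exact ⟨⟨_, h.coords_mem hδ⟩, fun _ _ _ _ _ h' => h.coords_unique h'⟩

/-- The coordinates of a point of `ℚ'`. -/
def coords (hδ : ∀ i, IsBoundaryType (δ i)) (x : QPrime δ) : E δ := (coords_exists hδ x).choose

theorem IsNormal.coords_eq (hδ : ∀ i, IsBoundaryType (δ i)) {x : QPrime δ}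
    {e : Fin 3 → Fin 3 → ℝ} {b c μ ν : Fin 3 → ℝ} (h : IsNormal x e b c μ ν) :
    (coords hδ x).1 = coordsOf b c (fun i => lam (δ i)) μ ν :=
  (coords_exists hδ x).choose_spec e b c μ ν h

theorem coords_orbit (hδ : ∀ i, IsBoundaryType (δ i)) {x y : QPrime δ} (h : orbitSetoid δ x y) :
    coords hδ x = coords hδ y := by
  obtain ⟨e, b, c, μ, ν, hx⟩ := exists_isNormal hδ x
  obtain ⟨g, h₀, h₁, h₂⟩ := h
  exact Subtype.ext ((hx.coords_eq hδ).trans ((hx.smul h₀ h₁ h₂).coords_eq hδ).symm)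

theorem continuous_det3 {X : Type*} [TopologicalSpace X] {u v w : X → Fin 3 → ℝ}
    (hu : Continuous u) (hv : Continuous v) (hw : Continuous w) :
    Continuous fun x => det3 (u x) (v x) (w x) := by
  unfold det3
  refine Continuous.matrix_det (continuous_matrix fun i j => ?_)
  fin_cases i
  · exact (continuous_apply j).comp hu
  · exact (continuous_apply j).comp hv
  · exact (continuous_apply j).comp hw

theorem continuous_gluing (i : Fin 3) : Continuous fun x : QPrime δ => x.1.2.2 i :=
  (continuous_apply i).comp (continuous_snd.comp (continuous_snd.comp continuous_subtype_val))

theorem continuous_gluing_smul (i : Fin 3) {v : QPrime δ → Fin 3 → ℝ} (hv : Continuous v) :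
    Continuous fun x : QPrime δ => x.1.2.2 i • v x :=
  Continuous.matrix_mulVec (continuous_subtype_val.comp (continuous_gluing i)) hv

theorem continuous_eigencol (i : Fin 3) (k : ℝ) (s : Fin 3) :
    Continuous fun x : QPrime δ => eigencol (x.1.2.2 i) k s := by
  have h : Continuous fun x : QPrime δ =>
      ((x.1.2.2 i : Matrix (Fin 3) (Fin 3) ℝ) - k • (1 : Matrix (Fin 3) (Fin 3) ℝ)).adjugate :=
    ((continuous_subtype_val.comp (continuous_gluing i)).sub continuous_const).matrix_adjugate
  exact continuous_pi fun r => (continuous_apply s).comp ((continuous_apply r).comp h)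

theorem continuousAt_coordsOf {X : Type*} [TopologicalSpace X] {b c μ ν : X → Fin 3 → ℝ}
    {κ : Fin 3 → ℝ} {x : X} (hb : ContinuousAt b x) (hc : ContinuousAt c x)
    (hμ : ContinuousAt μ x) (hν : ContinuousAt ν x) :
    ContinuousAt (fun x => coordsOf (b x) (c x) κ (μ x) (ν x)) x := by
  have hb' : ∀ i, ContinuousAt (fun x => b x i) x := continuousAt_pi.1 hb
  have hc' : ∀ i, ContinuousAt (fun x => c x i) x := continuousAt_pi.1 hc
  refine ContinuousAt.prodMk ?_ (ContinuousAt.prodMk ?_ (continuousAt_const.prodMk (hμ.prodMk hν)))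
  · exact continuousAt_pi.2 fun i => (hb' _).mul (hc' _)
  · refine continuousAt_pi.2 fun j => ?_
    fin_cases j
    · exact ((hc' 0).mul (hc' 1)).mul (hc' 2)
    · exact ((hb' 0).mul (hb' 1)).mul (hb' 2)

/-- Near a given point the eigenvectors are adjugate columns, and the coordinates are rational
expressions in them and the gluing maps. The triangles are determined by these data and are not
consulted. -/
theorem continuous_coords (hδ : ∀ i, IsBoundaryType (δ i)) : Continuous (coords hδ) := by
  refine Continuous.subtype_mk (f := fun x => (coords hδ x).1) ?_ fun x => (coords hδ x).2
  rw [continuous_iff_continuousAt]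
  intro x₀
  obtain ⟨e₀, b₀, c₀, μ₀, ν₀, h₀⟩ := exists_isNormal hδ x₀
  choose s r hsr using h₀.std.exists_eigencol_ne_zero h₀.pos
  set f : QPrime δ → Fin 3 → Fin 3 → ℝ :=
    fun x i => eigencol (x.1.2.2 i) (lam (δ i)) (s i) with hf
  have hfc : ∀ i, Continuous fun x => f x i := fun i => continuous_eigencol i _ _
  have hev : ∀ᶠ x in nhds x₀, ∀ i, f x i ≠ 0 := by
    rw [Filter.eventually_all]
    intro i
    have h1 : ContinuousAt (fun x => f x i (r i)) x₀ :=
      ((continuous_apply (r i)).comp (hfc i)).continuousAt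
    filter_upwards [h1.eventually_ne (hsr i)] with x hx h0
    exact hx (by rw [h0]; rfl)
  have hkey : ∀ x, (∀ i, f x i ≠ 0) → ∃ b c μ ν, IsStd x.1.2.2 (f x) b c (fun i => lam (δ i)) μ ν ∧
      (coords hδ x).1 = coordsOf (bOf x.1.2.2 (f x)) (cOf x.1.2.2 (f x)) (fun i => lam (δ i))
        (fun i => (lam (δ i) * nuOf x.1.2.2 (f x) i)⁻¹) (nuOf x.1.2.2 (f x)) := by
    intro x hx
    obtain ⟨e, b, c, μ, ν, h⟩ := exists_isNormal hδ x
    have h1 := h.coordsOf_eq hx fun i => h.std.smul_eigencol i (s i)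
    exact ⟨_, _, _, _, h1.1, (h.coords_eq hδ).trans h1.2⟩
  have hne₀ : ∀ i, f x₀ i ≠ 0 := fun i h0 => hsr i (by
    have := congrFun h0 (r i)
    exact this)
  -- At `x₀` itself the chosen eigenvectors form a standard basis, so the denominators do not vanish
  -- there.
  obtain ⟨b, c, μ, ν, hstd, -⟩ := hkey x₀ hne₀
  have hden1 : ∀ i, det3 (f x₀ i) (f x₀ (i + 1)) (f x₀ (i + 2)) ≠ 0 := det3_ne_zero hstd.indep
  have hden2 : ∀ i, det3 (f x₀ (i + 1)) (f x₀ (i + 2)) (x₀.1.2.2 (i + 1) • f x₀ i) ≠ 0 := by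
    intro i
    have h1 := hstd.det3_flip (i + 1)
    have h2 := hden1 (i + 1)
    rw [add_one_add_one, add_one_add_two] at h1 h2
    rw [h1]
    exact mul_ne_zero (neg_ne_zero.2 (hstd.ν_ne_zero _)) h2
  have hν : ContinuousAt (fun x : QPrime δ => nuOf x.1.2.2 (f x)) x₀ :=
    continuousAt_pi.2 fun i => ContinuousAt.div
      (continuous_det3 (hfc _) (hfc _) (continuous_gluing_smul i (hfc _))).neg.continuousAt
      (continuous_det3 (hfc _) (hfc _) (hfc _)).continuousAt (hden1 i)
  have hb : ContinuousAt (fun x : QPrime δ => bOf x.1.2.2 (f x)) x₀ :=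
    continuousAt_pi.2 fun i => ContinuousAt.div
      (continuous_det3 (continuous_gluing_smul (i + 1) (hfc _)) (hfc _) (hfc _)).neg.continuousAt
      (continuous_det3 (hfc _) (hfc _) (continuous_gluing_smul (i + 1) (hfc _))).continuousAt
      (hden2 i)
  have hc : ContinuousAt (fun x : QPrime δ => cOf x.1.2.2 (f x)) x₀ :=
    continuousAt_pi.2 fun i => ContinuousAt.div
      (continuous_det3 (hfc _) (continuous_gluing_smul (i + 1) (hfc _)) (hfc _)).neg.continuousAt
      (continuous_det3 (hfc _) (hfc _) (continuous_gluing_smul (i + 1) (hfc _))).continuousAt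
      (hden2 i)
  have hμ : ContinuousAt (fun (x : QPrime δ) (i : Fin 3) =>
      (lam (δ i) * nuOf x.1.2.2 (f x) i)⁻¹) x₀ := by
    refine continuousAt_pi.2 fun i => ContinuousAt.inv₀
      (continuousAt_const.mul (continuousAt_pi.1 hν i)) ?_
    rw [hstd.nuOf_eq]
    exact mul_ne_zero (hδ i).lam_pos.ne' (hstd.ν_ne_zero i)
  refine (continuousAt_coordsOf (κ := fun i => lam (δ i)) hb hc hμ hν).congr ?_
  filter_upwards [hev] with x hx
  obtain ⟨-, -, -, -, -, h⟩ := hkey x hx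
  exact h.symm

theorem continuous_outerGL {X : Type*} [TopologicalSpace X] {b c : X → Fin 3 → ℝ}
    (hb : Continuous b) (hc : Continuous c) (i : Fin 3) :
    Continuous fun x => outerGL (b x) (c x) i := by
  have h : Continuous fun x => outerMat (b x) (c x) i := by
    refine continuous_matrix fun r j => ?_
    change Continuous fun x => outer stdE (b x) (c x) i j r
    rcases eq_or_ne j i with rfl | hj
    · simp only [outer_self, apex, Pi.add_apply, Pi.neg_apply, Pi.smul_apply, smul_eq_mul]
      fun_prop
    · simp only [outer_of_ne _ _ _ hj]
      exact continuous_const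
  -- The matrix is its own inverse, so one continuity proof serves for both.
  exact Units.continuous_iff.2 ⟨h, h⟩

theorem continuous_stdPoint (hδ : ∀ i, IsBoundaryType (δ i)) : Continuous (stdPoint hδ) := by
  have hp : Continuous fun p : E δ => p.1 := continuous_subtype_val
  have hσ : ∀ p : E δ, p.1.2.1 1 ≠ 0 := fun p => (p.2.2.1 1).ne'
  have h1 : ∀ i, Continuous fun p : E δ => p.1.1 i := fun i =>
    (continuous_apply i).comp (continuous_fst.comp hp)
  have h2 : ∀ j, Continuous fun p : E δ => p.1.2.1 j := fun i =>
    (continuous_apply i).comp (continuous_fst.comp (continuous_snd.comp hp))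
  have h3 : ∀ i, Continuous fun p : E δ => p.1.2.2.1 i := fun i =>
    (continuous_apply i).comp (continuous_fst.comp (continuous_snd.comp (continuous_snd.comp hp)))
  have h4 : ∀ i, Continuous fun p : E δ => p.1.2.2.2.1 i := fun i =>
    (continuous_apply i).comp (continuous_fst.comp (continuous_snd.comp (continuous_snd.comp
      (continuous_snd.comp hp))))
  have h5 : ∀ i, Continuous fun p : E δ => p.1.2.2.2.2 i := fun i =>
    (continuous_apply i).comp (continuous_snd.comp (continuous_snd.comp (continuous_snd.comp
      (continuous_snd.comp hp))))
  have hb : Continuous fun p : E δ => bStd p.1 := by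
    refine continuous_pi fun i => ?_
    fin_cases i
    · exact continuous_const
    · exact continuous_const
    · exact h2 1
  have hc : Continuous fun p : E δ => cStd p.1 := by
    refine continuous_pi fun i => ?_
    fin_cases i
    · exact (h1 1).div (h2 1) hσ
    · exact h1 2
    · exact h1 0
  have hb' : ∀ i, Continuous fun p : E δ => bStd p.1 i := fun i => (continuous_apply i).comp hb
  have hc' : ∀ i, Continuous fun p : E δ => cStd p.1 i := fun i => (continuous_apply i).comp hc
  refine Continuous.subtype_mk (continuous_const.prodMk ((continuous_pi fun i =>
    PuncturedTriangle.continuous_of.comp (continuous_outerGL hb hc i)).prodMk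
    (continuous_pi fun i => Continuous.subtype_mk ?_ _))) _
  refine Continuous.matrix_submatrix (continuous_matrix fun r k => ?_) _ _
  unfold core
  fin_cases r <;> fin_cases k <;> simp <;> fun_prop

/-- `ℚ` is homeomorphic to `𝓔`. -/
def homeomorphE (hδ : ∀ i, IsBoundaryType (δ i)) : Q δ ≃ₜ E δ where
  toFun := Quotient.lift (coords hδ) fun _ _ h => coords_orbit hδ h
  invFun p := Quotient.mk _ (stdPoint hδ p)
  left_inv := by
    rintro ⟨x⟩
    obtain ⟨e, b, c, μ, ν, h⟩ := exists_isNormal hδ x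
    have h1 : coords hδ x = ⟨_, h.coords_mem hδ⟩ := Subtype.ext (h.coords_eq hδ)
    change Quotient.mk _ (stdPoint hδ (coords hδ x)) = Quotient.mk _ x
    rw [h1]
    exact Quotient.sound (h.orbit_stdPoint hδ)
  right_inv p := by
    refine Subtype.ext (((isNormal_stdPoint hδ p).coords_eq hδ).trans ?_)
    rw [← κ_eq p.2]
    exact coordsOf_std p.2
  continuous_toFun := (continuous_coords hδ).quotient_lift _
  continuous_invFun := continuous_quotient_mk'.comp (continuous_stdPoint hδ)

/-! ### The set `𝓔` is a cell -/

variable (δ) in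
/-- The parameters `μ` in terms of `μ 0`. -/
def muOf (m : ℝ) : Fin 3 → ℝ :=
  ![m, lam (δ 0) * m / lam (δ 2), lam (δ 1) * m / lam (δ 2)]

variable (δ) in
/-- The parameters `ρ` in terms of `μ 0`. -/
def rhoOf (m : ℝ) (i : Fin 3) : ℝ :=
  1 + (tau (δ i) + muOf δ m i) * (lam (δ i) * muOf δ m i)

variable (δ) in
/-- The point of `𝓔` with given `μ 0` and `σ 0`. -/
def pointOf (m s : ℝ) : Coords :=
  (rhoOf δ m, ![s, rhoOf δ m 0 * rhoOf δ m 1 * rhoOf δ m 2 / s], fun i => lam (δ i), muOf δ m,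
    fun i => (lam (δ i) * muOf δ m i)⁻¹)

/-- Since `ρ - 1 = (τ + μ) * κ * μ`, positivity of `τ` gives `ρ > 1` for every `μ > 0`. -/
theorem pointOf_mem (hδ : ∀ i, IsBoundaryType (δ i)) {m s : ℝ} (hm : 0 < m) (hs : 0 < s) :
    pointOf δ m s ∈ E δ := by
  have hl := fun i => (hδ i).lam_pos
  have hμ : ∀ i, 0 < muOf δ m i := by
    intro i
    fin_cases i
    · exact hm
    · exact div_pos (mul_pos (hl 0) hm) (hl 2)
    · exact div_pos (mul_pos (hl 1) hm) (hl 2)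
  have hρ : ∀ i, 1 < rhoOf δ m i := fun i => by
    have := mul_pos (add_pos (hδ i).tau_pos (hμ i)) (mul_pos (hl i) (hμ i))
    rw [rhoOf]
    linarith
  have hρ' := fun i => one_pos.trans (hρ i)
  have hl0 := (hl 0).ne'
  have hl1 := (hl 1).ne'
  have hl2 := (hl 2).ne'
  have hm0 := hm.ne'
  refine ⟨hρ, fun j => ?_, hl, hμ, fun i => inv_pos.2 (mul_pos (hl i) (hμ i)),
    mul_div_cancel₀ _ hs.ne', fun i => mul_inv_cancel₀ (mul_pos (hl i) (hμ i)).ne', fun i => ?_,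
    fun i => rfl, fun i => ?_⟩
  · fin_cases j
    · exact hs
    · exact div_pos (mul_pos (mul_pos (hρ' 0) (hρ' 1)) (hρ' 2)) hs
  · fin_cases i
    · change lam (δ 0) * (lam (δ 1) * (lam (δ 0) * m / lam (δ 2)))⁻¹ *
        (lam (δ 1) * m / lam (δ 2)) = 1
      field_simp
    · change lam (δ 1) * (lam (δ 2) * (lam (δ 1) * m / lam (δ 2)))⁻¹ * m = 1
      field_simp
    · change lam (δ 2) * (lam (δ 0) * m)⁻¹ * (lam (δ 0) * m / lam (δ 2)) = 1
      field_simp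
  · change -muOf δ m i + (lam (δ i) * muOf δ m i)⁻¹ * (rhoOf δ m i - 1) = tau (δ i)
    rw [rhoOf, add_sub_cancel_left, mul_comm (tau (δ i) + _),
      inv_mul_cancel_left₀ (mul_pos (hl i) (hμ i)).ne']
    ring

theorem eq_pointOf {p : Coords} (hp : p ∈ E δ) : p = pointOf δ (p.2.2.2.1 0) (p.2.1 0) := by
  obtain ⟨ρ, σ, κ, μ, ν⟩ := p
  obtain ⟨-, hσ, hκ, hμ, hν, hρσ, hκμν, hcomp, hlam, htau⟩ := hp
  obtain rfl : κ = fun i => lam (δ i) := funext hlam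
  have hκ0 : 0 < lam (δ 0) := hκ 0
  have hκ2 : 0 < lam (δ 2) := hκ 2
  -- Comparing `κ i * μ i * ν i = 1` with the composition relation containing the same `ν i`
  -- eliminates `ν i`; `ν 0` and `ν 1` suffice.
  have hμ' : μ = muOf δ (μ 0) := by
    have c0 : lam (δ 0) * ν 1 * μ 2 = 1 := hcomp 0
    have c2 : lam (δ 2) * ν 0 * μ 1 = 1 := hcomp 2
    have k0 := hκμν 0
    have k1 := hκμν 1
    have e1 : μ 1 = lam (δ 0) * μ 0 / lam (δ 2) := by
      rw [eq_div_iff hκ2.ne']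
      apply mul_right_cancel₀ (hν 0).ne'
      linear_combination c2 - k0
    have e2 : μ 2 = lam (δ 1) * μ 0 / lam (δ 2) := by
      have : μ 2 * lam (δ 0) = lam (δ 1) * μ 1 := by
        apply mul_right_cancel₀ (hν 1).ne'
        linear_combination c0 - k1
      rw [eq_div_iff hκ2.ne']
      rw [e1] at this
      field_simp at this
      exact this
    funext i
    fin_cases i
    · rfl
    · exact e1
    · exact e2
  have hν' : ν = fun i => (lam (δ i) * muOf δ (μ 0) i)⁻¹ := by
    funext i
    rw [← hμ']
    exact eq_inv_of_mul_eq_one_left (by rw [← hκμν i]; ring)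
  have hρ' : ρ = rhoOf δ (μ 0) := by
    funext i
    rw [rhoOf, ← hμ']
    have := hκμν i
    have h1 := htau i
    linear_combination (1 - ρ i) * this + lam (δ i) * μ i * h1
  refine Prod.ext hρ' (Prod.ext (funext fun j => ?_) (Prod.ext rfl (Prod.ext hμ' hν')))
  fin_cases j
  · rfl
  · change σ 1 = rhoOf δ (μ 0) 0 * rhoOf δ (μ 0) 1 * rhoOf δ (μ 0) 2 / σ 0
    rw [← hρ', eq_div_iff (hσ 0).ne', mul_comm]
    exact hρσ

theorem continuous_muOf : Continuous (muOf δ) := by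
  refine continuous_pi fun i => ?_
  fin_cases i
  · exact continuous_id
  · exact (continuous_const.mul continuous_id).div_const _
  · exact (continuous_const.mul continuous_id).div_const _

theorem continuous_rhoOf : Continuous (rhoOf δ) := by
  refine continuous_pi fun i => ?_
  have h : Continuous fun m => muOf δ m i := (continuous_apply i).comp continuous_muOf
  unfold rhoOf
  fun_prop

/-- `𝓔` is homeomorphic to the plane, by the logarithms of `μ 0` and `σ 0`. -/
def homeomorphPlane (hδ : ∀ i, IsBoundaryType (δ i)) : E δ ≃ₜ ℝ × ℝ where
  toFun p := (Real.log (p.1.2.2.2.1 0), Real.log (p.1.2.1 0))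
  invFun q := ⟨pointOf δ (Real.exp q.1) (Real.exp q.2),
    pointOf_mem hδ (Real.exp_pos _) (Real.exp_pos _)⟩
  left_inv p := by
    refine Subtype.ext (Eq.trans ?_ (eq_pointOf p.2).symm)
    change pointOf δ (Real.exp (Real.log _)) (Real.exp (Real.log _)) = _
    rw [Real.exp_log (p.2.2.2.2.1 0), Real.exp_log (p.2.2.1 0)]
  right_inv q := Prod.ext (Real.log_exp _) (Real.log_exp _)
  continuous_toFun := by
    have hp : Continuous fun p : E δ => p.1 := continuous_subtype_val
    refine Continuous.prodMk (Continuous.log ?_ fun p => (p.2.2.2.2.1 0).ne')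
      (Continuous.log ?_ fun p => (p.2.2.1 0).ne')
    · exact (continuous_apply 0).comp (continuous_fst.comp (continuous_snd.comp (continuous_snd.comp
        (continuous_snd.comp hp))))
    · exact (continuous_apply 0).comp (continuous_fst.comp (continuous_snd.comp hp))
  continuous_invFun := by
    have h1 : Continuous fun q : ℝ × ℝ => Real.exp q.1 := Real.continuous_exp.comp continuous_fst
    have h2 : Continuous fun q : ℝ × ℝ => Real.exp q.2 := Real.continuous_exp.comp continuous_snd
    have hρ := continuous_rhoOf (δ := δ) |>.comp h1
    have hμ := continuous_muOf (δ := δ) |>.comp h1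
    have hρ' : ∀ i, Continuous fun q : ℝ × ℝ => rhoOf δ (Real.exp q.1) i := fun i =>
      (continuous_apply i).comp hρ
    refine Continuous.subtype_mk (hρ.prodMk (Continuous.prodMk (continuous_pi fun j => ?_)
      (continuous_const.prodMk (hμ.prodMk (continuous_pi fun i => ?_))))) _
    · fin_cases j
      · exact h2
      · exact (((hρ' 0).mul (hρ' 1)).mul (hρ' 2)).div h2 fun q => (Real.exp_pos _).ne'
    · refine Continuous.inv₀ (continuous_const.mul ((continuous_apply i).comp hμ)) fun q => ?_
      have h := pointOf_mem hδ (Real.exp_pos q.1) (Real.exp_pos q.2)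
      exact (mul_pos ((hδ i).lam_pos) (h.2.2.2.1 i)).ne'

end Continuity

end ProjectivePants

end

theorem mainTheorem6 (δ : Fin 3 → Matrix.SpecialLinearGroup (Fin 3) ℝ)
    (hδ : ∀ i, ProjectivePants.IsHyperbolic (δ i) ∨ ProjectivePants.IsQuasiHyperbolic (δ i) ∨
      ProjectivePants.IsParabolic (δ i)) :
    (∃ (ρ : Fin 3 → ProjectivePants.Q δ → ℝ) (σ : Fin 2 → ProjectivePants.Q δ → ℝ)
        (κ μ ν : Fin 3 → ProjectivePants.Q δ → ℝ),
      (∀ i, Continuous (ρ i)) ∧ (∀ j, Continuous (σ j)) ∧ (∀ i, Continuous (κ i)) ∧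
      (∀ i, Continuous (μ i)) ∧ (∀ i, Continuous (ν i)) ∧
      ∃ Φ : ProjectivePants.Q δ ≃ₜ ProjectivePants.E δ,
        ∀ x, (Φ x : ProjectivePants.Coords) =
          (fun i => ρ i x, fun j => σ j x, fun i => κ i x, fun i => μ i x, fun i => ν i x)) ∧
    Nonempty (ProjectivePants.E δ ≃ₜ EuclideanSpace ℝ (Fin 2)) ∧
    Nonempty (ProjectivePants.Q δ ≃ₜ EuclideanSpace ℝ (Fin 2)) := by
  have hδ' := fun i => ProjectivePants.isBoundaryType (hδ i)
  let Φ := ProjectivePants.homeomorphE hδ'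
  let Ψ : ProjectivePants.E δ ≃ₜ EuclideanSpace ℝ (Fin 2) :=
    (ProjectivePants.homeomorphPlane hδ').trans (Homeomorph.finTwoArrow.symm.trans
      (EuclideanSpace.equiv (Fin 2) ℝ).toHomeomorph.symm)
  have hΦ : Continuous fun x => (Φ x).1 := continuous_subtype_val.comp Φ.continuous
  refine ⟨⟨fun i x => (Φ x).1.1 i, fun j x => (Φ x).1.2.1 j, fun i x => (Φ x).1.2.2.1 i,
    fun i x => (Φ x).1.2.2.2.1 i, fun i x => (Φ x).1.2.2.2.2 i, fun i => ?_, fun j => ?_,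
    fun i => ?_, fun i => ?_, fun i => ?_, Φ, fun x => rfl⟩, ⟨Ψ⟩, ⟨Φ.trans Ψ⟩⟩
  · exact (continuous_apply i).comp (continuous_fst.comp hΦ)
  · exact (continuous_apply j).comp (continuous_fst.comp (continuous_snd.comp hΦ))
  · exact (continuous_apply i).comp (continuous_fst.comp (continuous_snd.comp
      (continuous_snd.comp hΦ)))
  · exact (continuous_apply i).comp (continuous_fst.comp (continuous_snd.comp (continuous_snd.comp
      (continuous_snd.comp hΦ))))
  · exact (continuous_apply i).comp (continuous_snd.comp (continuous_snd.comp (continuous_snd.comp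
      (continuous_snd.comp hΦ))))
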